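/- \textbf{Setting.} A \emph{map} is a connected planar multigraph (loops and multiple edges allowed) properly embedded in the sphere, up to homeomorphism, with one distinguished half-edge, its root; its size is its number of edges, and the vertex map (one vertex, no edge) is allowed as the map of size $0$. A \emph{tree-rooted map} is a map endowed with a spanning tree. A map is \emph{separable} if its edge set can be partitioned into two non-empty sets $E_1,E_2$ such that exactly one vertex is incident to both, and \emph{$2$-connected} otherwise. A \emph{block} of $\mathfrak m$ is a maximal $2$-connected submap of positive size, and $b(\mathfrak m)$ is the number of blocks. Let $\mathcal M_n$ (resp. $\mathcal B_n$) be the set of tree-rooted maps (resp. $2$-connected tree-rooted maps) of size $n$, $b_n=|\mathcal B_n|$, $B(y)=\sum_{n\ge 0} b_n y^n$ with radius of convergence $\rho_B$, and $M(z,u)=\sum_{n\ge 0}\sum_{\mathfrak m\in\mathcal M_n}z^n u^{b(\mathfrak m)}$. \textbf{Block tree.} Let $\mathfrak m$ be a tree-rooted map of positive size and let $\mathfrak b$ be the block containing its root, with the same root and the induced spanning tree. For each half-edge $e$ of $\mathfrak b$, incident to a vertex $x$, the pendant submap $\mathfrak m_e$ is the maximal submap of $\mathfrak m$ disjoint from $\mathfrak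 b$ except at $x$ and located in the corner of $\mathfrak b$ that follows $e$ counterclockwise around $x$; unless it is the vertex map, it is rooted at the half-edge of $\mathfrak m$ that follows $e$ counterclockwise around $x$, and it carries the induced spanning tree. The block tree $T_{\mathfrak m}$ is the decorated plane tree whose root carries $\mathfrak b$ and has one child for each half-edge $e$ of $\mathfrak b$, the subtree at this child being $T_{\mathfrak m_e}$; the block tree of the vertex map is a single node carrying the vertex map. The children are ordered by a fixed convention that orders the half-edges of each $2$-connected tree-rooted map in a way that depends only on this map; the result holds for every such convention. We write $\mathfrak b_v$ for the decoration of the node $v$ (it is the vertex map if $v$ is a leaf). \textbf{Laws.} For $u>0$ and $n\ge 0$, let $\mathbb P_n^{(u)}(\mathfrak m)=u^{b(\mathfrak m)}/[z^n]M(z,u)$ for $\mathfrak m\in\mathcal M_n$. Let $y(u)$ be the unique solution $y\in[0,\rho_B]$ of $$\frac{2yuB'(y)}{uB(y)+1-u}=1$$ if there is one, and $y(u)=\rho_B$ otherwise. Let $\mu^u$ be given by $$\mu^{u}(2j)=\frac{b_j\,y(u)^j\,u^{\mathbf 1_{j\neq 0}}}{uB(y(u))+1-u}\quad(j\ge 0),$$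 with no mass on odd integers. For a probability distribution $\mu$ on $\mathbb Z_{\ge 0}$, $GW(\mu,k)$ is the law of a Bienaymé--Galton--Watson tree with offspring distribution $\mu$ conditioned to have $k$ edges. \textbf{Proposition.} For every $u>0$ and every integer $n\ge 0$, $\mu^u$ and $\mathbb P_n^{(u)}$ are probability distributions. If $\mathrm M$ has law $\mathbb P_n^{(u)}$, $\mathrm T$ is its block tree (as a plane tree, without the decorations) and $(\mathrm B_v)_{v\in \mathrm T}$ is the family of the decorations, then: \begin{itemize} \item $\mathrm T$ has law $GW(\mu^u,2n)$; \item for every plane tree $\mathfrak t$ with $\mathbb P(\mathrm T=\mathfrak t)>0$, conditionally given $\mathrm T=\mathfrak t$, the number $k_v(\mathfrak t)$ of children of each node $v$ of $\mathfrak t$ is even, the blocks $(\mathrm B_v)_{v\in\mathfrak t}$ are independent, and for each $v\in\mathfrak t$, $\mathrm B_v$ is uniformly distributed on $\mathcal B_{k_v(\mathfrak t)/2}$. \end{itemize} -/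

import Mathlib

open MeasureTheory ProbabilityTheory

noncomputable section

namespace TreeRooted

/-! ### Rooted maps with a distinguished set of edges, on a given set of half-edges -/

/-- The combinatorial data of a rooted map with a distinguished set of edges, on the set `D` of
half-edges. `σ` sends a half-edge to the next one counterclockwise around its vertex and `α` sends a
half-edge to the other half of its edge. Vertices are the cycles of `σ`, edges are the cycles of
`α`, faces are the cycles of `σ * α`. A set of edges is an `α`-stable set of half-edges. The vertex
map has no half-edge and no root. The laws are imposed by `IsTreeRootedMap` below. -/
@[ext] structure MapData (D : Type) where
  σ : Equiv.Perm D
  α : Equiv.Perm D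
  tree : Set D
  root : Option D

namespace MapData

/-- Transport of the data along a bijection between the sets of half-edges. -/
def relabel {D D' : Type} (e : D ≃ D') (d : MapData D) : MapData D' where
  σ := (e.symm.trans d.σ).trans e
  α := (e.symm.trans d.α).trans e
  tree := e.symm ⁻¹' d.tree
  root := d.root.map e

theorem relabel_refl {D : Type} (d : MapData D) : d.relabel (Equiv.refl D) = d := by
  ext <;> simp [relabel]

theorem relabel_trans {D D' D'' : Type} (e : D ≃ D') (f : D' ≃ D'') (d : MapData D) :
    (d.relabel e).relabel f = d.relabel (e.trans f) := by
  ext <;> simp [relabel]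

/-- The vertex of a half-edge. -/
abbrev Vertex {D : Type} (d : MapData D) : Type := Quotient (Equiv.Perm.SameCycle.setoid d.σ)

abbrev Edge {D : Type} (d : MapData D) : Type := Quotient (Equiv.Perm.SameCycle.setoid d.α)

abbrev Face {D : Type} (d : MapData D) : Type :=
  Quotient (Equiv.Perm.SameCycle.setoid (d.σ * d.α))

def vertexOf {D : Type} (d : MapData D) (x : D) : d.Vertex := Quotient.mk _ x

/-- `S` is a set of edges. -/
def IsEdgeSet {D : Type} (d : MapData D) (S : Set D) : Prop := ∀ x ∈ S, d.α x ∈ S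

/-- The vertices of `x` and `y` are joined by a path that uses only edges of `S`. -/
def Linked {D : Type} (d : MapData D) (S : Set D) : D → D → Prop :=
  Relation.EqvGen fun x y => y = d.σ x ∨ (x ∈ S ∧ y = d.α x)

/-- `S` is the edge set of a spanning tree: it connects all the vertices, and it has no cycle
(removing any of its edges disconnects the endpoints of that edge). -/
structure IsSpanningTree {D : Type} (d : MapData D) (S : Set D) : Prop where
  isEdgeSet : d.IsEdgeSet S
  connected : ∀ x y, d.Linked S x y
  acyclic : ∀ x ∈ S, ¬ d.Linked (S \ {x, d.α x}) x (d.α x)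

/-- `d` is a tree-rooted map: a rooted connected map, planar by Euler's relation (which is only
asked when there is an edge, as the vertex of the vertex map carries no half-edge), with a spanning
tree. -/
structure IsTreeRootedMap {D : Type} (d : MapData D) : Prop where
  involutive : ∀ x, d.α (d.α x) = x
  fixedPointFree : ∀ x, d.α x ≠ x
  rooted : d.root = none ↔ IsEmpty D
  connected : ∀ x y, d.Linked Set.univ x y
  planar : Nonempty D → Nat.card d.Vertex + Nat.card d.Face = Nat.card d.Edge + 2
  spanning : d.IsSpanningTree d.tree

/-! ### Two-connected submaps and blocks -/

/-- The submap with edge set `S` is separable: `S` is the disjoint union of two non-empty sets of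
edges such that exactly one vertex is incident to both. -/
def Separable {D : Type} (d : MapData D) (S : Set D) : Prop :=
  ∃ E₁ E₂ : Set D, d.IsEdgeSet E₁ ∧ d.IsEdgeSet E₂ ∧ E₁.Nonempty ∧ E₂.Nonempty ∧
    Disjoint E₁ E₂ ∧ E₁ ∪ E₂ = S ∧
    ∃! v : d.Vertex, (∃ x ∈ E₁, d.vertexOf x = v) ∧ (∃ x ∈ E₂, d.vertexOf x = v)

/-- The whole map is 2-connected. -/
def IsTwoConnected {D : Type} (d : MapData D) : Prop := ¬ d.Separable Set.univ

/-- `S` is the edge set of a 2-connected submap of positive size. -/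
structure IsTwoConnectedSubmap {D : Type} (d : MapData D) (S : Set D) : Prop where
  isEdgeSet : d.IsEdgeSet S
  nonempty : S.Nonempty
  connected : ∀ x ∈ S, ∀ y ∈ S, d.Linked S x y
  not_separable : ¬ d.Separable S

/-- `S` is the edge set of a block: a maximal 2-connected submap of positive size. -/
def IsBlock {D : Type} (d : MapData D) (S : Set D) : Prop := Maximal d.IsTwoConnectedSubmap S

/-- The number of blocks. -/
def numBlocks {D : Type} (d : MapData D) : ℕ := {S : Set D | d.IsBlock S}.ncard

/-- The edge set of the block that contains the root (empty for the vertex map). -/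
def rootBlockSet {D : Type} (d : MapData D) : Set D :=
  ⋃₀ {S : Set D | d.IsBlock S ∧ ∃ r ∈ S, d.root = some r}

/-! ### Submaps as maps -/

theorem exists_return {D : Type} [Finite D] (f : Equiv.Perm D) (S : Set D) (x : S) :
    ∃ k : ℕ, 0 < k ∧ (f ^ k) (x : D) ∈ S :=
  ⟨orderOf f, orderOf_pos f, by simp [pow_orderOf_eq_one]⟩

open Classical in
/-- The first return time to `S` under the iteration of `f`. -/
def returnTime {D : Type} [Finite D] (f : Equiv.Perm D) (S : Set D) (x : S) : ℕ :=
  Nat.find (exists_return f S x)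

/-- The first point of `S` among `f x`, `f (f x)`, … -/
def returnFun {D : Type} [Finite D] (f : Equiv.Perm D) (S : Set D) (x : S) : S :=
  ⟨(f ^ returnTime f S x) (x : D), by
    classical exact (Nat.find_spec (exists_return f S x)).2⟩

theorem returnFun_aux {D : Type} [Finite D] (f : Equiv.Perm D) (S : Set D) (x y : S)
    (h : returnFun f S x = returnFun f S y) : returnTime f S y ≤ returnTime f S x := by
  classical
  by_contra hlt
  push Not at hlt
  have h' : (f ^ returnTime f S x) (x : D) = (f ^ returnTime f S y) (y : D) :=
    congrArg Subtype.val h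
  obtain ⟨m, hm⟩ := Nat.exists_eq_add_of_lt hlt
  have hxy : (x : D) = (f ^ (m + 1)) (y : D) := by
    rw [hm, add_assoc, pow_add, Equiv.Perm.mul_apply] at h'
    exact (f ^ returnTime f S x).injective h'
  have hx0 : 0 < returnTime f S x := (Nat.find_spec (exists_return f S x)).1
  have hmin : returnTime f S y ≤ m + 1 :=
    Nat.find_min' (exists_return f S y) ⟨Nat.succ_pos m, hxy ▸ x.2⟩
  omega

theorem returnFun_injective {D : Type} [Finite D] (f : Equiv.Perm D) (S : Set D) :
    Function.Injective (returnFun f S) := by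
  intro x y h
  have ht : returnTime f S x = returnTime f S y :=
    le_antisymm (returnFun_aux f S y x h.symm) (returnFun_aux f S x y h)
  have h' : (f ^ returnTime f S x) (x : D) = (f ^ returnTime f S y) (y : D) :=
    congrArg Subtype.val h
  rw [ht] at h'
  exact Subtype.ext ((f ^ returnTime f S y).injective h')

/-- The permutation of `S` that sends a point to the next point of `S` on its cycle. -/
def returnPerm {D : Type} [Finite D] (f : Equiv.Perm D) (S : Set D) : Equiv.Perm S :=
  Equiv.ofBijective (returnFun f S) (Finite.injective_iff_bijective.1 (returnFun_injective f S))

/-- The submap with edge set `S`, with the cyclic orders and the edges of the tree that it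
inherits, and with the root `r`. -/
def restrict {D : Type} [Finite D] (d : MapData D) (S : Set D) (r : Option S) : MapData S where
  σ := returnPerm d.σ S
  α := returnPerm d.α S
  tree := {x | (x : D) ∈ d.tree}
  root := r

open Classical in
/-- The block that contains the root, with the same root. -/
def rootBlock {D : Type} [Finite D] (d : MapData D) : MapData d.rootBlockSet :=
  d.restrict d.rootBlockSet
    (d.root.bind fun r => if h : r ∈ d.rootBlockSet then some ⟨r, h⟩ else none)

/-- The half-edges of the pendant submap at the half-edge `h` of the root block: the half-edges
that can be reached from the half-edge following `h`, by moving along edges and around vertices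
without ever meeting a half-edge of the root block. There is none if the half-edge following `h`
is itself in the root block. -/
def pendantSet {D : Type} (d : MapData D) (h : D) : Set D :=
  {x | d.σ h ∉ d.rootBlockSet ∧
    Relation.EqvGen
      (fun x y => x ∉ d.rootBlockSet ∧ y ∉ d.rootBlockSet ∧ (y = d.σ x ∨ y = d.α x)) (d.σ h) x}

open Classical in
/-- The pendant submap at `h`, rooted at the half-edge that follows `h` counterclockwise. -/
def pendant {D : Type} [Finite D] (d : MapData D) (h : D) : MapData (d.pendantSet h) :=
  d.restrict (d.pendantSet h)
    (if hh : d.σ h ∈ d.pendantSet h then some ⟨d.σ h, hh⟩ else none)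

end MapData

/-! ### Isomorphism classes -/

/-- Two sets of data are equivalent when a bijection between the half-edges carries one to the
other, root included. -/
instance isoSetoid : Setoid (Σ N : ℕ, MapData (Fin N)) where
  r a b := ∃ e : Fin a.1 ≃ Fin b.1, a.2.relabel e = b.2
  iseqv :=
    { refl := fun a => ⟨Equiv.refl _, MapData.relabel_refl a.2⟩
      symm := by
        rintro a b ⟨e, h⟩
        exact ⟨e.symm, by rw [← h, MapData.relabel_trans]; simp [MapData.relabel_refl]⟩
      trans := by
        rintro a b c ⟨e, h⟩ ⟨f, h'⟩
        exact ⟨e.trans f, by rw [← h', ← h, MapData.relabel_trans]⟩ }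

/-- Isomorphism classes of data on finite sets of half-edges. -/
def MapClass : Type := Quotient isoSetoid

instance : MeasurableSpace MapClass := ⊤

/-- The isomorphism class of data on any finite set of half-edges. -/
def MapData.toClass {D : Type} [Finite D] (d : MapData D) : MapClass :=
  Quotient.mk isoSetoid ⟨Nat.card D, d.relabel (Finite.equivFin D)⟩

namespace MapClass

/-- The number of half-edges. -/
def numHalfEdges (q : MapClass) : ℕ := (Quotient.out q).1

/-- A representative. All the notions below do not depend on which representative is used. -/
def rep (q : MapClass) : MapData (Fin q.numHalfEdges) := (Quotient.out q).2

/-- The number of blocks `b(m)`. -/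
def numBlocks (q : MapClass) : ℕ := q.rep.numBlocks

/-- The block that contains the root (the vertex map, for the vertex map). -/
def rootBlock (q : MapClass) : MapClass := q.rep.rootBlock.toClass

/-- The vertex map. -/
def vertexMap : MapClass := Quotient.mk isoSetoid ⟨0, ⟨1, 1, ∅, none⟩⟩

end MapClass

/-- The set of tree-rooted maps with `n` edges. -/
def maps (n : ℕ) : Set MapClass := {q | q.rep.IsTreeRootedMap ∧ q.numHalfEdges = 2 * n}

/-- The set of 2-connected tree-rooted maps with `n` edges. -/
def twoConnectedMaps (n : ℕ) : Set MapClass := {q | q ∈ maps n ∧ q.rep.IsTwoConnected}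

/-! ### The block tree -/

/-- A convention that numbers the half-edges of each map from `0` on, in a way that depends only on
its isomorphism class: each class gets a representative on a set `Fin N` of half-edges. Since a
rooted connected map has no non-trivial automorphism, this is the same as an order on the
half-edges of each (class of) tree-rooted map. -/
structure HalfEdgeOrder where
  rep : MapClass → Σ N : ℕ, MapData (Fin N)
  rep_spec : ∀ q, Quotient.mk isoSetoid (rep q) = q

namespace HalfEdgeOrder

theorem exists_iso (c : HalfEdgeOrder) {D : Type} [Finite D] (d : MapData D) :
    ∃ e : Fin (c.rep d.toClass).1 ≃ D, (c.rep d.toClass).2.relabel e = d := by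
  obtain ⟨e, he⟩ := Quotient.exact (c.rep_spec d.toClass)
  refine ⟨e.trans (Finite.equivFin D).symm, ?_⟩
  rw [← MapData.relabel_trans, he, MapData.relabel_trans]
  simp [MapData.relabel_refl]

/-- The numbering of the half-edges of `d` under the convention `c`. -/
def enum (c : HalfEdgeOrder) {D : Type} [Finite D] (d : MapData D) :
    Fin (c.rep d.toClass).1 ≃ D := (c.exists_iso d).choose

/-- The pendant submap at the `i`-th half-edge of the root block, if there is such a half-edge. -/
def child (c : HalfEdgeOrder) (q : MapClass) (i : ℕ) : Option MapClass :=
  if h : i < (c.rep q.rep.rootBlock.toClass).1 then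
    some (q.rep.pendant (c.enum q.rep.rootBlock ⟨i, h⟩)).toClass
  else none

/-- The submap of `q` that is reached by taking successively the pendant submaps with the indices
in the word `w`, if it exists. -/
def submapAt (c : HalfEdgeOrder) : MapClass → List ℕ → Option MapClass
  | q, [] => some q
  | q, i :: w => (c.child q i).bind fun q' => c.submapAt q' w

/-- The block tree of `q`, as a plane tree in Ulam–Harris coding: a node is a word, the root is the
empty word, the children of `v` are the words `v ++ [i]`. A node has one child for each half-edge of
the root block of the submap that it stands for. -/
def blockTree (c : HalfEdgeOrder) (q : MapClass) : Set (List ℕ) :=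
  {w | (c.submapAt q w).isSome}

/-- The decoration of the node `v` of the block tree: the root block of the submap at `v`, which is
the vertex map if `v` is a leaf. (The value is arbitrary if `v` is not a node.) -/
def block (c : HalfEdgeOrder) (v : List ℕ) (q : MapClass) : MapClass :=
  ((c.submapAt q v).map MapClass.rootBlock).getD MapClass.vertexMap

end HalfEdgeOrder

/-! ### Plane trees and Bienaymé–Galton–Watson trees -/

/-- The number of children of `v` in the plane tree `t`. -/
def numChildren (t : Set (List ℕ)) (v : List ℕ) : ℕ := {i : ℕ | v ++ [i] ∈ t}.ncard

/-- The plane tree in which each node `v` has `ξ v` children. -/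
def treeOfOffspring (ξ : List ℕ → ℕ) : Set (List ℕ) :=
  {w | ∀ (i : ℕ) (h : i < w.length), w[i] < ξ (w.take i)}

/-- The law of the Bienaymé–Galton–Watson tree with offspring law `μ`: the numbers of offspring are
independent with law `μ`. -/
def galtonWatson (μ : Measure ℕ) [IsProbabilityMeasure μ] : Measure (Set (List ℕ)) :=
  (Measure.infinitePi fun _ : List ℕ => μ).map treeOfOffspring

/-- The law `GW(μ, n)` of the Bienaymé–Galton–Watson tree conditioned to have `n` edges,
i.e. `n + 1` nodes. -/
def galtonWatsonCond (μ : Measure ℕ) [IsProbabilityMeasure μ] (n : ℕ) :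
    Measure (Set (List ℕ)) :=
  cond (galtonWatson μ) {t | t.encard = n + 1}

/-! ### The series of 2-connected tree-rooted maps and the offspring law -/

/-- The number `b_n` of 2-connected tree-rooted maps with `n` edges. -/
def bCoeff (n : ℕ) : ℕ := (twoConnectedMaps n).ncard

/-- `B(y) = ∑ b_j y^j`. -/
def B (y : ℝ) : ℝ := ∑' j : ℕ, (bCoeff j : ℝ) * y ^ j

/-- `B'(y) = ∑ j b_j y^(j-1)` (the terms with `j ≥ 1`, reindexed). -/
def B' (y : ℝ) : ℝ := ∑' j : ℕ, ((j : ℝ) + 1) * (bCoeff (j + 1) : ℝ) * y ^ j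

/-- The radius of convergence of `B`. -/
def rhoB : ℝ := (FormalMultilinearSeries.ofScalars ℝ fun n => (bCoeff n : ℝ)).radius.toReal

/-- The equation `2 y u B'(y) / (u B(y) + 1 - u) = 1`. -/
def CriticalEquation (u y : ℝ) : Prop := 2 * y * u * B' y / (u * B y + 1 - u) = 1

open Classical in
/-- `y(u)`: the solution of the equation in `[0, ρ_B]` if there is one, and `ρ_B` otherwise. -/
def yOf (u : ℝ) : ℝ :=
  if h : ∃ y ∈ Set.Icc 0 rhoB, CriticalEquation u y then h.choose else rhoB

/-- The measure `μ^{y,u}`, with mass `b_j y^j u^{1_{j ≠ 0}} / (u B(y) + 1 - u)` at `2 j`. -/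
def offspringAt (y u : ℝ) : Measure ℕ :=
  Measure.sum fun j : ℕ =>
    ENNReal.ofReal ((bCoeff j : ℝ) * y ^ j * (if j = 0 then 1 else u) / (u * B y + 1 - u)) •
      Measure.dirac (2 * j)

/-- The offspring law `μ^u`. -/
def offspring (u : ℝ) : Measure ℕ := offspringAt (yOf u) u

/-! ### The block-weighted law -/

/-- `[z^n] M(z, u)`, the total weight of the tree-rooted maps with `n` edges. -/
def mCoeff (n : ℕ) (u : ℝ) : ℝ := ∑' q : maps n, u ^ (q : MapClass).numBlocks

/-- The law `P_n^u` on tree-rooted maps with `n` edges. -/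
def blockLaw (n : ℕ) (u : ℝ) : Measure MapClass :=
  Measure.sum fun q : maps n =>
    ENNReal.ofReal (u ^ (q : MapClass).numBlocks / mCoeff n u) • Measure.dirac (q : MapClass)

end TreeRooted

end

/-! ### Cycle counts of permutations: products with transpositions, return permutations, excursions.
-/

namespace TreeRooted

open Equiv

/-! ### Counting the classes of a setoid -/

/-! A tree-rooted map is the same thing as a finite plane tree whose nodes carry 2-connected
tree-rooted maps, a node with a block of size j having 2j children. So, for a tree t with 2k_v
children at each node v, the maps with block tree t are in bijection with the product over v of the
sets of 2-connected maps of size k_v (`bijective_block`), and they all have as many blocks as t has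
inner nodes. Given the block tree, the law is therefore uniform on a finite product, which is
exactly independence with uniform marginals (`uniformOn_fiber`). The probability of t is the product
of the b_{k_v} u^{1[k_v ≠ 0]}, divided by [z^n]M. The Galton–Watson weight of t is the same product
of numerators times y^(∑ k_v) / Z^(2n+1), with Z = uB(y) + 1 - u. As ∑ 2k_v = 2n is the number of
edges of t, the two weights differ by a factor that depends on n and u only, and conditioning
removes it (`prod_offspringWeight`, `map_blockTree`). The precise value y(u) plays no role here:
only y(u) > 0 and the convergence of B(y(u)) are used (`yOf_spec`).

The bijection is the substance. With a map coded by the permutations σ and α, everything reduces to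
cycle counts. To take a map apart, it must be shown that the submap hanging at a corner of the root
block is attached at that corner only. A face walk from the corner leads back to the block at
another half-edge of the same vertex: by an ear argument, a link outside a block cannot join two of
its vertices (`IsBlock.sameCycle_of_linked`). Cutting the vertex between the two corners raises both
the number of vertices and the number of faces, so by the Euler inequality the result is
disconnected (`euler_inequality`, `exists_separating_set`). This combinatorial Jordan curve argument
yields the structure `Decomp`.

To put a map together, the cycle count `PermDecomp.numCycles_eq`, applied to σ and to σα, turns the
Euler relations of the parts into that of the whole. Retractions onto the parts carry connectedness
and spanning trees in both directions. Since a rooted connected map has no automorphism, numbering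
the half-edges of blocks is unambiguous, and `assemble_eq` and `assemble_spec` say that taking apart
and gluing are inverse to each other.

The analytic input is small. Tree-rooted maps of size n are coded by two bits per half-edge along
the contour of their tree, so b_n ≤ 16^n (`ncard_maps_le`). An explicit family gives b_n ≥ 1. Hence
ρ_B is positive and finite, and a continuity argument gives convergence of B at y(u), also when y(u)
= ρ_B. -/

theorem card_quotient_join {D : Type} [Finite D] (s s' : Setoid D) (a b : D)
    (hs : ∀ x y, s x y → s' x y) (hab : s' a b) (hn : ¬ s a b)
    (hmin : ∀ x y, s' x y → s x y ∨ (s x a ∧ s b y) ∨ (s x b ∧ s a y)) :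
    Nat.card (Quotient s) = Nat.card (Quotient s') + 1 := by
  classical
  -- The coarser relation only merges the classes of a and b, so it has the same classes once the
  -- class of b is dropped.
  let F : {q : Quotient s // q ≠ Quotient.mk s b} → Quotient s' := fun q =>
    Quotient.map' (s₁ := s) (s₂ := s') id hs q.1
  have hF : Function.Bijective F := by
    constructor
    · rintro ⟨p, hp⟩ ⟨q, hq⟩ h
      induction p using Quotient.inductionOn with | _ x => ?_
      induction q using Quotient.inductionOn with | _ y => ?_
      have hx : ¬ s x b := fun h => hp (Quotient.sound h)
      have hy : ¬ s y b := fun h => hq (Quotient.sound h)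
      have h' : s' x y := Quotient.exact h
      refine Subtype.ext (Quotient.sound ?_)
      rcases hmin x y h' with h | h | h
      · exact h
      · exact absurd (s.symm h.2) hy
      · exact absurd h.1 hx
    · intro q
      induction q using Quotient.inductionOn with | _ x => ?_
      by_cases hx : s x b
      · refine ⟨⟨Quotient.mk s a, fun h => hn (Quotient.exact h)⟩, Quotient.sound ?_⟩
        exact s'.trans hab (s'.symm (hs _ _ hx))
      · exact ⟨⟨Quotient.mk s x, fun h => hx (Quotient.exact h)⟩, rfl⟩
  rw [← Nat.card_congr (Equiv.ofBijective F hF)]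
  have h := Nat.card_congr (Equiv.sumCompl fun q : Quotient s => q = Quotient.mk s b)
  rw [← h, Nat.card_sum, Nat.card_unique, add_comm]

/-! ### Cycles of permutations -/

/-- The number of cycles of a permutation, fixed points included. -/
noncomputable def numCycles {D : Type} (f : Perm D) : ℕ :=
  Nat.card (Quotient (Perm.SameCycle.setoid f))

theorem sameCycle_pow {D : Type} (f : Perm D) (x : D) (k : ℕ) : f.SameCycle x ((f ^ k) x) :=
  ⟨k, by simp⟩

theorem sameCycle_self_apply {D : Type} (f : Perm D) (x : D) : f.SameCycle x (f x) :=
  ⟨1, by simp⟩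

theorem SameCycle.exists_nat {D : Type} [Finite D] {f : Perm D} {x y : D}
    (h : f.SameCycle x y) : ∃ k : ℕ, (f ^ k) x = y := by
  obtain ⟨k, _, hk⟩ := h.exists_pow_eq'
  exact ⟨k, hk⟩

theorem SameCycle.lift {D : Type} [Finite D] {f : Perm D} {R : D → D → Prop}
    (hR : Equivalence R) (hf : ∀ x, R x (f x)) {x y : D} (h : f.SameCycle x y) : R x y := by
  obtain ⟨k, rfl⟩ := SameCycle.exists_nat h
  induction k with
  | zero => exact hR.refl x
  | succ k ih =>
    rw [pow_succ', Perm.mul_apply]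
    exact hR.trans (ih (sameCycle_pow f x k)) (hf _)

theorem numCycles_eq_of_iff {D D' : Type} (f : Perm D) (g : Perm D') (e : D ≃ D')
    (h : ∀ x y, f.SameCycle x y ↔ g.SameCycle (e x) (e y)) : numCycles f = numCycles g :=
  Nat.card_congr (Quotient.congr e h)

/-- After one step from a, the modified permutation follows the f-orbit of b, and it keeps doing so
until that orbit first hits a or b. Which of the two is hit decides whether the transposition splits
a cycle or joins two. -/
theorem swap_walk {D : Type} [Finite D] [DecidableEq D] (f : Perm D) (a b : D) :
    ∃ m : ℕ, 0 < m ∧ ((f * swap a b) ^ m) a = (f ^ m) b ∧ ((f ^ m) b = a ∨ (f ^ m) b = b) ∧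
      ∀ i, 0 < i → i < m → ((f * swap a b) ^ i) a = (f ^ i) b ∧ (f ^ i) b ≠ a ∧ (f ^ i) b ≠ b := by
  have hex : ∃ m : ℕ, 0 < m ∧ ((f ^ m) b = a ∨ (f ^ m) b = b) :=
    ⟨orderOf f, orderOf_pos f, Or.inr (by simp [pow_orderOf_eq_one])⟩
  have hm := Nat.find_spec hex
  have hmin : ∀ i, 0 < i → i < Nat.find hex → (f ^ i) b ≠ a ∧ (f ^ i) b ≠ b := by
    intro i hi him
    have := Nat.find_min hex him
    tauto
  generalize Nat.find hex = m at hm hmin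
  have key : ∀ i, 0 < i → i ≤ m → ((f * swap a b) ^ i) a = (f ^ i) b := by
    intro i
    induction i with
    | zero => simp
    | succ i ih =>
      intro _ him
      rcases Nat.eq_zero_or_pos i with rfl | hi
      · simp
      · have h1 := ih hi (by omega)
        have h2 := hmin i hi (by omega)
        rw [pow_succ', Perm.mul_apply, h1, Perm.mul_apply, swap_apply_of_ne_of_ne h2.1 h2.2,
          pow_succ' f, Perm.mul_apply]
  exact ⟨m, hm.1, key m hm.1 le_rfl, hm.2, fun i h0 h1 => ⟨key i h0 h1.le, hmin i h0 h1⟩⟩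

theorem sameCycle_mul_swap_of_not {D : Type} [Finite D] [DecidableEq D] (f : Perm D) (a b : D)
    (h : ¬ f.SameCycle a b) : (f * swap a b).SameCycle a b := by
  have hab : a ≠ b := fun h' => h (h' ▸ Perm.SameCycle.refl f a)
  obtain ⟨m, -, h1, h2 | h2, -⟩ := swap_walk f a b
  · exact absurd (h2 ▸ sameCycle_pow f b m).symm h
  · have := sameCycle_pow (f * swap a b) a m
    rwa [h1, h2] at this

theorem not_sameCycle_mul_swap {D : Type} [Finite D] [DecidableEq D] (f : Perm D) (a b : D)
    (hab : a ≠ b) (h : f.SameCycle a b) : ¬ (f * swap a b).SameCycle a b := by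
  obtain ⟨m, hm, h1, h2, h3⟩ := swap_walk f a b
  have hper : ∀ (g : Perm D) (z : D), (g ^ m) z = z → ∀ k : ℕ, (g ^ k) z = (g ^ (k % m)) z := by
    intro g z hz k
    have : ∀ j : ℕ, ((g ^ m) ^ j) z = z := by
      intro j
      induction j with
      | zero => simp
      | succ j ih => rw [pow_succ, Perm.mul_apply, hz, ih]
    conv_lhs => rw [← Nat.mod_add_div k m, pow_add, pow_mul, Perm.mul_apply, this]
  -- If a is hit first, the new cycle of a closes up at time m before meeting b. If b is hit first,
  -- the f-cycle of b has closed up without meeting a, against the hypothesis.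
  rcases h2 with h2 | h2
  · intro h'
    obtain ⟨k, hk⟩ := SameCycle.exists_nat h'
    rw [hper _ a (h1.trans h2)] at hk
    rcases Nat.eq_zero_or_pos (k % m) with h0 | h0
    · rw [h0] at hk; exact hab hk
    · have := h3 _ h0 (Nat.mod_lt _ hm)
      exact this.2.2 (this.1 ▸ hk)
  · exfalso
    obtain ⟨k, hk⟩ := SameCycle.exists_nat h.symm
    rw [hper _ b h2] at hk
    rcases Nat.eq_zero_or_pos (k % m) with h0 | h0
    · rw [h0] at hk; exact hab hk.symm
    · exact (h3 _ h0 (Nat.mod_lt _ hm)).2.1 hk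

theorem numCycles_mul_swap_of_not {D : Type} [Finite D] [DecidableEq D] (f : Perm D) (a b : D)
    (h : ¬ f.SameCycle a b) : numCycles f = numCycles (f * swap a b) + 1 := by
  have hab := sameCycle_mul_swap_of_not f a b h
  have hs : ∀ x y, f.SameCycle x y → (f * swap a b).SameCycle x y := by
    intro x y hxy
    refine SameCycle.lift ⟨fun _ => .refl _ _, .symm, .trans⟩ (fun z => ?_) hxy
    by_cases hza : z = a
    · subst hza
      have := sameCycle_self_apply (f * swap z b) b
      rw [Perm.mul_apply, swap_apply_right] at this
      exact hab.trans this
    · by_cases hzb : z = b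
      · subst hzb
        have := sameCycle_self_apply (f * swap a z) a
        rw [Perm.mul_apply, swap_apply_left] at this
        exact hab.symm.trans this
      · have := sameCycle_self_apply (f * swap a b) z
        rwa [Perm.mul_apply, swap_apply_of_ne_of_ne hza hzb] at this
  refine card_quotient_join _ _ a b hs hab h ?_
  intro x y hxy
  change (f * swap a b).SameCycle x y at hxy
  have hsymm : ∀ {u v : D}, f.SameCycle u v → f.SameCycle v u := fun h => h.symm
  have htrans : ∀ {u v w : D}, f.SameCycle u v → f.SameCycle v w → f.SameCycle u w :=
    fun h => h.trans
  obtain ⟨k, rfl⟩ := SameCycle.exists_nat hxy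
  change f.SameCycle _ _ ∨ (f.SameCycle _ _ ∧ f.SameCycle _ _) ∨
    (f.SameCycle _ _ ∧ f.SameCycle _ _)
  clear hxy
  induction k with
  | zero => exact Or.inl (Perm.SameCycle.refl f x)
  | succ k ih =>
    rw [pow_succ', Perm.mul_apply]
    generalize ((f * swap a b) ^ k) x = z at ih
    rw [Perm.mul_apply]
    by_cases hza : z = a
    · subst hza
      rw [swap_apply_left]
      have := sameCycle_self_apply f b
      rcases ih with h1 | h1 | h1
      · exact Or.inr (Or.inl ⟨h1, this⟩)
      · exact absurd (hsymm h1.2) h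
      · exact Or.inl (htrans h1.1 this)
    · by_cases hzb : z = b
      · subst hzb
        rw [swap_apply_right]
        have := sameCycle_self_apply f a
        rcases ih with h1 | h1 | h1
        · exact Or.inr (Or.inr ⟨h1, this⟩)
        · exact Or.inl (htrans h1.1 this)
        · exact absurd h1.2 h
      · rw [swap_apply_of_ne_of_ne hza hzb]
        have := sameCycle_self_apply f z
        rcases ih with h1 | h1 | h1
        · exact Or.inl (htrans h1 this)
        · exact Or.inr (Or.inl ⟨h1.1, htrans h1.2 this⟩)
        · exact Or.inr (Or.inr ⟨h1.1, htrans h1.2 this⟩)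

theorem numCycles_mul_swap_of_sameCycle {D : Type} [Finite D] [DecidableEq D] (f : Perm D)
    (a b : D) (hab : a ≠ b) (h : f.SameCycle a b) :
    numCycles (f * swap a b) = numCycles f + 1 := by
  have := numCycles_mul_swap_of_not _ a b (not_sameCycle_mul_swap f a b hab h)
  rwa [mul_assoc, swap_mul_self, mul_one] at this

theorem numCycles_mul_swap_le {D : Type} [Finite D] [DecidableEq D] (f : Perm D) (a b : D) :
    numCycles (f * swap a b) ≤ numCycles f + 1 := by
  by_cases hab : a = b
  · subst hab; rw [swap_self, show Equiv.refl D = 1 from rfl, mul_one]; omega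
  · by_cases h : f.SameCycle a b
    · exact (numCycles_mul_swap_of_sameCycle f a b hab h).le
    · have := numCycles_mul_swap_of_not f a b h
      omega

/-! ### Return permutations -/

theorem returnTime_pos {D : Type} [Finite D] (f : Perm D) (S : Set D) (x : S) :
    0 < MapData.returnTime f S x := by
  classical exact (Nat.find_spec (MapData.exists_return f S x)).1

theorem returnTime_le {D : Type} [Finite D] (f : Perm D) (S : Set D) (x : S) {k : ℕ}
    (hk : 0 < k) (h : (f ^ k) (x : D) ∈ S) : MapData.returnTime f S x ≤ k := by
  classical exact Nat.find_min' (MapData.exists_return f S x) ⟨hk, h⟩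

theorem coe_returnPerm {D : Type} [Finite D] (f : Perm D) (S : Set D) (x : S) :
    (MapData.returnPerm f S x : D) = (f ^ MapData.returnTime f S x) (x : D) := rfl

theorem not_mem_of_lt_returnTime {D : Type} [Finite D] (f : Perm D) (S : Set D) (x : S) {k : ℕ}
    (hk : 0 < k) (h : k < MapData.returnTime f S x) : (f ^ k) (x : D) ∉ S :=
  fun hS => absurd (returnTime_le f S x hk hS) (by omega)

theorem coe_returnPerm_of_mem {D : Type} [Finite D] (f : Perm D) (S : Set D) (x : S)
    (h : f x ∈ S) : (MapData.returnPerm f S x : D) = f x := by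
  have h1 : MapData.returnTime f S x = 1 :=
    le_antisymm (returnTime_le f S x one_pos (by simpa using h)) (returnTime_pos f S x)
  rw [coe_returnPerm, h1, pow_one]

/-- Passing to the return permutation deletes points from the cycles but neither cuts nor merges
them. Hence its cycles count the cycles of f that meet S. -/
theorem sameCycle_returnPerm {D : Type} [Finite D] (f : Perm D) (S : Set D) (x y : S) :
    (MapData.returnPerm f S).SameCycle x y ↔ f.SameCycle (x : D) y := by
  constructor
  · intro h
    refine SameCycle.lift (R := fun x y : S => f.SameCycle (x : D) y)
      ⟨fun _ => .refl _ _, .symm, .trans⟩ (fun z => ?_) h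
    rw [coe_returnPerm]
    exact sameCycle_pow f _ _
  · intro h
    obtain ⟨k, hk⟩ := SameCycle.exists_nat h
    induction k using Nat.strong_induction_on generalizing x with
    | _ k ih =>
      rcases Nat.eq_zero_or_pos k with rfl | hk0
      · rw [show x = y from Subtype.ext hk]
      · have hle : MapData.returnTime f S x ≤ k := returnTime_le f S x hk0 (hk ▸ y.2)
        have hpos := returnTime_pos f S x
        have h' : (f ^ (k - MapData.returnTime f S x)) (MapData.returnPerm f S x : D) = y := by
          rw [coe_returnPerm, ← Perm.mul_apply, ← pow_add, Nat.sub_add_cancel hle, hk]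
        exact (sameCycle_self_apply _ x).trans
          (ih _ (by omega) _ (h' ▸ sameCycle_pow f _ _) h')

/-- The cycles of `f` that meet `S`. -/
def cyclesMeeting {D : Type} (f : Perm D) (S : Set D) : Set (Quotient (Perm.SameCycle.setoid f)) :=
  {q | ∃ x ∈ S, Quotient.mk _ x = q}

theorem mk_mem_cyclesMeeting {D : Type} (f : Perm D) (S : Set D) (x : D) :
    Quotient.mk _ x ∈ cyclesMeeting f S ↔ ∃ y ∈ S, f.SameCycle y x :=
  ⟨fun ⟨y, hy, h⟩ => ⟨y, hy, Quotient.exact h⟩, fun ⟨y, hy, h⟩ => ⟨y, hy, Quotient.sound h⟩⟩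

theorem ncard_cyclesMeeting {D : Type} [Finite D] (f : Perm D) (S : Set D) :
    (cyclesMeeting f S).ncard = numCycles (MapData.returnPerm f S) := by
  rw [← Nat.card_coe_set_eq]
  symm
  let F : Quotient (Perm.SameCycle.setoid (MapData.returnPerm f S)) → cyclesMeeting f S :=
    Quotient.lift (fun x : S => ⟨Quotient.mk _ (x : D), x, x.2, rfl⟩) (by
      intro x y h
      exact Subtype.ext (Quotient.sound ((sameCycle_returnPerm f S x y).1 h)))
  refine Nat.card_congr (Equiv.ofBijective F ⟨?_, ?_⟩)
  · intro p q h
    induction p using Quotient.inductionOn with | _ x => ?_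
    induction q using Quotient.inductionOn with | _ y => ?_
    exact Quotient.sound ((sameCycle_returnPerm f S x y).2
      (Quotient.exact (congrArg Subtype.val h)))
  · rintro ⟨_, x, hx, rfl⟩
    exact ⟨Quotient.mk _ ⟨x, hx⟩, rfl⟩

/-! ### A set of points with one excursion at each of its points -/

/-- Under the iteration of `f`, the set `P h` is entered from the point `h` of `B` only, and is left
for `B` from one point only. The sets `P h` partition the complement of `B`. -/
structure PermDecomp {D : Type} (f : Perm D) (B : Set D) (P : D → Set D) : Prop where
  disjB : ∀ {h x}, h ∈ B → x ∈ P h → x ∉ B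
  disj : ∀ {h h' x}, h ∈ B → h' ∈ B → x ∈ P h → x ∈ P h' → h = h'
  cover : ∀ {x}, x ∉ B → ∃ h ∈ B, x ∈ P h
  enter : ∀ {h}, h ∈ B → f h ∉ B → f h ∈ P h
  stay : ∀ {h x}, h ∈ B → x ∈ P h → f x ∉ B → f x ∈ P h
  exit_unique : ∀ {h x y}, h ∈ B → x ∈ P h → y ∈ P h → f x ∈ B → f y ∈ B → x = y
  empty : ∀ {h}, h ∈ B → f h ∈ B → P h = ∅

namespace PermDecomp

variable {D : Type} {f : Perm D} {B : Set D} {P : D → Set D}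

theorem eq_of_apply_mem (H : PermDecomp f B P) {h x : D} (hh : h ∈ B) (hx : x ∉ P h)
    (hfx : f x ∈ P h) : x = h := by
  by_cases hB : x ∈ B
  · exact H.disj hB hh (H.enter hB (H.disjB hh hfx)) hfx
  · obtain ⟨h', hh', hx'⟩ := H.cover hB
    have := H.disj hh hh' hfx (H.stay hh' hx' (H.disjB hh hfx))
    subst this
    exact absurd hx' hx

theorem apply_mem (H : PermDecomp f B P) {h x : D} (hh : h ∈ B) (hx : x ∈ P h) : f h ∈ P h := by
  refine H.enter hh fun hB => ?_
  rw [H.empty hh hB] at hx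
  exact hx

variable [Finite D]

/-- The last point of the excursion at `h`. -/
theorem exists_exit (H : PermDecomp f B P) {h : D} (hh : h ∈ B) (hfh : f h ∉ B) :
    ∃ p ∈ P h, f p = MapData.returnPerm f B ⟨h, hh⟩ ∧ f.SameCycle h p := by
  set t := MapData.returnTime f B ⟨h, hh⟩ with ht
  have ht1 : t ≠ 1 := by
    intro h1
    have := (MapData.returnPerm f B ⟨h, hh⟩).2
    rw [coe_returnPerm, ← ht, h1, pow_one] at this
    exact hfh this
  have ht0 : 0 < t := returnTime_pos f B ⟨h, hh⟩
  have key : ∀ i, i + 1 < t → (f ^ (i + 1)) h ∈ P h := by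
    intro i
    induction i with
    | zero => intro _; simpa using H.enter hh hfh
    | succ i ih =>
      intro hi
      have h1 := ih (by omega)
      have h2 := not_mem_of_lt_returnTime f B ⟨h, hh⟩ (Nat.succ_pos (i + 1)) hi
      rw [pow_succ', Perm.mul_apply]
      refine H.stay hh h1 ?_
      rwa [Nat.succ_eq_add_one, pow_succ', Perm.mul_apply] at h2
  obtain ⟨j, hj⟩ : ∃ j, t = j + 2 := ⟨t - 2, by omega⟩
  refine ⟨(f ^ (j + 1)) h, key j (by omega), ?_, sameCycle_pow f h _⟩
  rw [coe_returnPerm, ← ht, hj, ← Perm.mul_apply, ← pow_succ']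

theorem apply_exit (H : PermDecomp f B P) {h x : D} (hh : h ∈ B) (hx : x ∈ P h) (hfx : f x ∈ B) :
    f x = MapData.returnPerm f B ⟨h, hh⟩ ∧ f.SameCycle h x := by
  have := H.apply_mem hh hx
  obtain ⟨p, hp, hfp, hc⟩ := H.exists_exit hh (H.disjB hh this)
  have hxp : x = p := H.exit_unique hh hx hp hfx (hfp ▸ Subtype.coe_prop _)
  rw [hxp]
  exact ⟨hfp, hc⟩

/-- The part at h can be entered from h only, so after leaving it the orbit comes back to it right
after h. -/
theorem returnPerm_exit (H : PermDecomp f B P) {h x : D} (hh : h ∈ B) (hx : x ∈ P h)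
    (hfx : f x ∈ B) : (MapData.returnPerm f (P h) ⟨x, hx⟩ : D) = f h := by
  set t := MapData.returnTime f (P h) ⟨x, hx⟩ with ht
  have ht0 : 0 < t := returnTime_pos f (P h) ⟨x, hx⟩
  have hmem := (MapData.returnPerm f (P h) ⟨x, hx⟩).2
  rw [coe_returnPerm, ← ht] at hmem ⊢
  have ht1 : t ≠ 1 := by
    intro h1
    rw [h1, pow_one] at hmem
    exact H.disjB hh hmem hfx
  obtain ⟨j, hj⟩ : ∃ j, t = j + 2 := ⟨t - 2, by omega⟩
  have hn := not_mem_of_lt_returnTime f (P h) ⟨x, hx⟩ (Nat.succ_pos j) (by omega)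
  rw [hj, pow_succ', Perm.mul_apply] at hmem ⊢
  rw [H.eq_of_apply_mem hh hn hmem]

/-- A cycle that leaves the part goes through its unique exit, which lies on the cycle of h. For
vertices this says that the part meets the rest of the map at the vertex of h only. -/
theorem sameCycle_of_mem_of_not_mem (H : PermDecomp f B P) {h x y : D} (hh : h ∈ B)
    (hx : x ∈ P h) (hy : y ∉ P h) (hxy : f.SameCycle x y) : f.SameCycle x h := by
  obtain ⟨k, rfl⟩ := SameCycle.exists_nat hxy
  clear hxy
  induction k with
  | zero => exact absurd hx hy
  | succ k ih =>
    by_cases hk : (f ^ k) x ∈ P h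
    · rw [pow_succ', Perm.mul_apply] at hy
      have hB : f ((f ^ k) x) ∈ B := by
        by_contra hB
        exact hy (H.stay hh hk hB)
      exact (sameCycle_pow f x k).trans (H.apply_exit hh hk hB).2.symm
    · exact ih hk

theorem mk_mem_cyclesMeeting_inter (H : PermDecomp f B P) {h : D} (hh : h ∈ B)
    {q : Quotient (Perm.SameCycle.setoid f)} (hq : q ∈ cyclesMeeting f (P h)) :
    q ∈ cyclesMeeting f B ↔ q = Quotient.mk _ h := by
  obtain ⟨x, hx, rfl⟩ := hq
  constructor
  · rintro ⟨y, hy, hyx⟩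
    exact Quotient.sound (H.sameCycle_of_mem_of_not_mem hh hx (fun h' => H.disjB hh h' hy)
      (Quotient.exact hyx.symm))
  · intro h'
    exact ⟨h, hh, h'.symm⟩

open Classical in
-- The cycles of f either meet B or stay inside one part. Those that meet a given non-empty part all
-- avoid B, except the cycle of h, which is thus counted once by B and once by that part.
theorem numCycles_eq (H : PermDecomp f B P) :
    numCycles f + ∑ᶠ h : B, (if (P h).Nonempty then 1 else 0) =
      numCycles (MapData.returnPerm f B) + ∑ᶠ h : B, numCycles (MapData.returnPerm f (P h)) := by
  have := Fintype.ofFinite B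
  rw [finsum_eq_sum_of_fintype, finsum_eq_sum_of_fintype]
  have h1 : numCycles f = (cyclesMeeting f B).ncard + ((cyclesMeeting f B)ᶜ).ncard :=
    (Set.ncard_add_ncard_compl _).symm
  have h2 : (cyclesMeeting f B)ᶜ = ⋃ h : B, (cyclesMeeting f (P h) \ cyclesMeeting f B) := by
    ext q
    simp only [Set.mem_compl_iff, Set.mem_iUnion, Set.mem_sdiff, exists_and_right, iff_and_self]
    intro hq
    induction q using Quotient.inductionOn with | _ x => ?_
    obtain ⟨h, hh, hx⟩ := H.cover (x := x) fun hx => hq ⟨x, hx, rfl⟩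
    exact ⟨⟨h, hh⟩, x, hx, rfl⟩
  have h3 : ((cyclesMeeting f B)ᶜ).ncard =
      ∑ h : B, (cyclesMeeting f (P h) \ cyclesMeeting f B).ncard := by
    rw [h2, ← Nat.card_coe_set_eq, Nat.card_congr (Set.unionEqSigmaOfDisjoint ?_), Nat.card_sigma]
    · simp only [Nat.card_coe_set_eq]
    · rintro ⟨h, hh⟩ ⟨h', hh'⟩ hne
      refine Set.disjoint_left.2 ?_
      rintro _ ⟨⟨x, hx, rfl⟩, hxB⟩ ⟨⟨y, hy, hyx⟩, -⟩
      refine hxB ⟨h, hh, Quotient.sound ?_⟩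
      refine (H.sameCycle_of_mem_of_not_mem hh hx (fun h'' => hne ?_)
        (Quotient.exact hyx.symm)).symm
      exact Subtype.ext (H.disj hh hh' h'' hy)
  have h4 : ∀ h : B, (cyclesMeeting f (P h) \ cyclesMeeting f B).ncard +
      (if (P h).Nonempty then 1 else 0) = numCycles (MapData.returnPerm f (P h)) := by
    rintro ⟨h, hh⟩
    rw [← ncard_cyclesMeeting]
    split_ifs with hne
    · obtain ⟨x, hx⟩ := hne
      have hmem : Quotient.mk _ h ∈ cyclesMeeting f (P h) :=
        (mk_mem_cyclesMeeting _ _ _).2 ⟨f h, H.apply_mem hh hx, (sameCycle_self_apply f h).symm⟩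
      have : cyclesMeeting f (P h) \ cyclesMeeting f B =
          cyclesMeeting f (P h) \ {Quotient.mk _ h} := by
        ext q
        simp only [Set.mem_sdiff, Set.mem_singleton_iff, and_congr_right_iff]
        exact fun hq => not_congr (H.mk_mem_cyclesMeeting_inter hh hq)
      rw [this, Set.ncard_sdiff_singleton_add_one hmem]
    · have : P h = ∅ := Set.not_nonempty_iff_eq_empty.1 hne
      have : cyclesMeeting f (P h) = ∅ := by
        ext q
        simp [cyclesMeeting, this]
      simp [this]
  rw [h1, h3, ncard_cyclesMeeting, ← Finset.sum_congr rfl fun h _ => h4 h,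
    Finset.sum_add_distrib]
  ring

end PermDecomp

end TreeRooted

/-! ### Links, edge sets and Euler's relation for submaps. -/

namespace TreeRooted

open Equiv

namespace MapData

variable {D : Type} {d : MapData D}

/-! ### Linked half-edges -/

theorem Linked.refl (d : MapData D) (S : Set D) (x : D) : d.Linked S x x :=
  Relation.EqvGen.refl x

theorem Linked.symm {S : Set D} {x y : D} (h : d.Linked S x y) : d.Linked S y x :=
  Relation.EqvGen.symm _ _ h

theorem Linked.trans {S : Set D} {x y z : D} (h : d.Linked S x y) (h' : d.Linked S y z) :
    d.Linked S x z :=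
  Relation.EqvGen.trans _ _ _ h h'

theorem Linked.sigma (d : MapData D) (S : Set D) (x : D) : d.Linked S x (d.σ x) :=
  Relation.EqvGen.rel _ _ (Or.inl rfl)

theorem Linked.alpha (d : MapData D) {S : Set D} {x : D} (hx : x ∈ S) : d.Linked S x (d.α x) :=
  Relation.EqvGen.rel _ _ (Or.inr ⟨hx, rfl⟩)

theorem Linked.equivalence (d : MapData D) (S : Set D) : Equivalence (d.Linked S) :=
  ⟨Linked.refl d S, Linked.symm, Linked.trans⟩

theorem eqvGen_lift {r R : D → D → Prop} (hR : Equivalence R) (h : ∀ x y, r x y → R x y)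
    {x y : D} (hxy : Relation.EqvGen r x y) : R x y := by
  induction hxy with
  | rel x y h' => exact h x y h'
  | refl x => exact hR.refl x
  | symm x y _ ih => exact hR.symm ih
  | trans x y z _ _ ih ih' => exact hR.trans ih ih'

theorem Linked.lift {S : Set D} {R : D → D → Prop} (hR : Equivalence R)
    (hσ : ∀ x, R x (d.σ x)) (hα : ∀ x ∈ S, R x (d.α x)) {x y : D} (h : d.Linked S x y) : R x y := by
  refine eqvGen_lift hR ?_ h
  rintro x y (rfl | ⟨hx, rfl⟩)
  · exact hσ x
  · exact hα x hx

theorem Linked.mono {S S' : Set D} (hS : S ⊆ S') {x y : D} (h : d.Linked S x y) :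
    d.Linked S' x y :=
  h.lift (Linked.equivalence d S') (Linked.sigma d S') fun _ hx => Linked.alpha d (hS hx)

theorem Linked.of_sameCycle [Finite D] {S : Set D} {x y : D} (h : d.σ.SameCycle x y) :
    d.Linked S x y :=
  SameCycle.lift (Linked.equivalence d S) (Linked.sigma d S) h

/-- The setoid of linked half-edges. -/
def linkedSetoid (d : MapData D) (S : Set D) : Setoid D := ⟨d.Linked S, Linked.equivalence d S⟩

/-- The number of connected components of the map with all the vertices and the edges of `S`. -/
noncomputable def numComponents (d : MapData D) (S : Set D) : ℕ :=
  Nat.card (Quotient (d.linkedSetoid S))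

/-! ### Sets of edges -/

theorem IsEdgeSet.mem_iff (hα : ∀ x, d.α (d.α x) = x) {S : Set D} (hS : d.IsEdgeSet S) (x : D) :
    d.α x ∈ S ↔ x ∈ S :=
  ⟨fun h => hα x ▸ hS _ h, hS x⟩

theorem IsEdgeSet.union {S T : Set D} (hS : d.IsEdgeSet S) (hT : d.IsEdgeSet T) :
    d.IsEdgeSet (S ∪ T) :=
  fun x hx => hx.imp (hS x) (hT x)

theorem IsEdgeSet.inter {S T : Set D} (hS : d.IsEdgeSet S) (hT : d.IsEdgeSet T) :
    d.IsEdgeSet (S ∩ T) :=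
  fun x hx => ⟨hS x hx.1, hT x hx.2⟩

theorem isEdgeSet_univ (d : MapData D) : d.IsEdgeSet Set.univ := fun _ _ => trivial

theorem isEdgeSet_empty (d : MapData D) : d.IsEdgeSet ∅ := fun _ h => h.elim

theorem isEdgeSet_pair (hα : ∀ x, d.α (d.α x) = x) (x : D) : d.IsEdgeSet {x, d.α x} := by
  rintro y (rfl | rfl)
  · exact Or.inr rfl
  · exact Or.inl (hα _)

open Classical in
/-- The involution that exchanges the two halves of the edges of `S`, and fixes the other
half-edges. -/
noncomputable def edgePerm (d : MapData D) (S : Set D) : Perm D :=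
  if h : Function.Involutive (fun x => if x ∈ S then d.α x else x) then h.toPerm else 1

open Classical in
theorem edgePerm_apply (hα : ∀ x, d.α (d.α x) = x) {S : Set D} (hS : d.IsEdgeSet S) (x : D) :
    d.edgePerm S x = if x ∈ S then d.α x else x := by
  have h : Function.Involutive (fun x => if x ∈ S then d.α x else x) := by
    intro x
    by_cases hx : x ∈ S
    · simp [hx, hS x hx, hα]
    · simp [hx]
  rw [edgePerm, dif_pos h]
  rfl

theorem edgePerm_of_mem (hα : ∀ x, d.α (d.α x) = x) {S : Set D} (hS : d.IsEdgeSet S) {x : D}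
    (hx : x ∈ S) : d.edgePerm S x = d.α x := by
  classical rw [edgePerm_apply hα hS, if_pos hx]

theorem edgePerm_of_not_mem (hα : ∀ x, d.α (d.α x) = x) {S : Set D} (hS : d.IsEdgeSet S) {x : D}
    (hx : x ∉ S) : d.edgePerm S x = x := by
  classical rw [edgePerm_apply hα hS, if_neg hx]

theorem edgePerm_univ (hα : ∀ x, d.α (d.α x) = x) : d.edgePerm Set.univ = d.α := by
  ext x
  rw [edgePerm_of_mem hα d.isEdgeSet_univ (Set.mem_univ x)]

theorem edgePerm_empty (hα : ∀ x, d.α (d.α x) = x) : d.edgePerm ∅ = 1 := by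
  ext x
  rw [edgePerm_of_not_mem hα d.isEdgeSet_empty (Set.notMem_empty x), Perm.one_apply]

/-- Adding an edge is multiplication by a transposition, so the face count changes by one in a
controlled direction. This drives all the inductions on edge sets. -/
theorem edgePerm_union_pair [DecidableEq D] (hα : ∀ x, d.α (d.α x) = x) {S : Set D}
    (hS : d.IsEdgeSet S) {x : D} (hx : x ∉ S) :
    d.edgePerm (S ∪ {x, d.α x}) = d.edgePerm S * swap x (d.α x) := by
  have hαx : d.α x ∉ S := fun h => hx ((hS.mem_iff hα x).1 h)
  have hU := hS.union (isEdgeSet_pair hα x)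
  ext y
  rw [Perm.mul_apply]
  by_cases h1 : y = x
  · subst h1
    rw [edgePerm_of_mem hα hU (Or.inr (Or.inl rfl)), swap_apply_left,
      edgePerm_of_not_mem hα hS hαx]
  · by_cases h2 : y = d.α x
    · subst h2
      rw [edgePerm_of_mem hα hU (Or.inr (Or.inr rfl)), swap_apply_right,
        edgePerm_of_not_mem hα hS hx, hα]
    · rw [swap_apply_of_ne_of_ne h1 h2]
      by_cases h3 : y ∈ S
      · rw [edgePerm_of_mem hα hU (Or.inl h3), edgePerm_of_mem hα hS h3]
      · rw [edgePerm_of_not_mem hα hS h3, edgePerm_of_not_mem hα hU]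
        rintro (h | h | h)
        exacts [h3 h, h1 h, h2 h]

theorem ncard_union_pair [Finite D] (hα : ∀ x, d.α (d.α x) = x) (hf : ∀ x, d.α x ≠ x) {S : Set D}
    (hS : d.IsEdgeSet S) {x : D} (hx : x ∉ S) : (S ∪ {x, d.α x}).ncard = S.ncard + 2 := by
  rw [Set.ncard_union_eq, Set.ncard_pair (hf x).symm]
  rw [Set.disjoint_left]
  rintro y hy (rfl | rfl)
  · exact hx hy
  · exact hx ((hS.mem_iff hα x).1 hy)

theorem edgeSet_induction [Finite D] (hα : ∀ x, d.α (d.α x) = x) {S S' : Set D}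
    (hS : d.IsEdgeSet S) (hS' : d.IsEdgeSet S') (hSS : S ⊆ S') {p : Set D → Prop} (h0 : p S)
    (step : ∀ U, d.IsEdgeSet U → S ⊆ U → U ⊆ S' → ∀ x ∈ S', x ∉ U → p U → p (U ∪ {x, d.α x})) :
    p S' := by
  generalize hn : (S' \ S).ncard = n
  induction n using Nat.strong_induction_on generalizing S with
  | _ n ih =>
    by_cases hex : ∃ x ∈ S', x ∉ S
    · obtain ⟨x, hx', hx⟩ := hex
      have hsub : S ∪ {x, d.α x} ⊆ S' := by
        rintro y (hy | rfl | rfl)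
        exacts [hSS hy, hx', hS' x hx']
      refine ih _ ?_ (hS.union (isEdgeSet_pair hα x)) hsub
        (step S hS subset_rfl hSS x hx' hx h0)
        (fun U hU hSU => step U hU (Set.subset_union_left.trans hSU)) rfl
      rw [← hn]
      refine Set.ncard_lt_ncard (Set.ssubset_iff_of_subset ?_ |>.2 ⟨x, ⟨hx', hx⟩, ?_⟩)
      · exact fun y hy => ⟨hy.1, fun h => hy.2 (Or.inl h)⟩
      · exact fun h => h.2 (Or.inr (Or.inl rfl))
    · push Not at hex
      rwa [← Set.Subset.antisymm hSS hex]

/-! ### Components when an edge is added -/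

theorem linked_union_pair (hα : ∀ x, d.α (d.α x) = x) {S : Set D} {a x y : D}
    (h : d.Linked (S ∪ {a, d.α a}) x y) : d.Linked S x y ∨
      (d.Linked S x a ∧ d.Linked S (d.α a) y) ∨ (d.Linked S x (d.α a) ∧ d.Linked S a y) := by
  have key : Equivalence fun x y => d.Linked S x y ∨
      (d.Linked S x a ∧ d.Linked S (d.α a) y) ∨ (d.Linked S x (d.α a) ∧ d.Linked S a y) := by
    refine ⟨fun x => Or.inl (Linked.refl d S x), ?_, ?_⟩
    · rintro x y (h | ⟨h, h'⟩ | ⟨h, h'⟩)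
      exacts [Or.inl h.symm, Or.inr (Or.inr ⟨h'.symm, h.symm⟩),
        Or.inr (Or.inl ⟨h'.symm, h.symm⟩)]
    · rintro x y z (h | ⟨h, h'⟩ | ⟨h, h'⟩) (k | ⟨k, k'⟩ | ⟨k, k'⟩)
      · exact Or.inl (h.trans k)
      · exact Or.inr (Or.inl ⟨h.trans k, k'⟩)
      · exact Or.inr (Or.inr ⟨h.trans k, k'⟩)
      · exact Or.inr (Or.inl ⟨h, h'.trans k⟩)
      · exact Or.inr (Or.inl ⟨h, k'⟩)
      · exact Or.inl (h.trans k')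
      · exact Or.inr (Or.inr ⟨h, h'.trans k⟩)
      · exact Or.inl (h.trans k')
      · exact Or.inr (Or.inr ⟨h, k'⟩)
  refine h.lift key (fun x => Or.inl (Linked.sigma d S x)) ?_
  rintro x (hx | rfl | rfl)
  · exact Or.inl (Linked.alpha d hx)
  · exact Or.inr (Or.inl ⟨Linked.refl d S _, Linked.refl d S _⟩)
  · exact Or.inr (Or.inr ⟨Linked.refl d S _, by rw [hα]; exact Linked.refl d S _⟩)

theorem numComponents_of_not_linked [Finite D] (hα : ∀ x, d.α (d.α x) = x) {S : Set D} {x : D}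
    (h : ¬ d.Linked S x (d.α x)) :
    d.numComponents S = d.numComponents (S ∪ {x, d.α x}) + 1 :=
  card_quotient_join _ _ x (d.α x) (fun _ _ h => Linked.mono Set.subset_union_left h)
    (Linked.alpha d (Or.inr (Or.inl rfl))) h fun _ _ h' => linked_union_pair hα h'

theorem numComponents_of_linked (hα : ∀ x, d.α (d.α x) = x) {S : Set D} {x : D}
    (h : d.Linked S x (d.α x)) : d.numComponents (S ∪ {x, d.α x}) = d.numComponents S := by
  have : d.linkedSetoid (S ∪ {x, d.α x}) = d.linkedSetoid S := by
    ext y z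
    refine ⟨fun h' => ?_, fun h' => Linked.mono Set.subset_union_left h'⟩
    rcases linked_union_pair hα h' with k | ⟨k, k'⟩ | ⟨k, k'⟩
    · exact k
    · exact (k.trans h).trans k'
    · exact (k.trans h.symm).trans k'
  rw [numComponents, this, numComponents]

theorem numComponents_empty [Finite D] : d.numComponents ∅ = numCycles d.σ := by
  refine Nat.card_congr (Quotient.congr (Equiv.refl D) fun x y => ⟨fun h => ?_, fun h => ?_⟩)
  · exact Linked.lift (R := d.σ.SameCycle) ⟨fun _ => .refl _ _, .symm, .trans⟩
      (sameCycle_self_apply _) (fun _ h => h.elim) h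
  · exact Linked.of_sameCycle h

theorem numComponents_eq_one [Nonempty D] {S : Set D} (h : ∀ x y, d.Linked S x y) :
    d.numComponents S = 1 := by
  rw [numComponents, Nat.card_eq_one_iff_unique]
  refine ⟨⟨fun p q => ?_⟩, ⟨Quotient.mk _ (Classical.arbitrary D)⟩⟩
  induction p using Quotient.inductionOn with | _ x => ?_
  induction q using Quotient.inductionOn with | _ y => ?_
  exact Quotient.sound (h x y)

theorem linked_of_sameCycle_mul_edgePerm [Finite D] (hα : ∀ x, d.α (d.α x) = x) {S : Set D}
    (hS : d.IsEdgeSet S) {x y : D} (h : (d.σ * d.edgePerm S).SameCycle x y) : d.Linked S x y := by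
  refine SameCycle.lift (Linked.equivalence d S) (fun z => ?_) h
  rw [Perm.mul_apply]
  by_cases hz : z ∈ S
  · rw [edgePerm_of_mem hα hS hz]
    exact (Linked.alpha d hz).trans (Linked.sigma d S _)
  · rw [edgePerm_of_not_mem hα hS hz]
    exact Linked.sigma d S _

/-! ### Euler's relation -/

/-- Four times the genus of the map with edge set S is 4c - 2V - 2F + |S|, where |S| counts
half-edges; the claim is that it cannot decrease when edges are added. An edge inside a component
creates at most one face. An edge between two components merges them and merges two faces, which
leaves the genus unchanged. -/
theorem deficiency_mono [Finite D] (hα : ∀ x, d.α (d.α x) = x) (hf : ∀ x, d.α x ≠ x)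
    {S S' : Set D} (hS : d.IsEdgeSet S) (hS' : d.IsEdgeSet S') (hSS : S ⊆ S') :
    2 * numCycles (d.σ * d.edgePerm S') + 4 * d.numComponents S + S.ncard ≤
      2 * numCycles (d.σ * d.edgePerm S) + 4 * d.numComponents S' + S'.ncard := by
  classical
  refine edgeSet_induction hα hS hS' hSS (p := fun S' =>
    2 * numCycles (d.σ * d.edgePerm S') + 4 * d.numComponents S + S.ncard ≤
      2 * numCycles (d.σ * d.edgePerm S) + 4 * d.numComponents S' + S'.ncard) le_rfl ?_
  intro U hU _ _ x _ hx ih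
  rw [edgePerm_union_pair hα hU hx, ncard_union_pair hα hf hU hx, ← mul_assoc]
  by_cases hl : d.Linked U x (d.α x)
  · rw [numComponents_of_linked hα hl]
    have := numCycles_mul_swap_le (d.σ * d.edgePerm U) x (d.α x)
    omega
  · have h1 := numComponents_of_not_linked hα hl
    have h2 := numCycles_mul_swap_of_not (d.σ * d.edgePerm U) x (d.α x)
      fun h => hl (linked_of_sameCycle_mul_edgePerm hα hU h)
    omega

theorem euler_inequality [Finite D] [Nonempty D] (hα : ∀ x, d.α (d.α x) = x)
    (hf : ∀ x, d.α x ≠ x) (hc : ∀ x y, d.Linked Set.univ x y) :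
    2 * numCycles d.σ + 2 * numCycles (d.σ * d.α) ≤ Nat.card D + 4 := by
  have h := deficiency_mono hα hf d.isEdgeSet_empty d.isEdgeSet_univ (Set.subset_univ _)
  rw [edgePerm_univ hα, edgePerm_empty hα, numComponents_empty, numComponents_eq_one hc,
    Set.ncard_empty, Set.ncard_univ, mul_one] at h
  omega

theorem numCycles_one : numCycles (1 : Perm D) = Nat.card D := by
  have hF : Function.Bijective (Quotient.mk (Perm.SameCycle.setoid (1 : Perm D))) := by
    refine ⟨fun x y h => ?_, Quotient.mk_surjective⟩
    have h' : (1 : Perm D).SameCycle x y := Quotient.exact h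
    simpa using h'
  exact (Nat.card_congr (Equiv.ofBijective _ hF)).symm

/-- Starting from the identity, each edge joins two fixed points. As σ is not involved, the count
applies to any fixed-point-free involution. -/
theorem two_mul_numCycles_alpha [Finite D] (hα : ∀ x, d.α (d.α x) = x) (hf : ∀ x, d.α x ≠ x) :
    2 * numCycles d.α = Nat.card D := by
  classical
  have h := edgeSet_induction hα d.isEdgeSet_empty d.isEdgeSet_univ (Set.subset_univ _)
    (p := fun S => 2 * numCycles (d.edgePerm S) + S.ncard = 2 * Nat.card D) (by
      rw [edgePerm_empty hα, Set.ncard_empty, numCycles_one, add_zero]) (by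
      intro U hU _ _ x _ hx ih
      rw [edgePerm_union_pair hα hU hx, ncard_union_pair hα hf hU hx]
      have := numCycles_mul_swap_of_not (d.edgePerm U) x (d.α x) (by
        intro h
        have h' : Function.IsFixedPt (d.edgePerm U) x := edgePerm_of_not_mem hα hU hx
        exact hf x (h.eq_of_left h').symm)
      omega)
  rw [edgePerm_univ hα, Set.ncard_univ] at h
  omega

theorem planar_iff [Finite D] (hα : ∀ x, d.α (d.α x) = x) (hf : ∀ x, d.α x ≠ x) :
    Nat.card d.Vertex + Nat.card d.Face = Nat.card d.Edge + 2 ↔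
      2 * numCycles d.σ + 2 * numCycles (d.σ * d.α) = Nat.card D + 4 := by
  rw [← two_mul_numCycles_alpha hα hf]
  change numCycles d.σ + numCycles (d.σ * d.α) = numCycles d.α + 2 ↔ _
  omega

/-- Euler's relation for the map with all the vertices and the edges of `S` of a planar map. -/
theorem euler_of_planar [Finite D] [Nonempty D] (hα : ∀ x, d.α (d.α x) = x)
    (hf : ∀ x, d.α x ≠ x) (hc : ∀ x y, d.Linked Set.univ x y)
    (hp : 2 * numCycles d.σ + 2 * numCycles (d.σ * d.α) = Nat.card D + 4) {S : Set D}
    (hS : d.IsEdgeSet S) :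
    4 * d.numComponents S + S.ncard =
      2 * numCycles (d.σ * d.edgePerm S) + 2 * numCycles d.σ := by
  -- The genus is zero both without edges and with all of them, and it is monotone in between.
  have h1 := deficiency_mono hα hf d.isEdgeSet_empty hS (Set.empty_subset _)
  have h2 := deficiency_mono hα hf hS d.isEdgeSet_univ (Set.subset_univ _)
  rw [edgePerm_univ hα, numComponents_eq_one hc, Set.ncard_univ] at h2
  rw [edgePerm_empty hα, numComponents_empty, Set.ncard_empty, mul_one] at h1
  omega

/-- In a forest built edge by edge, every new edge joins two components. -/
theorem numComponents_of_acyclic [Finite D] (hα : ∀ x, d.α (d.α x) = x) (hf : ∀ x, d.α x ≠ x)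
    {S : Set D} (hS : d.IsEdgeSet S) (ha : ∀ x ∈ S, ¬ d.Linked (S \ {x, d.α x}) x (d.α x)) :
    2 * d.numComponents S + S.ncard = 2 * numCycles d.σ := by
  refine edgeSet_induction hα d.isEdgeSet_empty hS (Set.empty_subset _)
    (p := fun S => 2 * d.numComponents S + S.ncard = 2 * numCycles d.σ) (by
      rw [numComponents_empty, Set.ncard_empty, add_zero]) ?_
  intro U hU _ hUS x hx hxU ih
  have hl : ¬ d.Linked U x (d.α x) := by
    refine fun h => ha x hx (Linked.mono (S' := S \ {x, d.α x}) (fun y hy => ⟨hUS hy, ?_⟩) h)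
    rintro (rfl | rfl)
    · exact hxU hy
    · exact hxU ((hU.mem_iff hα x).1 hy)
  have := numComponents_of_not_linked hα hl
  rw [ncard_union_pair hα hf hU hxU]
  omega

/-! ### Planarity of connected submaps -/

theorem card_quotient_split [Finite D] (s : Setoid D) (N : Set D)
    (hN : ∀ x y, s x y → (x ∈ N ↔ y ∈ N)) :
    Nat.card (Quotient s) = {q : Quotient s | ∃ x, x ∉ N ∧ Quotient.mk s x = q}.ncard +
      Nat.card (Quotient (s.comap (Subtype.val : N → D))) := by
  rw [← Set.ncard_add_ncard_compl {q : Quotient s | ∃ x, x ∉ N ∧ Quotient.mk s x = q}]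
  congr 1
  rw [← Nat.card_coe_set_eq]
  symm
  let F : Quotient (s.comap (Subtype.val : N → D)) →
      ({q : Quotient s | ∃ x, x ∉ N ∧ Quotient.mk s x = q}ᶜ : Set (Quotient s)) :=
    Quotient.lift (fun x : N => (⟨Quotient.mk s x, by
      rintro ⟨y, hy, hyx⟩
      exact hy ((hN _ _ (Quotient.exact hyx)).2 x.2)⟩ :
      ({q : Quotient s | ∃ x, x ∉ N ∧ Quotient.mk s x = q}ᶜ : Set (Quotient s)))) (by
      intro x y h
      exact Subtype.ext (Quotient.sound h))
  suffices hF : Function.Bijective F from Nat.card_congr (Equiv.ofBijective F hF)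
  constructor
  · intro p q h
    induction p using Quotient.inductionOn with | _ x => ?_
    induction q using Quotient.inductionOn with | _ y => ?_
    exact Quotient.sound (Quotient.exact (congrArg Subtype.val h) : s (x : D) y)
  · rintro ⟨q, hq⟩
    induction q using Quotient.inductionOn with | _ x => ?_
    have hx : x ∈ N := by
      by_contra hx
      exact hq ⟨x, hx, rfl⟩
    exact ⟨Quotient.mk _ ⟨x, hx⟩, rfl⟩

/-- Until it first meets S, a walk around a vertex is also a walk along a face of the submap. -/
theorem sameCycle_mul_edgePerm_mem [Finite D] (hα : ∀ x, d.α (d.α x) = x) {S : Set D}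
    (hS : d.IsEdgeSet S) {x z : D} (hz : z ∈ S) (h : d.σ.SameCycle x z) :
    ∃ w ∈ S, (d.σ * d.edgePerm S).SameCycle x w := by
  obtain ⟨k, hk⟩ := SameCycle.exists_nat h
  clear h
  induction k generalizing x with
  | zero =>
    rw [pow_zero, Perm.one_apply] at hk
    exact ⟨x, hk ▸ hz, Perm.SameCycle.refl _ _⟩
  | succ k ih =>
    by_cases hx : x ∈ S
    · exact ⟨x, hx, Perm.SameCycle.refl _ _⟩
    · rw [pow_succ, Perm.mul_apply] at hk
      obtain ⟨w, hw, hxw⟩ := ih hk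
      have := sameCycle_self_apply (d.σ * d.edgePerm S) x
      rw [Perm.mul_apply, edgePerm_of_not_mem hα hS hx] at this
      exact ⟨w, hw, this.trans hxw⟩

/-- Each vertex that S does not touch counts for one vertex, one face and one component, so the
isolated vertices cancel from Euler's relation and S leaves a single component. -/
theorem euler_of_connected_submap [Finite D] [Nonempty D] (hα : ∀ x, d.α (d.α x) = x)
    (hf : ∀ x, d.α x ≠ x) (hc : ∀ x y, d.Linked Set.univ x y)
    (hp : 2 * numCycles d.σ + 2 * numCycles (d.σ * d.α) = Nat.card D + 4) {S : Set D}
    (hS : d.IsEdgeSet S) (hne : S.Nonempty) (hcS : ∀ x ∈ S, ∀ y ∈ S, d.Linked S x y) :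
    2 * (cyclesMeeting d.σ S).ncard + 2 * (cyclesMeeting (d.σ * d.edgePerm S) S).ncard =
      S.ncard + 4 := by
  have h := euler_of_planar hα hf hc hp hS
  set N : Set D := {x | ∀ z ∈ S, ¬ d.σ.SameCycle x z} with hN
  have hnN : ∀ x, x ∉ N ↔ ∃ z ∈ S, d.σ.SameCycle x z := by
    intro x
    simp [hN]
  have hNS : ∀ {x}, x ∈ N → x ∉ S := fun hx hxS => hx _ hxS (Perm.SameCycle.refl _ _)
  have hσN : ∀ {x y}, d.σ.SameCycle x y → (x ∈ N ↔ y ∈ N) := fun h =>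
    ⟨fun hx z hz hyz => hx z hz (h.trans hyz), fun hy z hz hxz => hy z hz (h.symm.trans hxz)⟩
  let R : D → D → Prop := fun x y => (x ∈ N ↔ y ∈ N) ∧ (x ∈ N → d.σ.SameCycle x y)
  have hR : Equivalence R := ⟨fun x => ⟨Iff.rfl, fun _ => .refl _ _⟩,
    fun h => ⟨h.1.symm, fun hy => (h.2 (h.1.2 hy)).symm⟩,
    fun h h' => ⟨h.1.trans h'.1, fun hx => (h.2 hx).trans (h'.2 (h.1.1 hx))⟩⟩
  have hLR : ∀ x y, d.Linked S x y → R x y := fun x y hxy => by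
    refine hxy.lift hR (fun x => ⟨hσN (sameCycle_self_apply _ x),
      fun _ => sameCycle_self_apply _ x⟩) (fun x hx => ⟨?_, fun h => absurd hx (hNS h)⟩)
    exact ⟨fun h => absurd hx (hNS h), fun h => absurd (hS x hx) (hNS h)⟩
  have hφL : ∀ x y, (d.σ * d.edgePerm S).SameCycle x y → d.Linked S x y :=
    fun x y h => linked_of_sameCycle_mul_edgePerm hα hS h
  have hσφ : ∀ {x y}, x ∈ N → d.σ.SameCycle x y → (d.σ * d.edgePerm S).SameCycle x y := by
    intro x y hx hxy
    refine (SameCycle.lift (R := fun x y => (x ∈ N ↔ y ∈ N) ∧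
      (x ∈ N → (d.σ * d.edgePerm S).SameCycle x y)) ⟨fun x => ⟨Iff.rfl, fun _ => .refl _ _⟩,
      fun h => ⟨h.1.symm, fun hy => (h.2 (h.1.2 hy)).symm⟩,
      fun h h' => ⟨h.1.trans h'.1, fun hx => (h.2 hx).trans (h'.2 (h.1.1 hx))⟩⟩
      (fun z => ⟨hσN (sameCycle_self_apply _ z), fun hz => ?_⟩) hxy).2 hx
    have := sameCycle_self_apply (d.σ * d.edgePerm S) z
    rwa [Perm.mul_apply, edgePerm_of_not_mem hα hS (hNS hz)] at this
  have e1 := card_quotient_split (Perm.SameCycle.setoid d.σ) N fun x y h => hσN h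
  have e2 := card_quotient_split (Perm.SameCycle.setoid (d.σ * d.edgePerm S)) N
    fun x y h => (hLR _ _ (hφL _ _ h)).1
  have e3 := card_quotient_split (d.linkedSetoid S) N fun x y h => (hLR _ _ h).1
  have c2 : (Perm.SameCycle.setoid (d.σ * d.edgePerm S)).comap (Subtype.val : N → D) =
      (Perm.SameCycle.setoid d.σ).comap Subtype.val := by
    ext x y
    exact ⟨fun h => (hLR _ _ (hφL _ _ h)).2 x.2, fun h => hσφ x.2 h⟩
  have c3 : (d.linkedSetoid S).comap (Subtype.val : N → D) =
      (Perm.SameCycle.setoid d.σ).comap Subtype.val := by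
    ext x y
    exact ⟨fun h => (hLR _ _ h).2 x.2, fun h => Linked.of_sameCycle h⟩
  have m1 : {q : Quotient (Perm.SameCycle.setoid d.σ) | ∃ x, x ∉ N ∧ Quotient.mk _ x = q} =
      cyclesMeeting d.σ S := by
    ext q
    constructor
    · rintro ⟨x, hx, rfl⟩
      obtain ⟨z, hz, hxz⟩ := (hnN x).1 hx
      exact ⟨z, hz, Quotient.sound hxz.symm⟩
    · rintro ⟨x, hx, rfl⟩
      exact ⟨x, fun h => hNS h hx, rfl⟩
  have m2 : {q : Quotient (Perm.SameCycle.setoid (d.σ * d.edgePerm S)) |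
      ∃ x, x ∉ N ∧ Quotient.mk _ x = q} = cyclesMeeting (d.σ * d.edgePerm S) S := by
    ext q
    constructor
    · rintro ⟨x, hx, rfl⟩
      obtain ⟨z, hz, hxz⟩ := (hnN x).1 hx
      obtain ⟨w, hw, hxw⟩ := sameCycle_mul_edgePerm_mem hα hS hz hxz
      exact ⟨w, hw, Quotient.sound hxw.symm⟩
    · rintro ⟨x, hx, rfl⟩
      exact ⟨x, fun h => hNS h hx, rfl⟩
  have m3 : {q : Quotient (d.linkedSetoid S) | ∃ x, x ∉ N ∧ Quotient.mk _ x = q}.ncard = 1 := by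
    obtain ⟨s, hs⟩ := hne
    rw [Set.ncard_eq_one]
    refine ⟨Quotient.mk _ s, Set.ext fun q => ⟨?_, ?_⟩⟩
    · rintro ⟨x, hx, rfl⟩
      obtain ⟨z, hz, hxz⟩ := (hnN x).1 hx
      exact Quotient.sound ((Linked.of_sameCycle hxz).trans (hcS z hz s hs))
    · rintro rfl
      exact ⟨s, fun h => hNS h hs, rfl⟩
  rw [m1] at e1
  rw [m2, c2] at e2
  rw [m3, c3] at e3
  change numCycles d.σ = _ at e1
  change numCycles (d.σ * d.edgePerm S) = _ at e2
  change d.numComponents S = _ at e3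
  omega

end MapData

end TreeRooted

/-! ### Separability, embeddings of submaps, and invariance under relabelling. -/

namespace TreeRooted

open Equiv

namespace MapData

/-! ### Separability -/

/-- Stated on half-edges, the common vertex splits into existence and uniqueness. The uniqueness
half alone is what passes to sub-partitions later on; non-emptiness of the two sides follows from
existence. -/
theorem separable_iff {D : Type} (d : MapData D) (S : Set D) : d.Separable S ↔
    ∃ E₁ E₂ : Set D, d.IsEdgeSet E₁ ∧ d.IsEdgeSet E₂ ∧ Disjoint E₁ E₂ ∧ E₁ ∪ E₂ = S ∧
      (∃ x ∈ E₁, ∃ y ∈ E₂, d.σ.SameCycle x y) ∧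
      ∀ x ∈ E₁, ∀ y ∈ E₂, ∀ x' ∈ E₁, ∀ y' ∈ E₂, d.σ.SameCycle x y → d.σ.SameCycle x' y' →
        d.σ.SameCycle x x' := by
  constructor
  · rintro ⟨E₁, E₂, h1, h2, -, -, hd, hu, v, ⟨⟨x, hx, rfl⟩, y, hy, hyx⟩, hv⟩
    refine ⟨E₁, E₂, h1, h2, hd, hu, ⟨x, hx, y, hy, Quotient.exact hyx.symm⟩, ?_⟩
    have key : ∀ x' ∈ E₁, ∀ y' ∈ E₂, d.σ.SameCycle x' y' → d.σ.SameCycle x' x :=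
      fun x' hx' y' hy' h => Quotient.exact (hv (d.vertexOf x')
        ⟨⟨x', hx', rfl⟩, y', hy', Quotient.sound h.symm⟩)
    exact fun a ha b hb a' ha' b' hb' h h' => (key a ha b hb h).trans (key a' ha' b' hb' h').symm
  · rintro ⟨E₁, E₂, h1, h2, hd, hu, ⟨x, hx, y, hy, hxy⟩, hv⟩
    refine ⟨E₁, E₂, h1, h2, ⟨x, hx⟩, ⟨y, hy⟩, hd, hu, d.vertexOf x,
      ⟨⟨x, hx, rfl⟩, y, hy, Quotient.sound hxy.symm⟩, ?_⟩
    rintro _ ⟨⟨x', hx', rfl⟩, y', hy', h'⟩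
    exact Quotient.sound (hv x' hx' y' hy' x hx y hy (Quotient.exact h'.symm) hxy)

/-! ### Embeddings of maps -/

/-- `ι` identifies `e` with a submap of `d` (vertices and edges only). -/
structure Emb {X D : Type} (e : MapData X) (d : MapData D) (ι : X → D) : Prop where
  inj : Function.Injective ι
  alpha : ∀ x, ι (e.α x) = d.α (ι x)
  sameCycle : ∀ x y, e.σ.SameCycle x y ↔ d.σ.SameCycle (ι x) (ι y)

namespace Emb

variable {X D : Type} {e : MapData X} {d : MapData D} {ι : X → D}

theorem isEdgeSet_image (H : Emb e d ι) {S : Set X} : d.IsEdgeSet (ι '' S) ↔ e.IsEdgeSet S := by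
  constructor
  · intro h x hx
    have := h _ (Set.mem_image_of_mem ι hx)
    rw [← H.alpha] at this
    exact (H.inj.mem_set_image).1 this
  · rintro h _ ⟨x, hx, rfl⟩
    exact ⟨e.α x, h x hx, H.alpha x⟩

theorem linked_image [Finite X] [Finite D] (H : Emb e d ι) {S : Set X} {x y : X} :
    d.Linked (ι '' S) (ι x) (ι y) ↔ e.Linked S x y := by
  constructor
  · intro h
    -- A link that uses only edges of the image stays at one vertex, or consists of a link inside
    -- the submap preceded and followed by turns around a vertex.
    let R : D → D → Prop := fun u w => d.σ.SameCycle u w ∨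
      ∃ x y, d.σ.SameCycle u (ι x) ∧ e.Linked S x y ∧ d.σ.SameCycle (ι y) w
    have hR : Equivalence R := by
      refine ⟨fun u => Or.inl (.refl _ _), ?_, ?_⟩
      · rintro u w (h | ⟨x, y, h1, h2, h3⟩)
        exacts [Or.inl h.symm, Or.inr ⟨y, x, h3.symm, h2.symm, h1.symm⟩]
      · rintro u w z (h | ⟨x, y, h1, h2, h3⟩) (k | ⟨x', y', k1, k2, k3⟩)
        · exact Or.inl (h.trans k)
        · exact Or.inr ⟨x', y', h.trans k1, k2, k3⟩
        · exact Or.inr ⟨x, y, h1, h2, h3.trans k⟩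
        · exact Or.inr ⟨x, y', h1, (h2.trans (Linked.of_sameCycle
            ((H.sameCycle _ _).2 (h3.trans k1)))).trans k2, k3⟩
    have := h.lift hR (fun u => Or.inl (sameCycle_self_apply _ u)) (by
      rintro _ ⟨x, hx, rfl⟩
      rw [← H.alpha]
      exact Or.inr ⟨x, e.α x, .refl _ _, Linked.alpha e hx, .refl _ _⟩)
    rcases this with h | ⟨x', y', h1, h2, h3⟩
    · exact Linked.of_sameCycle ((H.sameCycle _ _).2 h)
    · exact ((Linked.of_sameCycle ((H.sameCycle _ _).2 h1)).trans h2).trans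
        (Linked.of_sameCycle ((H.sameCycle _ _).2 h3))
  · intro h
    exact h.lift (R := fun x y => d.Linked (ι '' S) (ι x) (ι y))
      ⟨fun _ => Linked.refl d _ _, Linked.symm, Linked.trans⟩
      (fun x => Linked.of_sameCycle ((H.sameCycle _ _).1 (sameCycle_self_apply _ x)))
      (fun x hx => by rw [H.alpha]; exact Linked.alpha d (Set.mem_image_of_mem ι hx))

theorem separable_image (H : Emb e d ι) {S : Set X} :
    d.Separable (ι '' S) ↔ e.Separable S := by
  rw [separable_iff, separable_iff]
  constructor
  · rintro ⟨E₁, E₂, h1, h2, hd, hu, ⟨x, hx, y, hy, hxy⟩, hv⟩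
    have i1 : ι '' (ι ⁻¹' E₁) = E₁ := Set.image_preimage_eq_of_subset fun z hz => by
      obtain ⟨w, -, rfl⟩ := hu.subset (Or.inl hz)
      exact ⟨w, rfl⟩
    have i2 : ι '' (ι ⁻¹' E₂) = E₂ := Set.image_preimage_eq_of_subset fun z hz => by
      obtain ⟨w, -, rfl⟩ := hu.subset (Or.inr hz)
      exact ⟨w, rfl⟩
    obtain ⟨x, hx', rfl⟩ := i1.symm ▸ hx
    obtain ⟨y, hy', rfl⟩ := i2.symm ▸ hy
    refine ⟨ι ⁻¹' E₁, ι ⁻¹' E₂, H.isEdgeSet_image.1 (by rwa [i1]),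
      H.isEdgeSet_image.1 (by rwa [i2]), hd.preimage ι, ?_,
      ⟨x, hx, y, hy, (H.sameCycle _ _).2 hxy⟩, ?_⟩
    · rw [← Set.preimage_union, hu, Set.preimage_image_eq _ H.inj]
    · exact fun a ha b hb a' ha' b' hb' h h' => (H.sameCycle _ _).2
        (hv _ ha _ hb _ ha' _ hb' ((H.sameCycle _ _).1 h) ((H.sameCycle _ _).1 h'))
  · rintro ⟨E₁, E₂, h1, h2, hd, rfl, ⟨x, hx, y, hy, hxy⟩, hv⟩
    refine ⟨ι '' E₁, ι '' E₂, H.isEdgeSet_image.2 h1, H.isEdgeSet_image.2 h2,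
      (Set.disjoint_image_iff H.inj).2 hd, (Set.image_union _ _ _).symm,
      ⟨_, Set.mem_image_of_mem ι hx, _, Set.mem_image_of_mem ι hy, (H.sameCycle _ _).1 hxy⟩, ?_⟩
    rintro _ ⟨a, ha, rfl⟩ _ ⟨b, hb, rfl⟩ _ ⟨a', ha', rfl⟩ _ ⟨b', hb', rfl⟩ h h'
    exact (H.sameCycle _ _).1 (hv _ ha _ hb _ ha' _ hb' ((H.sameCycle _ _).2 h)
      ((H.sameCycle _ _).2 h'))

theorem isTwoConnectedSubmap_image [Finite X] [Finite D] (H : Emb e d ι) {S : Set X} :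
    d.IsTwoConnectedSubmap (ι '' S) ↔ e.IsTwoConnectedSubmap S := by
  constructor
  · rintro ⟨h1, h2, h3, h4⟩
    exact ⟨H.isEdgeSet_image.1 h1, h2.of_image, fun x hx y hy => H.linked_image.1
      (h3 _ (Set.mem_image_of_mem ι hx) _ (Set.mem_image_of_mem ι hy)),
      fun h => h4 (H.separable_image.2 h)⟩
  · rintro ⟨h1, h2, h3, h4⟩
    refine ⟨H.isEdgeSet_image.2 h1, h2.image ι, ?_, fun h => h4 (H.separable_image.1 h)⟩
    rintro _ ⟨x, hx, rfl⟩ _ ⟨y, hy, rfl⟩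
    exact H.linked_image.2 (h3 x hx y hy)

end Emb

theorem relabel_σ {D D' : Type} (e : D ≃ D') (d : MapData D) (x : D) :
    (d.relabel e).σ (e x) = e (d.σ x) := by simp [relabel]

theorem relabel_α {D D' : Type} (e : D ≃ D') (d : MapData D) (x : D) :
    (d.relabel e).α (e x) = e (d.α x) := by simp [relabel]

theorem mem_relabel_tree {D D' : Type} (e : D ≃ D') (d : MapData D) (x : D) :
    e x ∈ (d.relabel e).tree ↔ x ∈ d.tree := by simp [relabel]

theorem relabel_root {D D' : Type} (e : D ≃ D') (d : MapData D) :
    (d.relabel e).root = d.root.map e := rfl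

theorem relabel_eq_iff {D D' : Type} (e : D ≃ D') (d : MapData D) (d' : MapData D') :
    d.relabel e = d' ↔ (∀ x, e (d.σ x) = d'.σ (e x)) ∧ (∀ x, e (d.α x) = d'.α (e x)) ∧
      (∀ x, x ∈ d.tree ↔ e x ∈ d'.tree) ∧ d.root.map e = d'.root := by
  constructor
  · rintro rfl
    exact ⟨fun x => (relabel_σ e d x).symm, fun x => (relabel_α e d x).symm,
      fun x => (mem_relabel_tree e d x).symm, rfl⟩
  · rintro ⟨h1, h2, h3, h4⟩
    ext1
    · ext x
      obtain ⟨x, rfl⟩ := e.surjective x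
      rw [relabel_σ, h1]
    · ext x
      obtain ⟨x, rfl⟩ := e.surjective x
      rw [relabel_α, h2]
    · ext x
      obtain ⟨x, rfl⟩ := e.surjective x
      rw [mem_relabel_tree, h3]
    · exact h4

theorem relabel_symm {D D' : Type} {e : D ≃ D'} {d : MapData D} {d' : MapData D'}
    (h : d.relabel e = d') : d'.relabel e.symm = d := by
  rw [← h, relabel_trans, Equiv.self_trans_symm, relabel_refl]

theorem sameCycle_conj {D D' : Type} [Finite D] [Finite D'] (e : D ≃ D') {f : Perm D}
    {g : Perm D'} (h : ∀ x, e (f x) = g (e x)) (x y : D) :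
    f.SameCycle x y ↔ g.SameCycle (e x) (e y) := by
  have hpow : ∀ (k : ℕ) (x : D), e ((f ^ k) x) = (g ^ k) (e x) := by
    intro k x
    induction k with
    | zero => rfl
    | succ k ih => rw [pow_succ', pow_succ', Perm.mul_apply, Perm.mul_apply, h, ih]
  constructor
  · intro hxy
    obtain ⟨k, rfl⟩ := SameCycle.exists_nat hxy
    rw [hpow]
    exact sameCycle_pow _ _ _
  · intro hxy
    obtain ⟨k, hk⟩ := SameCycle.exists_nat hxy
    rw [← hpow] at hk
    rw [← e.injective hk]
    exact sameCycle_pow _ _ _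

theorem emb_relabel {D D' : Type} [Finite D] [Finite D'] (e : D ≃ D') (d : MapData D) :
    Emb d (d.relabel e) e :=
  ⟨e.injective, fun x => (relabel_α e d x).symm,
    sameCycle_conj e fun x => (relabel_σ e d x).symm⟩

theorem coe_restrict_α {D : Type} [Finite D] {d : MapData D} {S : Set D} (hS : d.IsEdgeSet S)
    (r : Option S) (x : S) : ((d.restrict S r).α x : D) = d.α x :=
  coe_returnPerm_of_mem _ _ _ (hS x x.2)

theorem emb_restrict {D : Type} [Finite D] {d : MapData D} {S : Set D} (hS : d.IsEdgeSet S)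
    (r : Option S) : Emb (d.restrict S r) d Subtype.val :=
  ⟨Subtype.val_injective, coe_restrict_α hS r, sameCycle_returnPerm d.σ S⟩

theorem isTreeRootedMap_relabel {D D' : Type} [Finite D] [Finite D'] (e : D ≃ D')
    {d : MapData D} (h : d.IsTreeRootedMap) : (d.relabel e).IsTreeRootedMap := by
  have hE := emb_relabel e d
  have hlink : ∀ (S : Set D') (x y : D), (d.relabel e).Linked S (e x) (e y) ↔
      d.Linked (e ⁻¹' S) x y := by
    intro S x y
    rw [← hE.linked_image, Set.image_preimage_eq _ e.surjective]
  have hinv : ∀ x, (d.relabel e).α ((d.relabel e).α x) = x := by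
    intro x
    obtain ⟨x, rfl⟩ := e.surjective x
    rw [relabel_α, relabel_α, h.involutive]
  have hfix : ∀ x, (d.relabel e).α x ≠ x := by
    intro x
    obtain ⟨x, rfl⟩ := e.surjective x
    rw [relabel_α]
    exact fun h' => h.fixedPointFree x (e.injective h')
  refine ⟨hinv, hfix, ?_, ?_, ?_, ?_, ?_, ?_⟩
  · rw [relabel_root, Option.map_eq_none_iff, h.rooted]
    exact ⟨fun _ => e.symm.isEmpty, fun _ => e.isEmpty⟩
  · intro x y
    obtain ⟨x, rfl⟩ := e.surjective x
    obtain ⟨y, rfl⟩ := e.surjective y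
    rw [hlink]
    exact h.connected x y
  · intro hne
    have hne' : Nonempty D := e.nonempty_congr.2 hne
    rw [planar_iff hinv hfix, ← numCycles_eq_of_iff d.σ _ e hE.sameCycle,
      ← numCycles_eq_of_iff (d.σ * d.α) _ e (sameCycle_conj e fun x => by
        rw [Perm.mul_apply, Perm.mul_apply, relabel_α, relabel_σ]), ← Nat.card_congr e]
    exact (planar_iff h.involutive h.fixedPointFree).1 (h.planar hne')
  · intro x
    obtain ⟨x, rfl⟩ := e.surjective x
    rw [relabel_α, mem_relabel_tree, mem_relabel_tree]
    exact h.spanning.isEdgeSet x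
  · intro x y
    obtain ⟨x, rfl⟩ := e.surjective x
    obtain ⟨y, rfl⟩ := e.surjective y
    rw [hlink]
    convert h.spanning.connected x y using 1
    ext z
    exact mem_relabel_tree e d z
  · intro x hx
    obtain ⟨x, rfl⟩ := e.surjective x
    rw [mem_relabel_tree] at hx
    rw [relabel_α, hlink]
    convert h.spanning.acyclic x hx using 2
    ext z
    simp [mem_relabel_tree]

theorem isBlock_relabel {D D' : Type} [Finite D] [Finite D'] (e : D ≃ D') (d : MapData D)
    (S : Set D) : (d.relabel e).IsBlock (e '' S) ↔ d.IsBlock S := by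
  have hE := emb_relabel e d
  constructor
  · rintro ⟨h1, h2⟩
    refine ⟨hE.isTwoConnectedSubmap_image.1 h1, fun T hT hST => ?_⟩
    exact (Set.image_subset_image_iff e.injective).1
      (h2 (hE.isTwoConnectedSubmap_image.2 hT) (Set.image_mono hST))
  · rintro ⟨h1, h2⟩
    refine ⟨hE.isTwoConnectedSubmap_image.2 h1, fun T hT hST => ?_⟩
    obtain ⟨T, rfl⟩ : ∃ T', T = e '' T' := ⟨e ⁻¹' T, (Set.image_preimage_eq _ e.surjective).symm⟩
    exact Set.image_mono (h2 (hE.isTwoConnectedSubmap_image.1 hT)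
      ((Set.image_subset_image_iff e.injective).1 hST))

theorem numBlocks_relabel {D D' : Type} [Finite D] [Finite D'] (e : D ≃ D') (d : MapData D) :
    (d.relabel e).numBlocks = d.numBlocks := by
  rw [numBlocks, numBlocks, ← Set.ncard_image_of_injective _ e.injective.image_injective]
  congr 1
  ext T
  constructor
  · intro hT
    obtain ⟨T, rfl⟩ : ∃ T', T = e '' T' := ⟨e ⁻¹' T, (Set.image_preimage_eq _ e.surjective).symm⟩
    exact ⟨T, (isBlock_relabel e d T).1 hT, rfl⟩
  · rintro ⟨T, hT, rfl⟩
    exact (isBlock_relabel e d T).2 hT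

theorem isTwoConnected_relabel {D D' : Type} [Finite D] [Finite D'] (e : D ≃ D') (d : MapData D) :
    (d.relabel e).IsTwoConnected ↔ d.IsTwoConnected := by
  rw [IsTwoConnected, IsTwoConnected, ← (emb_relabel e d).separable_image, Set.image_univ,
    e.range_eq_univ]

theorem mem_rootBlockSet_relabel {D D' : Type} [Finite D] [Finite D'] (e : D ≃ D')
    (d : MapData D) (x : D) : e x ∈ (d.relabel e).rootBlockSet ↔ x ∈ d.rootBlockSet := by
  constructor
  · rintro ⟨T, ⟨hT, r, hr, hroot⟩, hx⟩
    obtain ⟨T, rfl⟩ : ∃ T', T = e '' T' := ⟨e ⁻¹' T, (Set.image_preimage_eq _ e.surjective).symm⟩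
    obtain ⟨r, hr, rfl⟩ := hr
    refine ⟨T, ⟨(isBlock_relabel e d T).1 hT, r, hr, ?_⟩, (e.injective.mem_set_image).1 hx⟩
    exact Option.map_injective e.injective hroot
  · rintro ⟨T, ⟨hT, r, hr, hroot⟩, hx⟩
    exact ⟨e '' T, ⟨(isBlock_relabel e d T).2 hT, e r, Set.mem_image_of_mem e hr, by
      rw [relabel_root, hroot, Option.map_some]⟩, Set.mem_image_of_mem e hx⟩

theorem mem_pendantSet_relabel_of_mem {D D' : Type} [Finite D] [Finite D'] (e : D ≃ D')
    (d : MapData D) {h x : D} (hx : x ∈ d.pendantSet h) : e x ∈ (d.relabel e).pendantSet (e h) := by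
  obtain ⟨h1, h2⟩ := hx
  refine ⟨by rwa [relabel_σ, mem_rootBlockSet_relabel], ?_⟩
  rw [relabel_σ]
  refine eqvGen_lift (R := fun x y => Relation.EqvGen (fun x y =>
      x ∉ (d.relabel e).rootBlockSet ∧ y ∉ (d.relabel e).rootBlockSet ∧
      (y = (d.relabel e).σ x ∨ y = (d.relabel e).α x)) (e x) (e y))
    ⟨fun _ => .refl _, .symm _ _, .trans _ _ _⟩ ?_ h2
  rintro x y ⟨hx, hy, hxy⟩
  refine .rel _ _ ⟨by rwa [mem_rootBlockSet_relabel], by rwa [mem_rootBlockSet_relabel], ?_⟩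
  rcases hxy with rfl | rfl
  · exact Or.inl (relabel_σ e d x).symm
  · exact Or.inr (relabel_α e d x).symm

theorem mem_pendantSet_relabel {D D' : Type} [Finite D] [Finite D'] (e : D ≃ D')
    (d : MapData D) (h x : D) : e x ∈ (d.relabel e).pendantSet (e h) ↔ x ∈ d.pendantSet h := by
  refine ⟨fun hx => ?_, mem_pendantSet_relabel_of_mem e d⟩
  have := mem_pendantSet_relabel_of_mem e.symm _ hx
  rwa [relabel_symm rfl, e.symm_apply_apply, e.symm_apply_apply] at this

/-! ### Isomorphism classes -/

theorem toClass_eq_mk {D : Type} [Finite D] (d : MapData D) {N : ℕ} (e : D ≃ Fin N) :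
    d.toClass = Quotient.mk isoSetoid ⟨N, d.relabel e⟩ := by
  refine Quotient.sound ⟨(Finite.equivFin D).symm.trans e, ?_⟩
  change (d.relabel (Finite.equivFin D)).relabel _ = _
  rw [relabel_trans, ← Equiv.trans_assoc, Equiv.self_trans_symm, Equiv.refl_trans]

theorem toClass_relabel {D D' : Type} [Finite D] [Finite D'] (e : D ≃ D') (d : MapData D) :
    (d.relabel e).toClass = d.toClass := by
  rw [toClass_eq_mk d (e.trans (Finite.equivFin D')), ← relabel_trans]
  rfl

theorem toClass_eq_iff {D D' : Type} [Finite D] [Finite D'] (d : MapData D) (d' : MapData D') :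
    d.toClass = d'.toClass ↔ ∃ e : D ≃ D', d.relabel e = d' := by
  constructor
  · intro h
    obtain ⟨e, he⟩ := Quotient.exact h
    refine ⟨((Finite.equivFin D).trans e).trans (Finite.equivFin D').symm, ?_⟩
    change (d.relabel (Finite.equivFin D)).relabel e = d'.relabel (Finite.equivFin D') at he
    rw [← relabel_trans, ← relabel_trans, he]
    exact relabel_symm rfl
  · rintro ⟨e, rfl⟩
    exact (toClass_relabel e d).symm

/-- A conjugation preserves return times, so restriction commutes with relabelling. This makes root
blocks and pendant submaps well defined on isomorphism classes. -/
theorem relabel_restrict {D D' : Type} [Finite D] [Finite D'] (e : D ≃ D') (d : MapData D)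
    {S : Set D} {S' : Set D'} (hS : ∀ x, x ∈ S ↔ e x ∈ S') (r : Option S) (r' : Option S')
    (hr : (r.map Subtype.val).map e = r'.map Subtype.val) :
    (d.restrict S r).relabel (e.subtypeEquiv hS) = (d.relabel e).restrict S' r' := by
  have hret : ∀ (f : Perm D) (g : Perm D'), (∀ x, e (f x) = g (e x)) → ∀ x : S,
      e.subtypeEquiv hS (returnPerm f S x) = returnPerm g S' (e.subtypeEquiv hS x) := by
    intro f g hfg x
    have hpow : ∀ (k : ℕ) (x : D), e ((f ^ k) x) = (g ^ k) (e x) := by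
      intro k x
      induction k with
      | zero => rfl
      | succ k ih => rw [pow_succ', pow_succ', Perm.mul_apply, Perm.mul_apply, hfg, ih]
    have ht : returnTime f S x = returnTime g S' (e.subtypeEquiv hS x) := by
      apply le_antisymm
      · refine returnTime_le _ _ _ (returnTime_pos _ _ _) ?_
        rw [hS, hpow]
        exact (returnPerm g S' (e.subtypeEquiv hS x)).2
      · refine returnTime_le _ _ _ (returnTime_pos _ _ _) ?_
        have := (returnPerm f S x).2
        rw [hS, coe_returnPerm, hpow] at this
        exact this
    apply Subtype.ext
    rw [coe_returnPerm, ← ht]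
    exact hpow _ _
  refine (relabel_eq_iff _ _ _).2 ⟨?_, ?_, ?_, ?_⟩
  · exact hret _ _ fun x => (relabel_σ e d x).symm
  · exact hret _ _ fun x => (relabel_α e d x).symm
  · exact fun x => (mem_relabel_tree e d x).symm
  · refine Option.map_injective Subtype.val_injective ?_
    rw [Option.map_map]
    rw [Option.map_map] at hr
    exact hr

theorem toClass_restrict_eq {D D' : Type} [Finite D] [Finite D'] (e : D ≃ D') (d : MapData D)
    {S : Set D} {S' : Set D'} (hS : ∀ x, x ∈ S ↔ e x ∈ S') (r : Option S) (r' : Option S')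
    (hr : (r.map Subtype.val).map e = r'.map Subtype.val) :
    ((d.relabel e).restrict S' r').toClass = (d.restrict S r).toClass := by
  rw [← relabel_restrict e d hS r r' hr, toClass_relabel]

theorem map_val_rootBlock_root {D : Type} [Finite D] (d : MapData D) :
    d.rootBlock.root.map Subtype.val = d.root.filter fun r => @decide (r ∈ d.rootBlockSet)
      (Classical.propDecidable _) := by
  classical
  rw [rootBlock, restrict]
  cases d.root with
  | none => rfl
  | some r =>
    by_cases h : r ∈ d.rootBlockSet <;> simp [h, Option.filter]

theorem map_val_pendant_root {D : Type} [Finite D] (d : MapData D) (h : D) :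
    (d.pendant h).root.map Subtype.val =
      @ite _ (d.σ h ∈ d.pendantSet h) (Classical.propDecidable _) (some (d.σ h)) none := by
  classical
  rw [pendant, restrict]
  by_cases h' : d.σ h ∈ d.pendantSet h <;> simp [h']

theorem relabel_rootBlock {D D' : Type} [Finite D] [Finite D'] (e : D ≃ D') (d : MapData D) :
    d.rootBlock.relabel (e.subtypeEquiv fun x => (mem_rootBlockSet_relabel e d x).symm) =
      (d.relabel e).rootBlock := by
  refine relabel_restrict e d (fun x => (mem_rootBlockSet_relabel e d x).symm) _ _ ?_
  change Option.map e (Option.map Subtype.val d.rootBlock.root) =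
    Option.map Subtype.val (d.relabel e).rootBlock.root
  rw [map_val_rootBlock_root, map_val_rootBlock_root, relabel_root]
  cases d.root with
  | none => rfl
  | some r =>
    by_cases h : r ∈ d.rootBlockSet <;> simp [Option.filter, h, mem_rootBlockSet_relabel]

theorem toClass_rootBlock_relabel {D D' : Type} [Finite D] [Finite D'] (e : D ≃ D')
    (d : MapData D) : (d.relabel e).rootBlock.toClass = d.rootBlock.toClass := by
  rw [← relabel_rootBlock, toClass_relabel]

theorem toClass_pendant_relabel {D D' : Type} [Finite D] [Finite D'] (e : D ≃ D')
    (d : MapData D) (h : D) : ((d.relabel e).pendant (e h)).toClass = (d.pendant h).toClass := by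
  refine toClass_restrict_eq e d (fun x => (mem_pendantSet_relabel e d h x).symm) _ _ ?_
  change Option.map e (Option.map Subtype.val (d.pendant h).root) =
    Option.map Subtype.val ((d.relabel e).pendant (e h)).root
  rw [map_val_pendant_root, map_val_pendant_root, relabel_σ]
  by_cases h' : d.σ h ∈ d.pendantSet h <;> simp [h', mem_pendantSet_relabel]

end MapData

namespace MapClass

open MapData

theorem mk_rep (q : MapClass) : Quotient.mk isoSetoid ⟨q.numHalfEdges, q.rep⟩ = q :=
  Quotient.out_eq q

theorem toClass_rep (q : MapClass) : q.rep.toClass = q := by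
  rw [toClass_eq_mk q.rep (Equiv.refl _), relabel_refl, mk_rep]

theorem exists_relabel_eq_rep {D : Type} [Finite D] (d : MapData D) :
    ∃ e : D ≃ Fin d.toClass.numHalfEdges, d.relabel e = d.toClass.rep :=
  (toClass_eq_iff _ _).1 (toClass_rep d.toClass).symm

theorem numHalfEdges_toClass {D : Type} [Finite D] (d : MapData D) :
    d.toClass.numHalfEdges = Nat.card D := by
  obtain ⟨e, -⟩ := exists_relabel_eq_rep d
  rw [Nat.card_congr e, Nat.card_eq_fintype_card, Fintype.card_fin]

theorem isTreeRootedMap_rep_toClass {D : Type} [Finite D] (d : MapData D) :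
    d.toClass.rep.IsTreeRootedMap ↔ d.IsTreeRootedMap := by
  obtain ⟨e, he⟩ := exists_relabel_eq_rep d
  rw [← he]
  exact ⟨fun h => relabel_symm (e := e) (d := d) rfl ▸ isTreeRootedMap_relabel e.symm h,
    isTreeRootedMap_relabel e⟩

theorem isTwoConnected_rep_toClass {D : Type} [Finite D] (d : MapData D) :
    d.toClass.rep.IsTwoConnected ↔ d.IsTwoConnected := by
  obtain ⟨e, he⟩ := exists_relabel_eq_rep d
  rw [← he, isTwoConnected_relabel]

theorem numBlocks_toClass {D : Type} [Finite D] (d : MapData D) :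
    d.toClass.numBlocks = d.numBlocks := by
  obtain ⟨e, he⟩ := exists_relabel_eq_rep d
  rw [MapClass.numBlocks, ← he, numBlocks_relabel]

theorem rootBlock_toClass {D : Type} [Finite D] (d : MapData D) :
    d.toClass.rootBlock = d.rootBlock.toClass := by
  obtain ⟨e, he⟩ := exists_relabel_eq_rep d
  have key : ∀ d', d.relabel e = d' → d'.rootBlock.toClass = d.rootBlock.toClass := by
    rintro _ rfl
    exact toClass_rootBlock_relabel e d
  exact key _ he

end MapClass

end TreeRooted

/-! ### Blocks, and the decomposition of a planar map along its root block. -/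

namespace TreeRooted

open Equiv

namespace MapData

variable {D : Type} {d : MapData D}

/-! ### Two-connected submaps and blocks -/

theorem exists_sameCycle_of_connected {S E₁ E₂ : Set D}
    (h1 : d.IsEdgeSet E₁) (h2 : d.IsEdgeSet E₂) (hS : S ⊆ E₁ ∪ E₂) {x y : D}
    (hx : x ∈ E₁) (hy : y ∈ E₂) (hxS : x ∈ S) (hyS : y ∈ S) (hSe : d.IsEdgeSet S)
    (hxy : d.Linked S x y) :
    ∃ x ∈ S ∩ E₁, ∃ y ∈ S ∩ E₂, d.σ.SameCycle x y := by
  by_contra hcon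
  push Not at hcon
  let t : D → Prop := fun u => ∃ x ∈ S ∩ E₁, d.σ.SameCycle u x
  have ht1 : ∀ u ∈ S ∩ E₁, t u := fun u hu => ⟨u, hu, .refl _ _⟩
  have ht2 : ∀ u ∈ S ∩ E₂, ¬ t u := fun u hu ⟨x, hx, hux⟩ => hcon x hx u hu hux.symm
  have key : t x ↔ t y := by
    refine hxy.lift (R := fun u w => t u ↔ t w)
      ⟨fun _ => Iff.rfl, Iff.symm, Iff.trans⟩ (fun u => ?_) fun u hu => ?_
    · have := sameCycle_self_apply d.σ u
      exact ⟨fun ⟨x, hx, h⟩ => ⟨x, hx, this.symm.trans h⟩, fun ⟨x, hx, h⟩ => ⟨x, hx, this.trans h⟩⟩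
    · rcases hS hu with hu1 | hu2
      · exact iff_of_true (ht1 u ⟨hu, hu1⟩) (ht1 _ ⟨hSe u hu, h1 u hu1⟩)
      · exact iff_of_false (ht2 u ⟨hu, hu2⟩) (ht2 _ ⟨hSe u hu, h2 u hu2⟩)
  exact ht2 y ⟨hyS, hy⟩ (key.1 (ht1 x ⟨hxS, hx⟩))

/-- A 2-connected submap cannot straddle two edge sets with at most one common vertex: by
connectedness its two traces would share a vertex, and this would separate it. Every localization of
a block below goes through this fact. -/
theorem IsTwoConnectedSubmap.subset_or_subset {S E₁ E₂ : Set D}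
    (hS : d.IsTwoConnectedSubmap S) (h1 : d.IsEdgeSet E₁) (h2 : d.IsEdgeSet E₂)
    (hd : Disjoint E₁ E₂) (hSE : S ⊆ E₁ ∪ E₂)
    (hv : ∀ x ∈ E₁, ∀ y ∈ E₂, ∀ x' ∈ E₁, ∀ y' ∈ E₂, d.σ.SameCycle x y → d.σ.SameCycle x' y' →
      d.σ.SameCycle x x') : S ⊆ E₁ ∨ S ⊆ E₂ := by
  by_contra hcon
  push Not at hcon
  obtain ⟨⟨y, hyS, hy⟩, x, hxS, hx⟩ := (⟨Set.not_subset.1 hcon.1, Set.not_subset.1 hcon.2⟩ :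
    (∃ y ∈ S, y ∉ E₁) ∧ ∃ x ∈ S, x ∉ E₂)
  have hy2 : y ∈ E₂ := (hSE hyS).resolve_left hy
  have hx1 : x ∈ E₁ := (hSE hxS).resolve_right hx
  refine hS.not_separable ((separable_iff _ _).2 ⟨S ∩ E₁, S ∩ E₂, hS.isEdgeSet.inter h1,
    hS.isEdgeSet.inter h2, hd.mono Set.inter_subset_right Set.inter_subset_right, ?_,
    exists_sameCycle_of_connected h1 h2 hSE hx1 hy2 hxS hyS hS.isEdgeSet
      (hS.connected x hxS y hyS), ?_⟩)
  · rw [← Set.inter_union_distrib_left, Set.inter_eq_left.2 hSE]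
  · exact fun a ha b hb a' ha' b' hb' => hv a ha.2 b hb.2 a' ha'.2 b' hb'.2

/-- Each of the two lies on one side of any separation of the union, and the common edge forces the
same side. Hence maximal 2-connected submaps partition the edges. -/
theorem IsTwoConnectedSubmap.union {S T : Set D}
    (hS : d.IsTwoConnectedSubmap S) (hT : d.IsTwoConnectedSubmap T) {x : D} (hxS : x ∈ S)
    (hxT : x ∈ T) : d.IsTwoConnectedSubmap (S ∪ T) := by
  have hlink : ∀ y ∈ S ∪ T, d.Linked (S ∪ T) x y := by
    rintro y (hy | hy)
    · exact (hS.connected x hxS y hy).mono Set.subset_union_left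
    · exact (hT.connected x hxT y hy).mono Set.subset_union_right
  refine ⟨hS.isEdgeSet.union hT.isEdgeSet, ⟨x, Or.inl hxS⟩,
    fun y hy z hz => (hlink y hy).symm.trans (hlink z hz), fun hsep => ?_⟩
  obtain ⟨E₁, E₂, h1, h2, hd, hu, ⟨a, ha, b, hb, -⟩, hv⟩ := (separable_iff _ _).1 hsep
  have hS' := hS.subset_or_subset h1 h2 hd (hu ▸ Set.subset_union_left) hv
  have hT' := hT.subset_or_subset h1 h2 hd (hu ▸ Set.subset_union_right) hv
  have hdis := Set.disjoint_left.1 hd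
  rcases hS' with hS' | hS' <;> rcases hT' with hT' | hT'
  · exact hdis (Set.union_subset hS' hT' (hu ▸ Or.inr hb)) hb
  · exact hdis (hS' hxS) (hT' hxT)
  · exact hdis (hT' hxT) (hS' hxS)
  · exact hdis ha (Set.union_subset hS' hT' (hu ▸ Or.inl ha))

theorem isTwoConnectedSubmap_pair (hα : ∀ x, d.α (d.α x) = x) (x : D) :
    d.IsTwoConnectedSubmap {x, d.α x} := by
  have hlink : ∀ y ∈ ({x, d.α x} : Set D), d.Linked {x, d.α x} x y := by
    rintro y (rfl | rfl)
    · exact Linked.refl d _ _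
    · exact Linked.alpha d (Or.inl rfl)
  refine ⟨isEdgeSet_pair hα x, ⟨x, Or.inl rfl⟩,
    fun y hy z hz => (hlink y hy).symm.trans (hlink z hz), fun hsep => ?_⟩
  obtain ⟨E₁, E₂, h1, h2, hd, hu, ⟨a, ha, b, hb, -⟩, hv⟩ := (separable_iff _ _).1 hsep
  have key : ∀ E : Set D, d.IsEdgeSet E → ∀ a ∈ E, a ∈ ({x, d.α x} : Set D) → x ∈ E := by
    rintro E hE a ha (rfl | rfl)
    · exact ha
    · exact hα x ▸ hE _ ha
  exact Set.disjoint_left.1 hd (key E₁ h1 a ha (hu ▸ Or.inl ha)) (key E₂ h2 b hb (hu ▸ Or.inr hb))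

theorem exists_isBlock [Finite D] (hα : ∀ x, d.α (d.α x) = x) (x : D) : ∃ S, d.IsBlock S ∧ x ∈ S := by
  obtain ⟨S, hle, hS⟩ := (Set.toFinite {S | d.IsTwoConnectedSubmap S}).exists_le_maximal
    (isTwoConnectedSubmap_pair hα x)
  exact ⟨S, hS, hle (Or.inl rfl)⟩

theorem IsBlock.subset {S T : Set D} (hS : d.IsBlock S)
    (hT : d.IsTwoConnectedSubmap T) {x : D} (hxS : x ∈ S) (hxT : x ∈ T) : T ⊆ S :=
  Set.subset_union_right.trans (hS.2 (hS.1.union hT hxS hxT) Set.subset_union_left)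

theorem IsBlock.eq {S T : Set D} (hS : d.IsBlock S)
    (hT : d.IsBlock T) {x : D} (hxS : x ∈ S) (hxT : x ∈ T) : S = T :=
  (hT.subset hS.1 hxT hxS).antisymm (hS.subset hT.1 hxS hxT)

theorem IsBlock.rootBlockSet_eq {S : Set D} (hS : d.IsBlock S) {r : D}
    (hr : d.root = some r) (hrS : r ∈ S) : d.rootBlockSet = S := by
  apply Set.Subset.antisymm
  · rintro x ⟨T, ⟨hT, r', hr', hroot⟩, hx⟩
    rw [hr, Option.some_inj] at hroot
    subst hroot
    rwa [hS.eq hT hrS hr']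
  · exact Set.subset_sUnion_of_mem ⟨hS, r, hrS, hr⟩

theorem isBlock_rootBlockSet [Finite D] (hα : ∀ x, d.α (d.α x) = x) {r : D} (hr : d.root = some r) :
    d.IsBlock d.rootBlockSet ∧ r ∈ d.rootBlockSet := by
  obtain ⟨S, hS, hrS⟩ := exists_isBlock hα r
  rw [hS.rootBlockSet_eq hr hrS]
  exact ⟨hS, hrS⟩

/-! ### The complement of a block -/

/-- Two distinct vertices of a block are not linked outside the block. -/
theorem IsBlock.sameCycle_of_linked [Finite D] {B : Set D} (hB : d.IsBlock B)
    {E : Set D} (hE : d.IsEdgeSet E) (hEB : Disjoint B E) {a b : D} (ha : a ∈ B) (hb : b ∈ B)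
    (hab : d.Linked E a b) : d.σ.SameCycle a b := by
  by_contra hn
  -- An edge set minimal among those that link two distinct vertices of the block from outside
  -- behaves like an ear.
  obtain ⟨E, -, hE⟩ := (Set.toFinite {E : Set D | d.IsEdgeSet E ∧ Disjoint B E ∧
    ∃ a ∈ B, ∃ b ∈ B, d.Linked E a b ∧ ¬ d.σ.SameCycle a b}).exists_le_minimal
    ⟨hE, hEB, a, ha, b, hb, hab, hn⟩
  clear hn hab ha hb a b
  obtain ⟨⟨hEe, hEB, a, ha, b, hb, hab, hn⟩, hmin⟩ := hE
  have hmin' : ∀ E' : Set D, d.IsEdgeSet E' → E' ⊆ E → d.Linked E' a b → E ⊆ E' :=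
    fun E' hE' hsub hl => hmin ⟨hE', hEB.mono_right hsub, a, ha, b, hb, hl, hn⟩ hsub
  have hEne : E.Nonempty := by
    by_contra hne
    rw [Set.not_nonempty_iff_eq_empty] at hne
    subst hne
    exact hn (hab.lift ⟨fun _ => .refl _ _, .symm, .trans⟩ (sameCycle_self_apply _)
      fun _ h => h.elim)
  -- the block with the ear `E` is 2-connected
  have hconn : ∀ x ∈ B ∪ E, d.Linked (B ∪ E) x a := by
    -- The edges of E connected to a already link a to b, so by minimality there are no others.
    have hsub : E ⊆ {x ∈ E | d.Linked (B ∪ E) x a} := by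
      refine hmin' _ ?_ (fun x hx => hx.1) ?_
      · exact fun x hx => ⟨hEe x hx.1, (Linked.alpha d (Or.inr hx.1)).symm.trans hx.2⟩
      · refine (hab.lift (R := fun x y => (d.Linked (B ∪ E) x a ↔ d.Linked (B ∪ E) y a) ∧
          (d.Linked (B ∪ E) x a → d.Linked {x ∈ E | d.Linked (B ∪ E) x a} x y))
          ⟨fun x => ⟨Iff.rfl, fun _ => Linked.refl d _ _⟩,
          fun h => ⟨h.1.symm, fun hy => (h.2 (h.1.2 hy)).symm⟩,
          fun h h' => ⟨h.1.trans h'.1, fun hx => (h.2 hx).trans (h'.2 (h.1.1 hx))⟩⟩ ?_ ?_).2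
          (Linked.refl d _ _)
        · intro x
          exact ⟨⟨(Linked.sigma d _ x).symm.trans, (Linked.sigma d _ x).trans⟩,
            fun _ => Linked.sigma d _ x⟩
        · intro x hx
          have hl : d.Linked (B ∪ E) x (d.α x) := Linked.alpha d (Or.inr hx)
          exact ⟨⟨hl.symm.trans, hl.trans⟩, fun h => Linked.alpha d ⟨hx, h⟩⟩
    rintro x (hx | hx)
    · exact (hB.1.connected x hx a ha).mono Set.subset_union_left
    · exact (hsub hx).2
  have hnsep : ∀ E₁ E₂ : Set D, d.IsEdgeSet E₁ → d.IsEdgeSet E₂ → Disjoint E₁ E₂ →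
      E₁ ∪ E₂ = B ∪ E → (∃ x ∈ E₁, ∃ y ∈ E₂, d.σ.SameCycle x y) →
      (∀ x ∈ E₁, ∀ y ∈ E₂, ∀ x' ∈ E₁, ∀ y' ∈ E₂, d.σ.SameCycle x y → d.σ.SameCycle x' y' →
        d.σ.SameCycle x x') → ¬ B ⊆ E₁ := by
    rintro E₁ E₂ h1 h2 hd hu ⟨x, hx, y, hy, hxy⟩ hv hBE
    have hdis := Set.disjoint_left.1 hd
    have hyE : y ∈ E := (hu ▸ Or.inr hy : y ∈ B ∪ E).resolve_left fun h => hdis (hBE h) hy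
    have hsub : E ⊆ E ∩ E₁ := by
      refine hmin' _ (hEe.inter h1) Set.inter_subset_left ?_
      classical
      -- The side that does not contain the block touches the other at the vertex of x only.
      -- Collapsing all its vertices onto that vertex turns the link from a to b into one that uses
      -- only `E ∩ E₁`, against the minimality of E.
      let t : D → Prop := fun u => ∃ y ∈ E₂, d.σ.SameCycle u y
      let π : D → D := fun u => if t u then x else u
      have hπ1 : ∀ u ∈ E₁, d.Linked (E ∩ E₁) (π u) u := by
        intro u hu
        by_cases ht : t u
        · obtain ⟨w, hw, huw⟩ := ht
          rw [show π u = x from if_pos ⟨w, hw, huw⟩]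
          exact Linked.of_sameCycle (hv x hx y hy u hu w hw hxy huw)
        · simp only [π, if_neg ht]
          exact Linked.refl d _ _
      have key : d.Linked (E ∩ E₁) (π a) (π b) := by
        refine hab.lift (R := fun u w => d.Linked (E ∩ E₁) (π u) (π w))
          ⟨fun _ => Linked.refl d _ _, Linked.symm, Linked.trans⟩ (fun u => ?_) fun u hu' => ?_
        · have hc := sameCycle_self_apply d.σ u
          have hiff : t u ↔ t (d.σ u) :=
            ⟨fun ⟨w, hw, h⟩ => ⟨w, hw, hc.symm.trans h⟩, fun ⟨w, hw, h⟩ => ⟨w, hw, hc.trans h⟩⟩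
          by_cases ht : t u
          · simp only [π, if_pos ht, if_pos (hiff.1 ht)]
            exact Linked.refl d _ _
          · simp only [π, if_neg ht, if_neg (fun h => ht (hiff.2 h))]
            exact Linked.sigma d _ u
        · rcases (hu ▸ Or.inr hu' : u ∈ E₁ ∪ E₂) with hu1 | hu2
          · exact ((hπ1 u hu1).trans (Linked.alpha d ⟨hu', hu1⟩)).trans
              (hπ1 _ (h1 u hu1)).symm
          · have ht : t u := ⟨u, hu2, .refl _ _⟩
            have ht' : t (d.α u) := ⟨_, h2 u hu2, .refl _ _⟩
            simp only [π, if_pos ht, if_pos ht']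
            exact Linked.refl d _ _
      exact ((hπ1 a (hBE ha)).symm.trans key).trans (hπ1 b (hBE hb))
    exact hdis (hsub hyE).2 hy
  have h2c : d.IsTwoConnectedSubmap (B ∪ E) := by
    refine ⟨hB.1.isEdgeSet.union hEe, ⟨a, Or.inl ha⟩,
      fun x hx y hy => (hconn x hx).trans (hconn y hy).symm, fun hsep => ?_⟩
    obtain ⟨E₁, E₂, h1, h2, hd, hu, ⟨x, hx, y, hy, hxy⟩, hv⟩ := (separable_iff _ _).1 hsep
    rcases hB.1.subset_or_subset h1 h2 hd (hu ▸ Set.subset_union_left) hv with h | h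
    · exact hnsep E₁ E₂ h1 h2 hd hu ⟨x, hx, y, hy, hxy⟩ hv h
    · refine hnsep E₂ E₁ h2 h1 hd.symm (Set.union_comm _ _ ▸ hu) ⟨y, hy, x, hx, hxy.symm⟩ ?_ h
      intro p hp q hq p' hp' q' hq' h h'
      exact (h.trans (hv q hq p hp q' hq' p' hp' h.symm h'.symm)).trans h'.symm
  obtain ⟨x, hx⟩ := hEne
  exact Set.disjoint_left.1 hEB (hB.2 h2c Set.subset_union_left (Or.inr hx)) hx

/-! ### The pendant submaps of a planar map -/

theorem mem_pendantSet_self {h : D} (hh : d.σ h ∉ d.rootBlockSet) : d.σ h ∈ d.pendantSet h :=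
  ⟨hh, .refl _⟩

theorem not_mem_rootBlockSet_of_mem_pendantSet {h x : D} (hx : x ∈ d.pendantSet h) :
    x ∉ d.rootBlockSet := by
  refine (eqvGen_lift (R := fun x y => (x ∈ d.rootBlockSet ↔ y ∈ d.rootBlockSet))
    ⟨fun _ => Iff.rfl, Iff.symm, Iff.trans⟩ ?_ hx.2).not.1 hx.1
  exact fun x y hxy => iff_of_false hxy.1 hxy.2.1

theorem sigma_mem_pendantSet {h x : D} (hx : x ∈ d.pendantSet h) (hσ : d.σ x ∉ d.rootBlockSet) :
    d.σ x ∈ d.pendantSet h :=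
  ⟨hx.1, .trans _ _ _ hx.2 (.rel _ _ ⟨not_mem_rootBlockSet_of_mem_pendantSet hx, hσ, Or.inl rfl⟩)⟩

theorem alpha_mem_pendantSet (hα : ∀ x, d.α (d.α x) = x) (hB : d.IsEdgeSet d.rootBlockSet)
    {h x : D} (hx : x ∈ d.pendantSet h) : d.α x ∈ d.pendantSet h := by
  have hx' := not_mem_rootBlockSet_of_mem_pendantSet hx
  exact ⟨hx.1, .trans _ _ _ hx.2 (.rel _ _ ⟨hx', fun h => hx' ((hB.mem_iff hα x).1 h),
    Or.inr rfl⟩)⟩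

/-- A set that contains the first half-edge of a pendant submap and is stable under the moves
outside the root block contains the pendant submap. -/
theorem pendantSet_subset {h : D} {K : Set D} (hK : d.σ h ∈ K)
    (hσ : ∀ x, x ∉ d.rootBlockSet → d.σ x ∉ d.rootBlockSet → (x ∈ K ↔ d.σ x ∈ K))
    (hα : ∀ x, x ∉ d.rootBlockSet → d.α x ∉ d.rootBlockSet → (x ∈ K ↔ d.α x ∈ K)) :
    d.pendantSet h ⊆ K := by
  intro x hx
  refine (eqvGen_lift (R := fun x y => (x ∈ K ↔ y ∈ K))
    ⟨fun _ => Iff.rfl, Iff.symm, Iff.trans⟩ ?_ hx.2).1 hK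
  rintro x y ⟨hx, hy, rfl | rfl⟩
  · exact hσ x hx hy
  · exact hα x hx hy

theorem linked_pendantSet (hα : ∀ x, d.α (d.α x) = x) (hB : d.IsEdgeSet d.rootBlockSet)
    {h x : D} (hx : x ∈ d.pendantSet h) : d.Linked (d.pendantSet h) (d.σ h) x := by
  have hsub : d.pendantSet h ⊆ {x | x ∈ d.pendantSet h ∧ d.Linked (d.pendantSet h) (d.σ h) x} := by
    refine pendantSet_subset ⟨mem_pendantSet_self hx.1, Linked.refl d _ _⟩ ?_ ?_
    · intro y hy hσy
      refine ⟨fun h' => ⟨sigma_mem_pendantSet h'.1 hσy, h'.2.trans (Linked.sigma d _ y)⟩,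
        fun h' => ⟨⟨hx.1, .trans _ _ _ h'.1.2 (.symm _ _ (.rel _ _ ⟨hy, hσy, Or.inl rfl⟩))⟩,
          h'.2.trans (Linked.sigma d _ y).symm⟩⟩
    · intro y hy hαy
      refine ⟨fun h' => ⟨alpha_mem_pendantSet hα hB h'.1, h'.2.trans (Linked.alpha d h'.1)⟩,
        fun h' => ?_⟩
      have h1 := alpha_mem_pendantSet hα hB h'.1
      have h2 := h'.2.trans (Linked.alpha d h'.1)
      rw [hα] at h1 h2
      exact ⟨h1, h2⟩
  exact (hsub hx).2

/-- The combinatorial Jordan curve argument, and the place where planarity is needed. The set K is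
what comes off when the vertex is cut at the corner after h and at the corner after q. It contains
the pendant submap, avoids the block, and rotation enters or leaves it only after h or q. -/
theorem exists_separating_set [Finite D] (hT : d.IsTreeRootedMap) {h : D} (hroot : d.IsBlock d.rootBlockSet)
    (hh : h ∈ d.rootBlockSet) (hσh : d.σ h ∉ d.rootBlockSet) :
    ∃ q ∈ d.pendantSet h, d.σ q ∈ d.rootBlockSet ∧ ∃ K : Set D, d.pendantSet h ⊆ K ∧
      Disjoint d.rootBlockSet K ∧ ∀ x, x ≠ h → x ≠ q → (x ∈ K ↔ d.σ x ∈ K) := by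
  classical
  have hα := hT.involutive
  have hB := hroot.1.isEdgeSet
  set B := d.rootBlockSet with hBdef
  -- the face of the corner at `h` comes back to the block at `y`
  have hαh : d.α h ∈ B := hB h hh
  obtain ⟨y, hyP, hyB, hyc⟩ : ∃ y ∈ d.pendantSet h, d.σ (d.α y) ∈ B ∧
      (d.σ * d.α).SameCycle (d.α h) y := by
    set t := returnTime (d.σ * d.α) B ⟨d.α h, hαh⟩ with ht
    have hφ : (d.σ * d.α) (d.α h) = d.σ h := by rw [Perm.mul_apply, hα]
    have hmem := (returnPerm (d.σ * d.α) B ⟨d.α h, hαh⟩).2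
    rw [coe_returnPerm, ← ht] at hmem
    have ht0 : 0 < t := returnTime_pos _ _ _
    have ht1 : t ≠ 1 := by
      intro h1
      rw [h1, pow_one, hφ] at hmem
      exact hσh hmem
    have key : ∀ i, i + 1 < t → ((d.σ * d.α) ^ (i + 1)) (d.α h) ∈ d.pendantSet h := by
      intro i
      induction i with
      | zero =>
        intro _
        rw [zero_add, pow_one, hφ]
        exact mem_pendantSet_self hσh
      | succ i ih =>
        intro hi
        have h1 := alpha_mem_pendantSet hα hB (ih (by omega))
        have h2 := not_mem_of_lt_returnTime (d.σ * d.α) B ⟨d.α h, hαh⟩ (Nat.succ_pos (i + 1)) hi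
        rw [Nat.succ_eq_add_one, pow_succ', Perm.mul_apply, Perm.mul_apply] at h2
        rw [pow_succ', Perm.mul_apply, Perm.mul_apply]
        exact sigma_mem_pendantSet h1 h2
    obtain ⟨j, hj⟩ : ∃ j, t = j + 2 := ⟨t - 2, by omega⟩
    refine ⟨_, key j (by omega), ?_, sameCycle_pow _ _ _⟩
    rwa [hj, pow_succ', Perm.mul_apply, Perm.mul_apply] at hmem
  set q := d.α y with hq
  have hqy : d.α q = y := hα y
  have hqP : q ∈ d.pendantSet h := alpha_mem_pendantSet hα hB hyP
  have hqB : q ∉ B := not_mem_rootBlockSet_of_mem_pendantSet hqP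
  have hhq : h ≠ q := fun h' => hqB (h' ▸ hh)
  have hPe : d.IsEdgeSet (d.pendantSet h) := fun x hx => alpha_mem_pendantSet hα hB hx
  have hsame : d.σ.SameCycle h q := by
    have hc := hroot.sameCycle_of_linked hPe (Set.disjoint_right.2 fun x hx =>
      not_mem_rootBlockSet_of_mem_pendantSet hx) hh hyB (((Linked.sigma d _ h).trans
      (linked_pendantSet hα hB hqP)).trans (Linked.sigma d _ q))
    exact hc.trans (sameCycle_self_apply _ q).symm
  -- the vertex is cut at the two corners
  let d₁ : MapData D := ⟨d.σ * swap h q, d.α, d.tree, d.root⟩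
  have hV : numCycles d₁.σ = numCycles d.σ + 1 :=
    numCycles_mul_swap_of_sameCycle _ _ _ hhq hsame
  -- Cutting the vertex multiplies the face permutation by the transposition of the opposite
  -- half-edges, which lie on one face since the face walk from `d.α h` reached y.
  have hF : numCycles (d₁.σ * d₁.α) = numCycles (d.σ * d.α) + 1 := by
    have : d₁.σ * d₁.α = d.σ * d.α * swap (d.α h) (d.α q) := by
      have hsw := mul_swap_eq_swap_mul d.α (d.α h) (d.α q)
      rw [hα, hα] at hsw
      rw [mul_assoc, mul_assoc, hqy, hsw]
    rw [this]
    exact numCycles_mul_swap_of_sameCycle _ _ _ (fun h' => hhq (d.α.injective h'))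
      (hqy ▸ hyc)
  have hs1 : ∀ x, x ≠ h → x ≠ q → d₁.σ x = d.σ x := fun x hx hx' => by
    change d.σ (swap h q x) = d.σ x
    rw [swap_apply_of_ne_of_ne hx hx']
  have hs2 : d₁.σ h = d.σ q := by
    change d.σ (swap h q h) = d.σ q
    rw [swap_apply_left]
  have hs3 : d₁.σ q = d.σ h := by
    change d.σ (swap h q q) = d.σ h
    rw [swap_apply_right]
  -- If the two halves of the vertex remained linked, the cut map would be connected with one more
  -- vertex and one more face than a planar map allows.
  have hnl : ¬ d₁.Linked Set.univ q h := by
    intro hl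
    have : Nonempty D := ⟨h⟩
    have hc : ∀ x y, d₁.Linked Set.univ x y := by
      intro x y
      refine Linked.lift (d := d) (S := Set.univ) (R := d₁.Linked Set.univ) (Linked.equivalence d₁ _) (fun x => ?_)
        (fun x _ => Linked.alpha d₁ (Set.mem_univ x)) (hT.connected x y)
      by_cases hx : x = h
      · subst hx
        exact hl.symm.trans (hs3 ▸ Linked.sigma d₁ _ q)
      · by_cases hx' : x = q
        · subst hx'
          exact hl.trans (hs2 ▸ Linked.sigma d₁ _ h)
        · exact hs1 x hx hx' ▸ Linked.sigma d₁ _ x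
    have h1 := euler_inequality (d := d₁) hα hT.fixedPointFree hc
    have h2 := (planar_iff hα hT.fixedPointFree).1 (hT.planar this)
    omega
  let K : Set D := {x | d₁.Linked Set.univ q x}
  have hKα : ∀ x, x ∈ K ↔ d.α x ∈ K := fun x =>
    ⟨fun hx => hx.trans (Linked.alpha d₁ (Set.mem_univ x)),
      fun hx => hx.trans (Linked.alpha d₁ (Set.mem_univ x)).symm⟩
  have hKσ₁ : ∀ x, x ∈ K ↔ d₁.σ x ∈ K := fun x =>
    ⟨fun hx => hx.trans (Linked.sigma d₁ _ x), fun hx => hx.trans (Linked.sigma d₁ _ x).symm⟩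
  have hKσ : ∀ x, x ≠ h → x ≠ q → (x ∈ K ↔ d.σ x ∈ K) := fun x hx hx' => by
    rw [hKσ₁, hs1 x hx hx']
  have hKB : Disjoint B K := by
    -- In the original map, K and its complement meet at the cut vertex only. So the block lies on
    -- one side, the one that contains h.
    have hcross : ∀ x ∈ K, ∀ y ∈ Kᶜ, d.σ.SameCycle x y → d.σ.SameCycle x h := by
      intro x hx y hy hxy
      by_contra hn
      refine hy ((SameCycle.lift (R := fun u w => d.σ.SameCycle u w ∧
        (¬ d.σ.SameCycle u h → (u ∈ K ↔ w ∈ K))) ⟨fun u => ⟨.refl _ _, fun _ => Iff.rfl⟩,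
          fun k => ⟨k.1.symm, fun hn => (k.2 fun k' => hn (k.1.symm.trans k')).symm⟩,
          fun k k' => ⟨k.1.trans k'.1, fun hn => (k.2 hn).trans
            (k'.2 fun k'' => hn (k.1.trans k''))⟩⟩ (fun u => ⟨sameCycle_self_apply _ u,
          fun hu => hKσ u ?_ ?_⟩) hxy).2 hn |>.1 hx)
      · rintro rfl
        exact hu (.refl _ _)
      · rintro rfl
        exact hu hsame.symm
    have hKe : d.IsEdgeSet K := fun x hx => (hKα x).1 hx
    have hKe' : d.IsEdgeSet Kᶜ := fun x hx h' => hx ((hKα x).2 h')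
    rcases hroot.1.subset_or_subset hKe hKe' disjoint_compl_right
      (by rw [Set.union_compl_self]; exact Set.subset_univ _)
      (fun a ha b hb a' ha' b' hb' h h' =>
        (hcross a ha b hb h).trans (hcross a' ha' b' hb' h').symm) with h' | h'
    · exact absurd (h' hh) hnl
    · exact Set.disjoint_left.2 h'
  refine ⟨q, hqP, hyB, K, ?_, hKB, hKσ⟩
  refine pendantSet_subset (hs3 ▸ (hKσ₁ q).1 (Linked.refl d₁ _ q)) (fun x hx hx' => hKσ x ?_ ?_)
    fun x _ _ => hKα x
  · rintro rfl
    exact hx hh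
  · rintro rfl
    exact hx' hyB

end MapData

/-! ### Decompositions along a block -/

/-- The map `d` is made of the submap `B`, with one submap `P h` inserted in the corner that follows
each half-edge `h` of `B`. -/
structure Decomp {D : Type} (d : MapData D) (B : Set D) (P : D → Set D) : Prop
    extends PermDecomp d.σ B P where
  edgeB : d.IsEdgeSet B
  edgeP : ∀ {h}, h ∈ B → d.IsEdgeSet (P h)

namespace MapData

variable {D : Type} [Finite D] {d : MapData D}

/-- Disjointness of the pendant submaps and uniqueness of the exit follow from the separating set:
rotation crosses its boundary at h and q only, and it contains no half-edge of the block. Covering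
follows from connectedness, since the block with its pendant submaps is stable under rotation and
edges. -/
theorem decomp_rootBlockSet (hT : d.IsTreeRootedMap) {r : D} (hr : d.root = some r) :
    Decomp d d.rootBlockSet d.pendantSet := by
  obtain ⟨hroot, hrB⟩ := isBlock_rootBlockSet hT.involutive hr
  have hB := hroot.1.isEdgeSet
  refine ⟨⟨fun _ hx => not_mem_rootBlockSet_of_mem_pendantSet hx, ?_, ?_,
    fun _ h => mem_pendantSet_self h, fun _ => sigma_mem_pendantSet, ?_, ?_⟩, hB,
    fun _ x hx => alpha_mem_pendantSet hT.involutive hB hx⟩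
  · intro h h' x hh hh' hx hx'
    obtain ⟨q, hq, hqB, K, hPK, hKB, hK⟩ := exists_separating_set hT hroot hh hx.1
    have hmem : d.σ h' ∈ d.pendantSet h := ⟨hx.1, .trans _ _ _ hx.2 (.symm _ _ hx'.2)⟩
    by_contra hne
    refine Set.disjoint_left.1 hKB hh' ((hK h' (Ne.symm hne) ?_).2 (hPK hmem))
    rintro rfl
    exact not_mem_rootBlockSet_of_mem_pendantSet hq hh'
  · intro x hx
    let C : Set D := d.rootBlockSet ∪ {x | ∃ h ∈ d.rootBlockSet, x ∈ d.pendantSet h}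
    have hCσ : ∀ x ∈ C, d.σ x ∈ C := by
      intro x hxC
      by_cases hσ : d.σ x ∈ d.rootBlockSet
      · exact Or.inl hσ
      · rcases hxC with hxB | ⟨h, hh, hxh⟩
        · exact Or.inr ⟨x, hxB, mem_pendantSet_self hσ⟩
        · exact Or.inr ⟨h, hh, sigma_mem_pendantSet hxh hσ⟩
    have hCα : ∀ x ∈ C, d.α x ∈ C := by
      rintro x (hxB | ⟨h, hh, hxh⟩)
      · exact Or.inl (hB x hxB)
      · exact Or.inr ⟨h, hh, alpha_mem_pendantSet hT.involutive hB hxh⟩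
    have hiff : ∀ f : Perm D, (∀ x ∈ C, f x ∈ C) → ∀ x, x ∈ C ↔ f x ∈ C := by
      intro f hf x
      refine ⟨hf x, fun h => ?_⟩
      obtain ⟨k, hk⟩ := SameCycle.exists_nat (sameCycle_self_apply f x).symm
      rw [← hk]
      clear hk
      induction k with
      | zero => exact h
      | succ k ih => rw [pow_succ', Perm.mul_apply]; exact hf _ ih
    have : x ∈ C := ((hT.connected r x).lift (R := fun x y => (x ∈ C ↔ y ∈ C))
      ⟨fun _ => Iff.rfl, Iff.symm, Iff.trans⟩ (hiff _ hCσ) (fun x _ => hiff _ hCα x)).1 (Or.inl hrB)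
    exact this.resolve_left hx
  · intro h x y hh hx hy hxB hyB
    obtain ⟨q, hq, hqB, K, hPK, hKB, hK⟩ := exists_separating_set hT hroot hh hx.1
    have key : ∀ z ∈ d.pendantSet h, d.σ z ∈ d.rootBlockSet → z = q := by
      intro z hz hzB
      by_contra hne
      refine Set.disjoint_left.1 hKB hzB ((hK z ?_ hne).1 (hPK hz))
      rintro rfl
      exact not_mem_rootBlockSet_of_mem_pendantSet hz hh
    rw [key x hx hxB, key y hy hyB]
  · intro h hh hσ
    exact Set.eq_empty_of_forall_notMem fun x hx => hx.1 hσ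

end MapData

end TreeRooted

/-! ### Transfer of tree-rootedness and of blocks between a decomposed map and its parts. -/

namespace TreeRooted

open Equiv

namespace MapData

/-! ### Restrictions -/

theorem returnPerm_congr {D : Type} [Finite D] {f g : Perm D} {S : Set D} (x y : S)
    (hxy : f x = g y) (h : ∀ z, z ∉ S → f z = g z) : returnPerm f S x = returnPerm g S y := by
  have key : ∀ k, (∀ i, 0 < i → i ≤ k → (f ^ i) (x : D) ∉ S) →
      (f ^ (k + 1)) (x : D) = (g ^ (k + 1)) (y : D) := by
    intro k
    induction k with
    | zero => intro _; simpa using hxy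
    | succ k ih =>
      intro hk
      have h1 := ih fun i h0 h1 => hk i h0 (by omega)
      rw [pow_succ', Perm.mul_apply, h _ (hk (k + 1) (by omega) le_rfl), h1, pow_succ' g (k + 1),
        Perm.mul_apply]
  have hpos := returnTime_pos f S x
  have h1 : (f ^ returnTime f S x) (x : D) = (g ^ returnTime f S x) (y : D) := by
    have := key (returnTime f S x - 1) fun i h0 hi => not_mem_of_lt_returnTime f S x h0 (by omega)
    rwa [Nat.sub_add_cancel hpos] at this
  have ht : returnTime g S y = returnTime f S x := by
    apply le_antisymm
    · refine returnTime_le _ _ _ hpos ?_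
      rw [← h1]
      exact (returnPerm f S x).2
    · by_contra hlt
      push Not at hlt
      have hpos' := returnTime_pos g S y
      have h2 := key (returnTime g S y - 1) fun i h0 hi =>
        not_mem_of_lt_returnTime f S x h0 (by omega)
      rw [Nat.sub_add_cancel hpos'] at h2
      exact not_mem_of_lt_returnTime f S x hpos' hlt (h2 ▸ (returnPerm g S y).2)
  exact Subtype.ext (by rw [coe_returnPerm, coe_returnPerm, ht, h1])

/-- The faces of the submap as a map of its own are the faces of the ambient map with edges S that
meet S. This is the bridge to `euler_of_connected_submap`. -/
theorem returnPerm_mul_alpha {D : Type} [Finite D] {d : MapData D} {S : Set D}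
    (hS : d.IsEdgeSet S) (f : Perm D) (hf : ∀ x ∈ S, f x = d.σ (d.α x))
    (hf' : ∀ x, x ∉ S → f x = d.σ x) :
    returnPerm d.σ S * returnPerm d.α S = returnPerm f S := by
  ext x
  rw [Perm.mul_apply, returnPerm_congr x (returnPerm d.α S x) _ hf']
  rw [coe_returnPerm_of_mem _ _ _ (hS x x.2), hf x x.2]

theorem ncard_eq_card {D : Type} (S : Set D) : S.ncard = Nat.card S := (Nat.card_coe_set_eq S).symm

/-- A connected submap onto which the links can be projected is a tree-rooted map. -/
theorem isTreeRootedMap_restrict {D : Type} [Finite D] {d : MapData D} (hT : d.IsTreeRootedMap)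
    {S : Set D} (hS : d.IsEdgeSet S) (r : S) (ρ : D → S) (hρ : ∀ x : S, ρ x = x)
    (hl : ∀ (U : Set D) (x y : D), d.IsEdgeSet U → d.Linked U x y →
      (d.restrict S (some r)).Linked (Subtype.val ⁻¹' U) (ρ x) (ρ y)) :
    (d.restrict S (some r)).IsTreeRootedMap := by
  have hE := emb_restrict hS (some r)
  have hinv : ∀ x, (d.restrict S (some r)).α ((d.restrict S (some r)).α x) = x := fun x =>
    Subtype.ext (by rw [coe_restrict_α hS, coe_restrict_α hS, hT.involutive])
  have hfix : ∀ x, (d.restrict S (some r)).α x ≠ x := fun x h => by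
    have := congrArg Subtype.val h
    rw [coe_restrict_α hS] at this
    exact hT.fixedPointFree _ this
  have hconn : ∀ x y, (d.restrict S (some r)).Linked Set.univ x y := fun x y => by
    have := hl Set.univ x y d.isEdgeSet_univ (hT.connected x y)
    rwa [hρ, hρ] at this
  have : Nonempty D := ⟨r⟩
  refine ⟨hinv, hfix, ?_, hconn, fun _ => ?_, ?_, ?_, ?_⟩
  · exact iff_of_false (by simp [restrict]) fun h => h.elim r
  · rw [planar_iff hinv hfix]
    have h1 := euler_of_connected_submap hT.involutive hT.fixedPointFree hT.connected
      ((planar_iff hT.involutive hT.fixedPointFree).1 (hT.planar this)) hS ⟨r, r.2⟩ (by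
        intro x hx y hy
        have := hE.linked_image.2 (hconn ⟨x, hx⟩ ⟨y, hy⟩)
        rwa [Set.image_univ, Subtype.range_coe] at this)
    rw [ncard_cyclesMeeting, ncard_cyclesMeeting, ncard_eq_card,
      ← returnPerm_mul_alpha hS (d.σ * d.edgePerm S) (fun x hx => by
        rw [Perm.mul_apply, edgePerm_of_mem hT.involutive hS hx]) (fun x hx => by
        rw [Perm.mul_apply, edgePerm_of_not_mem hT.involutive hS hx])] at h1
    exact h1
  · intro x hx
    change ((d.restrict S (some r)).α x : D) ∈ d.tree
    rw [coe_restrict_α hS]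
    exact hT.spanning.isEdgeSet _ hx
  · intro x y
    have := hl d.tree x y hT.spanning.isEdgeSet (hT.spanning.connected x y)
    rwa [hρ, hρ] at this
  · intro x hx h
    refine hT.spanning.acyclic x hx ?_
    have := hE.linked_image.2 h
    rw [hE.alpha] at this
    refine this.mono ?_
    rintro _ ⟨y, ⟨hy, hy'⟩, rfl⟩
    refine ⟨hy, ?_⟩
    rintro (h | h)
    · exact hy' (Or.inl (Subtype.ext h))
    · exact hy' (Or.inr (Subtype.ext (h.trans (coe_restrict_α hS _ x).symm)))

end MapData

open MapData

namespace Decomp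

variable {D : Type} {d : MapData D} {B : Set D} {P : D → Set D}

/-- A face that arrives through `d.α h` turns into the corner after h. So the faces see the same
insertions as the vertices, with the parts reindexed by α. -/
theorem permDecomp_face (H : Decomp d B P) (hα : ∀ x, d.α (d.α x) = x) :
    PermDecomp (d.σ * d.α) B fun x => P (d.α x) := by
  refine ⟨fun hh hx => H.disjB (H.edgeB _ hh) hx, fun hh hh' hx hx' => d.α.injective
    (H.disj (H.edgeB _ hh) (H.edgeB _ hh') hx hx'), ?_, fun hh hσ => H.enter (H.edgeB _ hh) hσ,
    fun hh hx hσ => H.stay (H.edgeB _ hh) (H.edgeP (H.edgeB _ hh) _ hx) hσ, ?_,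
    fun hh hσ => H.empty (H.edgeB _ hh) hσ⟩
  · intro x hx
    obtain ⟨h, hh, hxh⟩ := H.cover hx
    exact ⟨d.α h, H.edgeB _ hh, by rwa [hα]⟩
  · intro h x y hh hx hy hfx hfy
    have hh' := H.edgeB _ hh
    exact d.α.injective (H.exit_unique hh' (H.edgeP hh' _ hx) (H.edgeP hh' _ hy) hfx hfy)

variable [Finite D]

/-! ### Projection of the links -/

/-- Contract every inserted part onto the half-edge before it. A rotation step becomes a rotation
step of the block or no move, so links project without using new edges. This transfers both
connectedness and acyclicity. -/
theorem exists_retraction_block (H : Decomp d B P) (r : Option B) : ∃ π : D → B,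
    (∀ x : B, π x = x) ∧ (∀ h (hh : h ∈ B), ∀ x ∈ P h, π x = ⟨h, hh⟩) ∧
    ∀ (U : Set D) (x y : D), d.Linked U x y →
      (d.restrict B r).Linked (Subtype.val ⁻¹' U) (π x) (π y) := by
  classical
  have hcov : ∀ x, x ∉ B → ∃ h ∈ B, x ∈ P h := fun x hx => H.cover hx
  choose! g hgB hgP using hcov
  let π : D → B := fun x => if hx : x ∈ B then ⟨x, hx⟩ else ⟨g x, hgB x hx⟩
  have h1 : ∀ x : B, π x = x := fun x => dif_pos x.2
  have h2 : ∀ h (hh : h ∈ B), ∀ x ∈ P h, π x = ⟨h, hh⟩ := by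
    intro h hh x hx
    have hxB := H.disjB hh hx
    have : π x = ⟨g x, hgB x hxB⟩ := dif_neg hxB
    rw [this]
    exact Subtype.ext (H.disj (hgB x hxB) hh (hgP x hxB) hx)
  refine ⟨π, h1, h2, fun U x y hxy => ?_⟩
  refine hxy.lift (R := fun x y => (d.restrict B r).Linked (Subtype.val ⁻¹' U) (π x) (π y))
    ⟨fun _ => Linked.refl _ _ _, Linked.symm, Linked.trans⟩ (fun x => ?_) fun x hxU => ?_
  · by_cases hx : x ∈ B
    · by_cases hσ : d.σ x ∈ B
      · have e : π (d.σ x) = (d.restrict B r).σ (π x) := by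
          rw [h1 ⟨x, hx⟩, h1 ⟨_, hσ⟩]
          exact Subtype.ext (coe_returnPerm_of_mem d.σ B ⟨x, hx⟩ hσ).symm
        rw [e]
        exact Linked.sigma _ _ _
      · rw [h2 x hx _ (H.enter hx hσ), h1 ⟨x, hx⟩]
        exact Linked.refl _ _ _
    · obtain ⟨h, hh, hxh⟩ := H.cover hx
      by_cases hσ : d.σ x ∈ B
      · have e : π (d.σ x) = (d.restrict B r).σ (π x) := by
          rw [h2 h hh x hxh, h1 ⟨_, hσ⟩]
          exact Subtype.ext (H.apply_exit hh hxh hσ).1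
        rw [e]
        exact Linked.sigma _ _ _
      · rw [h2 h hh x hxh, h2 h hh _ (H.stay hh hxh hσ)]
        exact Linked.refl _ _ _
  · by_cases hx : x ∈ B
    · have e : π (d.α x) = (d.restrict B r).α (π x) := by
        rw [h1 ⟨x, hx⟩, h1 ⟨_, H.edgeB x hx⟩]
        exact Subtype.ext (coe_restrict_α H.edgeB r ⟨x, hx⟩).symm
      rw [e]
      refine Linked.alpha _ ?_
      rw [h1 ⟨x, hx⟩]
      exact hxU
    · obtain ⟨h, hh, hxh⟩ := H.cover hx
      rw [h2 h hh x hxh, h2 h hh _ (H.edgeP hh x hxh)]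
      exact Linked.refl _ _ _

/-- Contract everything outside the part onto its first half-edge, which is where the rotation
inside the part resumes after its exit. -/
theorem exists_retraction_pendant (H : Decomp d B P) (hα : ∀ x, d.α (d.α x) = x) {h : D}
    (hh : h ∈ B) (hσh : d.σ h ∈ P h) (r : Option (P h)) : ∃ π : D → P h,
    (∀ x : P h, π x = x) ∧ (∀ x, x ∉ P h → π x = ⟨d.σ h, hσh⟩) ∧
    ∀ (U : Set D) (x y : D), d.Linked U x y →
      (d.restrict (P h) r).Linked (Subtype.val ⁻¹' U) (π x) (π y) := by
  classical
  let π : D → P h := fun x => if hx : x ∈ P h then ⟨x, hx⟩ else ⟨d.σ h, hσh⟩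
  have h1 : ∀ x : P h, π x = x := fun x => dif_pos x.2
  have h2 : ∀ x, x ∉ P h → π x = ⟨d.σ h, hσh⟩ := fun x hx => dif_neg hx
  refine ⟨π, h1, h2, fun U x y hxy => ?_⟩
  refine hxy.lift (R := fun x y => (d.restrict (P h) r).Linked (Subtype.val ⁻¹' U) (π x) (π y))
    ⟨fun _ => Linked.refl _ _ _, Linked.symm, Linked.trans⟩ (fun x => ?_) fun x hxU => ?_
  · by_cases hx : x ∈ P h
    · have e : π (d.σ x) = (d.restrict (P h) r).σ (π x) := by
        by_cases hσ : d.σ x ∈ P h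
        · rw [h1 ⟨x, hx⟩, h1 ⟨_, hσ⟩]
          exact Subtype.ext (coe_returnPerm_of_mem d.σ (P h) ⟨x, hx⟩ hσ).symm
        · rw [h1 ⟨x, hx⟩, h2 _ hσ]
          refine Subtype.ext (H.returnPerm_exit hh hx ?_).symm
          by_contra hB
          exact hσ (H.stay hh hx hB)
      rw [e]
      exact Linked.sigma _ _ _
    · by_cases hσ : d.σ x ∈ P h
      · have := H.eq_of_apply_mem hh hx hσ
        subst this
        rw [h2 _ hx, h1 ⟨_, hσ⟩]
        exact Linked.refl _ _ _
      · rw [h2 _ hx, h2 _ hσ]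
        exact Linked.refl _ _ _
  · by_cases hx : x ∈ P h
    · have e : π (d.α x) = (d.restrict (P h) r).α (π x) := by
        rw [h1 ⟨x, hx⟩, h1 ⟨_, H.edgeP hh x hx⟩]
        exact Subtype.ext (coe_restrict_α (H.edgeP hh) r ⟨x, hx⟩).symm
      rw [e]
      refine Linked.alpha _ ?_
      rw [h1 ⟨x, hx⟩]
      exact hxU
    · rw [h2 _ hx, h2 _ fun h' => hx (((H.edgeP hh).mem_iff hα x).1 h')]
      exact Linked.refl _ _ _

/-! ### The parts of a tree-rooted map are tree-rooted maps -/

theorem isTreeRootedMap_block (H : Decomp d B P) (hT : d.IsTreeRootedMap) (r : B) :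
    (d.restrict B (some r)).IsTreeRootedMap := by
  obtain ⟨π, h1, -, h3⟩ := H.exists_retraction_block (some r)
  exact isTreeRootedMap_restrict hT H.edgeB r π h1 fun U x y _ => h3 U x y

theorem isTreeRootedMap_pendant (H : Decomp d B P) (hT : d.IsTreeRootedMap) {h : D} (hh : h ∈ B)
    (hσh : d.σ h ∈ P h) : (d.restrict (P h) (some ⟨d.σ h, hσh⟩)).IsTreeRootedMap := by
  obtain ⟨π, h1, -, h3⟩ := H.exists_retraction_pendant hT.involutive hh hσh (some ⟨d.σ h, hσh⟩)
  exact isTreeRootedMap_restrict hT (H.edgeP hh) _ π h1 fun U x y _ => h3 U x y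

/-! ### Sizes -/

theorem card_eq (H : Decomp d B P) : Nat.card D = Nat.card B + ∑ᶠ h : B, Nat.card (P h) := by
  have := Fintype.ofFinite B
  rw [finsum_eq_sum_of_fintype]
  have h1 : Nat.card D = B.ncard + Bᶜ.ncard := (Set.ncard_add_ncard_compl B).symm
  have h2 : Bᶜ = ⋃ h : B, P h := by
    ext x
    rw [Set.mem_iUnion]
    refine ⟨fun hx => ?_, fun ⟨h, hx⟩ => H.disjB h.2 hx⟩
    obtain ⟨h, hh, hxh⟩ := H.cover hx
    exact ⟨⟨h, hh⟩, hxh⟩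
  rw [h1, ncard_eq_card, h2, ncard_eq_card, Nat.card_congr (Set.unionEqSigmaOfDisjoint ?_),
    Nat.card_sigma]
  intro h h' hne
  exact Set.disjoint_left.2 fun x hx hx' => hne (Subtype.ext (H.disj h.2 h'.2 hx hx'))

theorem returnPerm_face_block (H : Decomp d B P) (hα : ∀ x, d.α (d.α x) = x) :
    returnPerm (d.σ * d.α) B = returnPerm d.σ B * returnPerm d.α B := by
  ext x
  have hx' : d.α x ∈ B := H.edgeB x x.2
  have hαx : returnPerm d.α B x = ⟨d.α x, hx'⟩ :=
    Subtype.ext (coe_returnPerm_of_mem d.α B x hx')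
  rw [Perm.mul_apply, hαx]
  by_cases hσ : d.σ (d.α x) ∈ B
  · rw [coe_returnPerm_of_mem _ _ _ hσ]
    exact (coe_returnPerm_of_mem d.σ B ⟨d.α x, hx'⟩ hσ).symm
  · obtain ⟨p, hp, hfp, -⟩ := (H.permDecomp_face hα).exists_exit x.2 hσ
    have hmem : d.σ (d.α p) ∈ B := hfp ▸ (returnPerm (d.σ * d.α) B ⟨x, x.2⟩).2
    have := (H.apply_exit hx' (H.edgeP hx' _ hp) hmem).1
    rw [← this]
    exact hfp.symm

theorem returnPerm_face_pendant (H : Decomp d B P) (hα : ∀ x, d.α (d.α x) = x) {h : D}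
    (hh : h ∈ B) : returnPerm (d.σ * d.α) (P h) = returnPerm d.σ (P h) * returnPerm d.α (P h) := by
  ext x
  have hx' : d.α x ∈ P h := H.edgeP hh x x.2
  have hαx : returnPerm d.α (P h) x = ⟨d.α x, hx'⟩ :=
    Subtype.ext (coe_returnPerm_of_mem d.α (P h) x hx')
  rw [Perm.mul_apply, hαx]
  by_cases hσ : d.σ (d.α x) ∈ P h
  · rw [coe_returnPerm_of_mem _ _ _ hσ]
    exact (coe_returnPerm_of_mem d.σ (P h) ⟨d.α x, hx'⟩ hσ).symm
  · have hB : d.σ (d.α x) ∈ B := by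
      by_contra hB
      exact hσ (H.stay hh hx' hB)
    rw [H.returnPerm_exit hh hx' hB]
    -- The face decomposition indexes this part by `d.α h`, so the part reads `P (d.α (d.α h))`. The
    -- variable h' allows this double involution to be rewritten.
    have key : ∀ h', h' = d.α h → ∀ hx : (x : D) ∈ P (d.α h'),
        (returnPerm (d.σ * d.α) (P (d.α h')) ⟨x, hx⟩ : D) = (d.σ * d.α) h' := by
      rintro _ rfl hx
      exact (H.permDecomp_face hα).returnPerm_exit (H.edgeB _ hh) hx hB
    have := key _ rfl
    rw [Perm.mul_apply, hα] at this
    exact this x.2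

/-! ### A map whose parts are tree-rooted maps is a tree-rooted map -/

/-- Every non-empty part shares one vertex and one face with the block. Summing the Euler relations
therefore gives 4 too much for each such part, which is exactly what merging one vertex and one face
takes away. A link that would create a cycle in the tree retracts to such a link in the part
containing the edge. -/
theorem isTreeRootedMap (H : Decomp d B P) (hα : ∀ x, d.α (d.α x) = x) (hf : ∀ x, d.α x ≠ x)
    {r : D} (hr : d.root = some r) {rB : Option B} (hB : (d.restrict B rB).IsTreeRootedMap)
    (hBne : B.Nonempty) {rP : ∀ h, Option (P h)}
    (hP : ∀ h ∈ B, (d.restrict (P h) (rP h)).IsTreeRootedMap) : d.IsTreeRootedMap := by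
  classical
  have hEB := emb_restrict H.edgeB rB
  have hEP : ∀ h (hh : h ∈ B), Emb (d.restrict (P h) (rP h)) d Subtype.val := fun h hh =>
    emb_restrict (H.edgeP hh) (rP h)
  have hlinkB : ∀ (U : Set D) (x y : B), (d.restrict B rB).Linked (Subtype.val ⁻¹' U) x y →
      d.Linked U x y := fun U x y h =>
    (hEB.linked_image.2 h).mono (Set.image_preimage_subset _ _)
  have hlinkP : ∀ (U : Set D) (h : D), h ∈ B → ∀ (x y : P h),
      (d.restrict (P h) (rP h)).Linked (Subtype.val ⁻¹' U) x y → d.Linked U x y :=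
    fun U h hh x y hxy =>
    ((hEP h hh).linked_image.2 hxy).mono (Set.image_preimage_subset _ _)
  have hconn : ∀ U : Set D, (∀ x y, (d.restrict B rB).Linked (Subtype.val ⁻¹' U) x y) →
      (∀ h ∈ B, ∀ x y, (d.restrict (P h) (rP h)).Linked (Subtype.val ⁻¹' U) x y) →
      ∀ x y, d.Linked U x y := by
    intro U h1 h2
    obtain ⟨b, hb⟩ := hBne
    suffices h : ∀ x, d.Linked U b x from fun x y => (h x).symm.trans (h y)
    intro x
    by_cases hx : x ∈ B
    · exact hlinkB U ⟨b, hb⟩ ⟨x, hx⟩ (h1 _ _)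
    · obtain ⟨h, hh, hxh⟩ := H.cover hx
      exact ((hlinkB U ⟨b, hb⟩ ⟨h, hh⟩ (h1 _ _)).trans (Linked.sigma d U h)).trans
        (hlinkP U h hh ⟨d.σ h, H.apply_mem hh hxh⟩ ⟨x, hxh⟩ (h2 h hh _ _))
  refine ⟨hα, hf, ?_, ?_, fun _ => ?_, ?_, ?_, ?_⟩
  · rw [hr]
    exact iff_of_false (by simp) fun h => h.elim r
  · exact hconn Set.univ (fun x y => hB.connected x y) fun h hh x y => (hP h hh).connected x y
  · rw [planar_iff hα hf]
    have := Fintype.ofFinite B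
    have hV := H.numCycles_eq
    have hF := (H.permDecomp_face hα).numCycles_eq
    let a : B ≃ B := returnPerm d.α B
    have ha : ∀ x : B, (a x : D) = d.α x := fun x => coe_returnPerm_of_mem d.α B x (H.edgeB x x.2)
    have e1 : ∑ᶠ h : B, (if (P (d.α h)).Nonempty then 1 else 0) =
        ∑ᶠ h : B, (if (P h).Nonempty then 1 else 0) := by
      rw [← finsum_comp_equiv a]
      exact finsum_congr fun h => by rw [ha, hα]
    have e2 : ∑ᶠ h : B, numCycles (returnPerm (d.σ * d.α) (P (d.α h))) =
        ∑ᶠ h : B, numCycles (returnPerm d.σ (P h) * returnPerm d.α (P h)) := by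
      rw [← finsum_comp_equiv a]
      refine finsum_congr fun h => ?_
      rw [ha, hα, H.returnPerm_face_pendant hα h.2]
    rw [e1, e2, H.returnPerm_face_block hα] at hF
    have hcard := H.card_eq
    obtain ⟨b, hb⟩ := hBne
    have hBp := (planar_iff hB.involutive hB.fixedPointFree).1 (hB.planar ⟨⟨b, hb⟩⟩)
    change 2 * numCycles (returnPerm d.σ B) +
      2 * numCycles (returnPerm d.σ B * returnPerm d.α B) = _ at hBp
    have hPp : ∀ h : B, 2 * numCycles (returnPerm d.σ (P h)) +
        2 * numCycles (returnPerm d.σ (P h) * returnPerm d.α (P h)) =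
        Nat.card (P h) + 4 * (if (P h).Nonempty then 1 else 0) := by
      rintro ⟨h, hh⟩
      split_ifs with hne
      · obtain ⟨x, hx⟩ := hne
        exact (planar_iff (hP h hh).involutive (hP h hh).fixedPointFree).1
          ((hP h hh).planar ⟨⟨x, hx⟩⟩)
      · have : IsEmpty (P h) := Set.isEmpty_coe_sort.2 (Set.not_nonempty_iff_eq_empty.1 hne)
        simp [numCycles]
    rw [finsum_eq_sum_of_fintype, finsum_eq_sum_of_fintype] at hV hF
    rw [finsum_eq_sum_of_fintype] at hcard
    have hsum := Finset.sum_congr (rfl : (Finset.univ : Finset B) = Finset.univ)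
      fun h _ => hPp h
    simp only [Finset.sum_add_distrib, ← Finset.mul_sum] at hsum
    omega
  · intro x hx
    by_cases hxB : x ∈ B
    · have := hB.spanning.isEdgeSet ⟨x, hxB⟩ hx
      change ((d.restrict B rB).α ⟨x, hxB⟩ : D) ∈ d.tree at this
      rwa [coe_restrict_α H.edgeB] at this
    · obtain ⟨h, hh, hxh⟩ := H.cover hxB
      have := (hP h hh).spanning.isEdgeSet ⟨x, hxh⟩ hx
      change ((d.restrict (P h) (rP h)).α ⟨x, hxh⟩ : D) ∈ d.tree at this
      rwa [coe_restrict_α (H.edgeP hh)] at this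
  · exact hconn d.tree hB.spanning.connected fun h hh => (hP h hh).spanning.connected
  · intro x hx hl
    by_cases hxB : x ∈ B
    · obtain ⟨π, h1, -, h3⟩ := H.exists_retraction_block rB
      refine hB.spanning.acyclic ⟨x, hxB⟩ hx ?_
      have hl' := h3 _ _ _ hl
      rw [h1 ⟨x, hxB⟩, h1 ⟨_, H.edgeB x hxB⟩] at hl'
      have e : (d.restrict B rB).α ⟨x, hxB⟩ = ⟨d.α x, H.edgeB x hxB⟩ :=
        Subtype.ext (coe_restrict_α H.edgeB rB ⟨x, hxB⟩)
      rw [e]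
      refine hl'.mono ?_
      rintro y ⟨hy, hy'⟩
      refine ⟨hy, ?_⟩
      rintro (rfl | rfl)
      exacts [hy' (Or.inl rfl), hy' (Or.inr rfl)]
    · obtain ⟨h, hh, hxh⟩ := H.cover hxB
      obtain ⟨π, h1, -, h3⟩ := H.exists_retraction_pendant hα hh (H.apply_mem hh hxh) (rP h)
      refine (hP h hh).spanning.acyclic ⟨x, hxh⟩ hx ?_
      have hl' := h3 _ _ _ hl
      rw [h1 ⟨x, hxh⟩, h1 ⟨_, H.edgeP hh x hxh⟩] at hl'
      have e : (d.restrict (P h) (rP h)).α ⟨x, hxh⟩ = ⟨d.α x, H.edgeP hh x hxh⟩ :=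
        Subtype.ext (coe_restrict_α (H.edgeP hh) (rP h) ⟨x, hxh⟩)
      rw [e]
      refine hl'.mono ?_
      rintro y ⟨hy, hy'⟩
      refine ⟨hy, ?_⟩
      rintro (rfl | rfl)
      exacts [hy' (Or.inl rfl), hy' (Or.inr rfl)]

/-! ### Blocks -/

/-- A part meets its complement at the vertex of h only, so a 2-connected submap lies inside it or
outside it. The blocks of the map are hence B and the blocks of the parts. -/
theorem subset_of_isTwoConnectedSubmap (H : Decomp d B P) (hα : ∀ x, d.α (d.α x) = x) {S : Set D}
    (hS : d.IsTwoConnectedSubmap S) : S ⊆ B ∨ ∃ h ∈ B, S ⊆ P h := by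
  by_contra hcon
  push Not at hcon
  refine hcon.1 fun x hx => ?_
  by_contra hxB
  obtain ⟨h, hh, hxh⟩ := H.cover hxB
  have hP := H.edgeP hh
  have hc : d.IsEdgeSet (P h)ᶜ := fun y hy h' => hy ((hP.mem_iff hα y).1 h')
  rcases hS.subset_or_subset hP hc disjoint_compl_right
    (by rw [Set.union_compl_self]; exact Set.subset_univ _)
    (fun a ha b hb a' ha' b' hb' h1 h2 => (H.sameCycle_of_mem_of_not_mem hh ha hb h1).trans
      (H.sameCycle_of_mem_of_not_mem hh ha' hb' h2).symm) with h' | h'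
  · exact hcon.2 h hh h'
  · exact h' hx hxh

theorem isTwoConnectedSubmap_restrict {S : Set D} (hS : d.IsEdgeSet S) {r : Option S}
    (hne : S.Nonempty) (hc : ∀ x y, (d.restrict S r).Linked Set.univ x y) :
    d.IsTwoConnectedSubmap S ↔ (d.restrict S r).IsTwoConnected := by
  have hE := emb_restrict hS r
  have h1 := hE.isTwoConnectedSubmap_image (S := Set.univ)
  rw [Set.image_univ, Subtype.range_coe] at h1
  rw [h1]
  have : Nonempty S := hne.to_subtype
  exact ⟨fun h => h.not_separable, fun h => ⟨isEdgeSet_univ _, Set.univ_nonempty,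
    fun x _ y _ => hc x y, h⟩⟩

theorem isBlock (H : Decomp d B P) (hα : ∀ x, d.α (d.α x) = x)
    (hB : d.IsTwoConnectedSubmap B) : d.IsBlock B := by
  refine ⟨hB, fun S hS hBS => ?_⟩
  rcases H.subset_of_isTwoConnectedSubmap hα hS with h | ⟨h, hh, h'⟩
  · exact h
  · exact absurd hh (H.disjB hh (h' (hBS hh)))

theorem isBlock_iff (H : Decomp d B P) (hα : ∀ x, d.α (d.α x) = x)
    (hB : d.IsTwoConnectedSubmap B) (rP : ∀ h, Option (P h)) (S : Set D) :
    d.IsBlock S ↔ S = B ∨ ∃ h ∈ B, ∃ T, (d.restrict (P h) (rP h)).IsBlock T ∧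
      S = Subtype.val '' T := by
  constructor
  · intro hS
    rcases H.subset_of_isTwoConnectedSubmap hα hS.1 with h | ⟨h, hh, hSP⟩
    · exact Or.inl (h.antisymm (hS.2 hB h))
    · refine Or.inr ⟨h, hh, Subtype.val ⁻¹' S, ?_, ?_⟩
      · have hE := emb_restrict (H.edgeP hh) (rP h)
        have e : (Subtype.val '' (Subtype.val ⁻¹' S : Set (P h))) = S :=
          Set.image_preimage_eq_of_subset (by rwa [Subtype.range_coe])
        refine ⟨hE.isTwoConnectedSubmap_image.1 (by rw [e]; exact hS.1), fun T hT hST => ?_⟩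
        have := hS.2 (hE.isTwoConnectedSubmap_image.2 hT) (by
          rw [← e]
          exact Set.image_mono hST)
        exact fun x hx => this (Set.mem_image_of_mem _ hx)
      · exact (Set.image_preimage_eq_of_subset (by rwa [Subtype.range_coe])).symm
  · rintro (rfl | ⟨h, hh, T, hT, rfl⟩)
    · exact H.isBlock hα hB
    · have hE := emb_restrict (H.edgeP hh) (rP h)
      refine ⟨hE.isTwoConnectedSubmap_image.2 hT.1, fun S hS hTS => ?_⟩
      obtain ⟨x, hx⟩ := hT.1.nonempty
      have hxS := hTS (Set.mem_image_of_mem _ hx)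
      have hSP : S ⊆ P h := by
        rcases H.subset_of_isTwoConnectedSubmap hα hS with h' | ⟨h', hh', hSP⟩
        · exact absurd (h' hxS) (H.disjB hh x.2)
        · rwa [H.disj hh hh' x.2 (hSP hxS)]
      have e : (Subtype.val '' (Subtype.val ⁻¹' S : Set (P h))) = S :=
        Set.image_preimage_eq_of_subset (by rwa [Subtype.range_coe])
      have := hT.2 (hE.isTwoConnectedSubmap_image (S := Subtype.val ⁻¹' S) |>.1 (by rw [e]; exact hS)) (fun y hy =>
        hTS (Set.mem_image_of_mem _ hy))
      rw [← e]
      exact Set.image_mono this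

theorem numBlocks_eq (H : Decomp d B P) (hα : ∀ x, d.α (d.α x) = x)
    (hB : d.IsTwoConnectedSubmap B) (rP : ∀ h, Option (P h)) :
    d.numBlocks = 1 + ∑ᶠ h : B, (d.restrict (P h) (rP h)).numBlocks := by
  have := Fintype.ofFinite B
  rw [finsum_eq_sum_of_fintype]
  let C : B → Set (Set D) := fun h =>
    (fun T => Subtype.val '' T) '' {T | (d.restrict (P h) (rP h)).IsBlock T}
  have hC : ∀ h : B, ∀ S ∈ C h, S ⊆ P h ∧ S.Nonempty := by
    rintro h _ ⟨T, hT, rfl⟩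
    refine ⟨?_, hT.1.nonempty.image _⟩
    rintro _ ⟨x, -, rfl⟩
    exact x.2
  have h1 : {S | d.IsBlock S} = insert B (⋃ h, C h) := by
    ext S
    rw [Set.mem_ofPred_eq, H.isBlock_iff hα hB rP, Set.mem_insert_iff, Set.mem_iUnion]
    refine or_congr_right ⟨?_, ?_⟩
    · rintro ⟨h, hh, T, hT, rfl⟩
      exact ⟨⟨h, hh⟩, T, hT, rfl⟩
    · rintro ⟨⟨h, hh⟩, T, hT, rfl⟩
      exact ⟨h, hh, T, hT, rfl⟩
  have h2 : B ∉ ⋃ h, C h := by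
    rw [Set.mem_iUnion]
    rintro ⟨h, hC'⟩
    exact H.disjB h.2 ((hC h B hC').1 h.2) h.2
  rw [numBlocks, h1, Set.ncard_insert_of_notMem h2, add_comm]
  congr 1
  rw [ncard_eq_card, Nat.card_congr (Set.unionEqSigmaOfDisjoint ?_), Nat.card_sigma]
  · refine Finset.sum_congr rfl fun h _ => ?_
    rw [← ncard_eq_card, Set.ncard_image_of_injective _ Subtype.val_injective.image_injective]
    rfl
  · intro h h' hne
    refine Set.disjoint_left.2 fun S hS hS' => hne ?_
    obtain ⟨x, hx⟩ := (hC h S hS).2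
    exact Subtype.ext (H.disj h.2 h'.2 ((hC h S hS).1 hx) ((hC h' S hS').1 hx))

/-- The pendant set is defined by reachability without meeting the block. A connected part is
reached entirely because the one rotation inside it that passes through the block goes from its exit
to its first half-edge, and both are reachable. -/
theorem pendantSet_eq (H : Decomp d B P) (hα : ∀ x, d.α (d.α x) = x) (hB : d.rootBlockSet = B)
    {h : D} (hh : h ∈ B) (rP : Option (P h))
    (hc : ∀ x y, (d.restrict (P h) rP).Linked Set.univ x y) : d.pendantSet h = P h := by
  subst hB
  by_cases hσ : d.σ h ∈ d.rootBlockSet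
  · rw [H.empty hh hσ]
    exact Set.eq_empty_of_forall_notMem fun x hx => hx.1 hσ
  have hσh := H.enter hh hσ
  apply Set.Subset.antisymm
  · refine pendantSet_subset hσh (fun x hx hx' => ⟨fun hxP => H.stay hh hxP hx', fun hxP => ?_⟩)
      fun x _ _ => ((H.edgeP hh).mem_iff hα x).symm
    by_contra hxP'
    exact hx (H.eq_of_apply_mem hh hxP' hxP ▸ hh)
  · have hsub : d.pendantSet h ⊆ P h := by
      refine pendantSet_subset hσh (fun x hx hx' => ⟨fun hxP => H.stay hh hxP hx', fun hxP => ?_⟩)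
        fun x _ _ => ((H.edgeP hh).mem_iff hα x).symm
      by_contra hxP'
      exact hx (H.eq_of_apply_mem hh hxP' hxP ▸ hh)
    -- If the exit were not reached, the rotation from `d.σ h` would never leave the pendant set,
    -- although it comes back to h.
    have hexit : ∀ x ∈ P h, d.σ x ∈ d.rootBlockSet → x ∈ d.pendantSet h := by
      intro x hx hxB
      by_contra hxp
      have hclosed : ∀ y ∈ d.pendantSet h, d.σ y ∈ d.pendantSet h := by
        intro y hy
        refine sigma_mem_pendantSet hy fun hyB => hxp ?_
        rwa [H.exit_unique hh hx (hsub hy) hxB hyB]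
      obtain ⟨k, hk⟩ := SameCycle.exists_nat (sameCycle_self_apply d.σ h).symm
      have : ∀ k : ℕ, (d.σ ^ k) (d.σ h) ∈ d.pendantSet h := by
        intro k
        induction k with
        | zero => exact mem_pendantSet_self hσ
        | succ k ih => rw [pow_succ', Perm.mul_apply]; exact hclosed _ ih
      exact not_mem_rootBlockSet_of_mem_pendantSet (hk ▸ this k) hh
    intro x hx
    have := Linked.lift (d := d.restrict (P h) rP) (S := Set.univ)
      (R := fun x y => ((x : D) ∈ d.pendantSet h ↔ (y : D) ∈ d.pendantSet h))
      ⟨fun _ => Iff.rfl, Iff.symm, Iff.trans⟩ ?_ ?_ (hc ⟨d.σ h, hσh⟩ ⟨x, hx⟩)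
    · exact this.1 (mem_pendantSet_self hσ)
    · rintro ⟨y, hy⟩
      by_cases hyB : d.σ y ∈ d.rootBlockSet
      · refine iff_of_true (hexit y hy hyB) ?_
        change (returnPerm d.σ (P h) ⟨y, hy⟩ : D) ∈ _
        rw [H.returnPerm_exit hh hy hyB]
        exact mem_pendantSet_self hσ
      · have e : ((d.restrict (P h) rP).σ ⟨y, hy⟩ : D) = d.σ y :=
          coe_returnPerm_of_mem d.σ (P h) ⟨y, hy⟩ (H.stay hh hy hyB)
        rw [e]
        refine ⟨fun h' => sigma_mem_pendantSet h' hyB, fun h' => ⟨hσ, ?_⟩⟩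
        exact .trans _ _ _ h'.2 (.symm _ _ (.rel _ _ ⟨H.disjB hh hy, hyB, Or.inl rfl⟩))
    · rintro ⟨y, hy⟩ -
      rw [coe_restrict_α (H.edgeP hh)]
      refine ⟨fun h' => alpha_mem_pendantSet hα H.edgeB h', fun h' => ?_⟩
      have := alpha_mem_pendantSet hα H.edgeB h'
      rwa [hα] at this

end Decomp

end TreeRooted

/-! ### Gluing maps into the corners of a map. -/

namespace TreeRooted

open Equiv

namespace MapData

theorem isTreeRootedMap_of_isEmpty {D : Type} [IsEmpty D] (d : MapData D) :
    d.IsTreeRootedMap := by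
  refine ⟨isEmptyElim, isEmptyElim, iff_of_true ?_ inferInstance, isEmptyElim,
    fun ⟨x⟩ => isEmptyElim x, isEmptyElim, isEmptyElim, isEmptyElim⟩
  cases h : d.root with
  | none => rfl
  | some r => exact isEmptyElim r

/-- A rooted connected map has no non-trivial automorphism. -/
theorem relabel_injective {X D : Type} [Finite X] [Finite D] {b : MapData X} {d : MapData D}
    (hd : d.IsTreeRootedMap) {e e' : X ≃ D} (he : b.relabel e = d) (he' : b.relabel e' = d) :
    e = e' := by
  have hb : b.IsTreeRootedMap := relabel_symm he ▸ isTreeRootedMap_relabel e.symm hd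
  obtain ⟨h1, h2, -, h4⟩ := (relabel_eq_iff _ _ _).1 he
  obtain ⟨k1, k2, -, k4⟩ := (relabel_eq_iff _ _ _).1 he'
  ext x
  cases hr : b.root with
  | none => exact (hb.rooted.1 hr).elim x
  | some r =>
    have hroot : e r = e' r := by
      have := h4.trans k4.symm
      rw [hr] at this
      exact Option.some_injective _ this
    refine ((hb.connected r x).lift (R := fun x y => (e x = e' x ↔ e y = e' y))
      ⟨fun _ => Iff.rfl, Iff.symm, Iff.trans⟩ (fun y => ?_) fun y _ => ?_).1 hroot
    · rw [h1, k1, d.σ.injective.eq_iff]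
    · rw [h2, k2, d.α.injective.eq_iff]

/-! ### Gluing -/

section Glue

variable {X : Type} {Y : X → Type}

open Classical in
/-- The rotation of the half-edges when a map `m h` is inserted in the corner of `b` that follows
each half-edge `h`. -/
noncomputable def glueFun (b : MapData X) (m : ∀ h, MapData (Y h)) :
    (X ⊕ Σ h, Y h) → (X ⊕ Σ h, Y h)
  | Sum.inl h => (m h).root.elim (Sum.inl (b.σ h)) fun r => Sum.inr ⟨h, r⟩
  | Sum.inr ⟨h, x⟩ =>
    if (m h).root = some ((m h).σ x) then Sum.inl (b.σ h) else Sum.inr ⟨h, (m h).σ x⟩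

theorem glueFun_inl_some (b : MapData X) (m : ∀ h, MapData (Y h)) {h : X} {r : Y h}
    (hr : (m h).root = some r) : glueFun b m (Sum.inl h) = Sum.inr ⟨h, r⟩ := by
  rw [glueFun, hr]; rfl

theorem glueFun_inl_none (b : MapData X) (m : ∀ h, MapData (Y h)) {h : X}
    (hr : (m h).root = none) : glueFun b m (Sum.inl h) = Sum.inl (b.σ h) := by
  rw [glueFun, hr]; rfl

theorem glueFun_inr_root (b : MapData X) (m : ∀ h, MapData (Y h)) {h : X} {x : Y h}
    (hr : (m h).root = some ((m h).σ x)) : glueFun b m (Sum.inr ⟨h, x⟩) = Sum.inl (b.σ h) := by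
  rw [glueFun, if_pos hr]

theorem glueFun_inr (b : MapData X) (m : ∀ h, MapData (Y h)) {h : X} {x : Y h}
    (hr : (m h).root ≠ some ((m h).σ x)) :
    glueFun b m (Sum.inr ⟨h, x⟩) = Sum.inr ⟨h, (m h).σ x⟩ := by
  rw [glueFun, if_neg hr]

theorem glueFun_injective (b : MapData X) (m : ∀ h, MapData (Y h)) :
    Function.Injective (glueFun b m) := by
  have hcross : ∀ h h' (x : Y h'), glueFun b m (Sum.inl h) ≠ glueFun b m (Sum.inr ⟨h', x⟩) := by
    intro h h' x heq
    by_cases hx : (m h').root = some ((m h').σ x)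
    · rw [glueFun_inr_root b m hx] at heq
      cases hr : (m h).root with
      | none =>
        rw [glueFun_inl_none b m hr, Sum.inl.injEq, b.σ.injective.eq_iff] at heq
        subst heq
        rw [hr] at hx
        cases hx
      | some r =>
        rw [glueFun_inl_some b m hr] at heq
        cases heq
    · rw [glueFun_inr b m hx] at heq
      cases hr : (m h).root with
      | none =>
        rw [glueFun_inl_none b m hr] at heq
        cases heq
      | some r =>
        rw [glueFun_inl_some b m hr, Sum.inr.injEq] at heq
        cases heq
        exact hx hr
  rintro (h | ⟨h, x⟩) (h' | ⟨h', x'⟩) heq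
  · congr 1
    cases hr : (m h).root with
    | none =>
      rw [glueFun_inl_none b m hr] at heq
      cases hr' : (m h').root with
      | none =>
        rw [glueFun_inl_none b m hr', Sum.inl.injEq, b.σ.injective.eq_iff] at heq
        exact heq
      | some r' =>
        rw [glueFun_inl_some b m hr'] at heq
        cases heq
    | some r =>
      rw [glueFun_inl_some b m hr] at heq
      cases hr' : (m h').root with
      | none =>
        rw [glueFun_inl_none b m hr'] at heq
        cases heq
      | some r' =>
        rw [glueFun_inl_some b m hr', Sum.inr.injEq] at heq
        exact congrArg Sigma.fst heq
  · exact absurd heq (hcross _ _ _)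
  · exact absurd heq.symm (hcross _ _ _)
  · by_cases hx : (m h).root = some ((m h).σ x)
    · rw [glueFun_inr_root b m hx] at heq
      by_cases hx' : (m h').root = some ((m h').σ x')
      · rw [glueFun_inr_root b m hx', Sum.inl.injEq, b.σ.injective.eq_iff] at heq
        subst heq
        rw [hx, Option.some_inj, (m h).σ.injective.eq_iff] at hx'
        rw [hx']
      · rw [glueFun_inr b m hx'] at heq
        cases heq
    · rw [glueFun_inr b m hx] at heq
      by_cases hx' : (m h').root = some ((m h').σ x')
      · rw [glueFun_inr_root b m hx'] at heq
        cases heq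
      · rw [glueFun_inr b m hx', Sum.inr.injEq, Sigma.mk.injEq] at heq
        obtain ⟨rfl, heq⟩ := heq
        rw [(m h).σ.injective (eq_of_heq heq)]

variable [Finite X] [∀ h, Finite (Y h)]

/-- The map obtained from `b` by inserting the map `m h` in the corner that follows `h`, for each
half-edge `h` of `b`. -/
noncomputable def glue (b : MapData X) (m : ∀ h, MapData (Y h)) : MapData (X ⊕ Σ h, Y h) where
  σ := Equiv.ofBijective (glueFun b m) (Finite.injective_iff_bijective.1 (glueFun_injective b m))
  α := Equiv.sumCongr b.α (Equiv.sigmaCongrRight fun h => (m h).α)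
  tree := {x | Sum.elim (fun h => h ∈ b.tree) (fun p => p.2 ∈ (m p.1).tree) x}
  root := b.root.map Sum.inl

theorem glue_σ (b : MapData X) (m : ∀ h, MapData (Y h)) (x : X ⊕ Σ h, Y h) :
    (glue b m).σ x = glueFun b m x := rfl

/-- The half-edges of the map inserted after a half-edge of `b`. -/
def gluePart (Y : X → Type) : (X ⊕ Σ h, Y h) → Set (X ⊕ Σ h, Y h)
  | Sum.inl h => Set.range fun x : Y h => Sum.inr ⟨h, x⟩
  | Sum.inr _ => ∅

/-- The exit of an inserted map is the half-edge that its own rotation sends to the root, hence it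
is unique. A map without root must be empty, as nothing would lead into it. -/
theorem decomp_glue (b : MapData X) (m : ∀ h, MapData (Y h))
    (hm : ∀ h, (m h).root = none → IsEmpty (Y h)) :
    Decomp (glue b m) (Set.range Sum.inl) (gluePart Y) := by
  refine ⟨⟨?_, ?_, ?_, ?_, ?_, ?_, ?_⟩, ?_, ?_⟩
  · rintro _ _ ⟨h, rfl⟩ ⟨x, rfl⟩ ⟨y, hy⟩
    cases hy
  · rintro _ _ _ ⟨h, rfl⟩ ⟨h', rfl⟩ ⟨x, rfl⟩ ⟨x', hx'⟩
    rw [Sum.inr.injEq] at hx'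
    rw [show h' = h from congrArg Sigma.fst hx']
  · rintro (h | ⟨h, x⟩) hx
    · exact absurd ⟨h, rfl⟩ hx
    · exact ⟨Sum.inl h, ⟨h, rfl⟩, x, rfl⟩
  · rintro _ ⟨h, rfl⟩ hσ
    rw [glue_σ] at hσ ⊢
    cases hr : (m h).root with
    | none =>
      rw [glueFun_inl_none b m hr] at hσ
      exact absurd ⟨_, rfl⟩ hσ
    | some r =>
      rw [glueFun_inl_some b m hr]
      exact ⟨r, rfl⟩
  · rintro _ _ ⟨h, rfl⟩ ⟨x, rfl⟩ hσ
    simp only [glue_σ] at hσ ⊢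
    by_cases hx : (m h).root = some ((m h).σ x)
    · rw [glueFun_inr_root b m hx] at hσ
      exact absurd ⟨_, rfl⟩ hσ
    · rw [glueFun_inr b m hx]
      exact ⟨_, rfl⟩
  · have key : ∀ h (x : Y h), (glue b m).σ (Sum.inr ⟨h, x⟩) ∈ Set.range Sum.inl →
        (m h).root = some ((m h).σ x) := by
      rintro h x ⟨y, hy⟩
      by_contra hx
      rw [glue_σ, glueFun_inr b m hx] at hy
      cases hy
    rintro _ _ _ ⟨h, rfl⟩ ⟨x, rfl⟩ ⟨x', rfl⟩ hx hx'
    have := (key h x hx).symm.trans (key h x' hx')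
    rw [Option.some_inj, (m h).σ.injective.eq_iff] at this
    rw [this]
  · rintro _ ⟨h, rfl⟩ ⟨y, hy⟩
    cases hr : (m h).root with
    | none =>
      have := hm h hr
      exact Set.range_eq_empty _
    | some r =>
      rw [glue_σ, glueFun_inl_some b m hr] at hy
      cases hy
  · rintro _ ⟨h, rfl⟩
    exact ⟨b.α h, rfl⟩
  · rintro _ ⟨h, rfl⟩ _ ⟨x, rfl⟩
    exact ⟨(m h).α x, rfl⟩

/-- The first return to the block skips the inserted excursion and restores the original rotation.
-/
theorem relabel_eq_restrict_glue (b : MapData X) (m : ∀ h, MapData (Y h))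
    (hm : ∀ h, (m h).root = none → IsEmpty (Y h))
    (r : Option (Set.range (Sum.inl : X → X ⊕ Σ h, Y h)))
    (hr : r.map Subtype.val = b.root.map Sum.inl) :
    b.relabel (Equiv.ofInjective Sum.inl Sum.inl_injective) =
      (glue b m).restrict (Set.range Sum.inl) r := by
  have H := decomp_glue b m hm
  refine (relabel_eq_iff _ _ _).2 ⟨fun h => ?_, fun h => ?_, fun h => Iff.rfl, ?_⟩
  · refine Subtype.ext ?_
    change Sum.inl (b.σ h) = (returnPerm (glue b m).σ _ ⟨Sum.inl h, _⟩ : X ⊕ Σ h, Y h)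
    cases hmr : (m h).root with
    | none =>
      rw [coe_returnPerm_of_mem] <;> rw [glue_σ, glueFun_inl_none b m hmr]
      exact ⟨_, rfl⟩
    | some y =>
      have hnot : (glue b m).σ (Sum.inl h) ∉ Set.range Sum.inl := by
        rw [glue_σ, glueFun_inl_some b m hmr]
        rintro ⟨z, hz⟩
        cases hz
      obtain ⟨_, ⟨x, rfl⟩, hp, -⟩ := H.exists_exit ⟨h, rfl⟩ hnot
      rw [← hp]
      have hmem := (returnPerm (glue b m).σ (Set.range Sum.inl) ⟨Sum.inl h, ⟨h, rfl⟩⟩).2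
      rw [← hp] at hmem
      simp only [glue_σ] at hmem ⊢
      by_cases hx : (m h).root = some ((m h).σ x)
      · rw [glueFun_inr_root b m hx]
      · rw [glueFun_inr b m hx] at hmem
        obtain ⟨z, hz⟩ := hmem
        cases hz
  · exact Subtype.ext (coe_restrict_α H.edgeB r ⟨Sum.inl h, h, rfl⟩).symm
  · refine Option.map_injective Subtype.val_injective ?_
    change _ = r.map Subtype.val
    rw [hr, Option.map_map]
    rfl

theorem inr_mk_injective {X : Type} {Y : X → Type} (h : X) :
    Function.Injective fun x : Y h => (Sum.inr ⟨h, x⟩ : X ⊕ Σ h, Y h) :=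
  fun x y hxy => by simpa using hxy

/-- The half-edges of an inserted map, inside the glued map. -/
noncomputable def gluePartEquiv {X : Type} (Y : X → Type) (h : X) :
    Y h ≃ gluePart Y (Sum.inl h) :=
  Equiv.ofInjective _ (inr_mk_injective h)

theorem relabel_eq_restrict_gluePart (b : MapData X) (m : ∀ h, MapData (Y h))
    (hm : ∀ h, (m h).root = none → IsEmpty (Y h)) (h : X)
    (r : Option (gluePart Y (Sum.inl h)))
    (hr : r.map Subtype.val = (m h).root.map fun x => Sum.inr ⟨h, x⟩) :
    (m h).relabel (gluePartEquiv Y h) =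
      (glue b m).restrict (gluePart Y (Sum.inl h)) r := by
  have H := decomp_glue b m hm
  have hh : (Sum.inl h : X ⊕ Σ h, Y h) ∈ Set.range (Sum.inl : X → X ⊕ Σ h, Y h) := ⟨h, rfl⟩
  refine (relabel_eq_iff _ _ _).2 ⟨fun x => ?_, fun x => ?_, fun x => Iff.rfl, ?_⟩
  · refine Subtype.ext ?_
    change Sum.inr ⟨h, (m h).σ x⟩ = (returnPerm (glue b m).σ (gluePart Y (Sum.inl h))
      ⟨Sum.inr ⟨h, x⟩, ⟨x, rfl⟩⟩ : X ⊕ Σ h, Y h)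
    by_cases hx : (m h).root = some ((m h).σ x)
    · rw [H.returnPerm_exit hh ⟨x, rfl⟩ (by
        rw [glue_σ, glueFun_inr_root b m hx]; exact ⟨_, rfl⟩), glue_σ, glueFun_inl_some b m hx]
    · rw [coe_returnPerm_of_mem] <;> rw [glue_σ, glueFun_inr b m hx]
      exact ⟨_, rfl⟩
  · exact Subtype.ext (coe_restrict_α (H.edgeP hh) r ⟨Sum.inr ⟨h, x⟩, x, rfl⟩).symm
  · refine Option.map_injective Subtype.val_injective ?_
    change _ = r.map Subtype.val
    rw [hr, Option.map_map]
    rfl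

/-- A map is obtained by gluing its parts. -/
theorem exists_relabel_glue_eq {D : Type} [Finite D] {d : MapData D} {B : Set D} {P : D → Set D}
    (H : Decomp d B P) {rB : Option B} (hrB : rB.map Subtype.val = d.root) {b : MapData X}
    (e : X ≃ B) (he : b.relabel e = d.restrict B rB) {m : ∀ h, MapData (Y h)}
    (rP : ∀ h : X, Option (P (e h)))
    (hrP : ∀ h : X, ∀ x : P (e h), rP h = some x ↔ (x : D) = d.σ (e h))
    (g : ∀ h : X, Y h ≃ P (e h))
    (hg : ∀ h : X, (m h).relabel (g h) = d.restrict (P (e h)) (rP h)) :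
    ∃ E : (X ⊕ Σ h, Y h) ≃ D, (glue b m).relabel E = d := by
  let F : (X ⊕ Σ h, Y h) → D := Sum.elim (fun h => (e h : D)) fun p => (g p.1 p.2 : D)
  have hF : Function.Bijective F := by
    constructor
    · rintro (h | ⟨h, x⟩) (h' | ⟨h', x'⟩) heq
      · rw [e.injective (Subtype.ext heq)]
      · exact absurd (show (e h : D) = g h' x' from heq)
          fun h'' => H.disjB (e h').2 (g h' x').2 (h'' ▸ (e h).2)
      · exact absurd (show (g h x : D) = e h' from heq)
          fun h'' => H.disjB (e h).2 (g h x).2 (h'' ▸ (e h').2)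
      · have heq' : (g h x : D) = g h' x' := heq
        have : h = h' := e.injective (Subtype.ext
          (H.disj (e h).2 (e h').2 (g h x).2 (heq' ▸ (g h' x').2)))
        subst this
        rw [(g h).injective (Subtype.ext heq')]
    · intro x
      by_cases hx : x ∈ B
      · exact ⟨Sum.inl (e.symm ⟨x, hx⟩), by simp [F]⟩
      · obtain ⟨h, hh, hxh⟩ := H.cover hx
        obtain ⟨h, rfl⟩ : ∃ h', h = e h' := ⟨e.symm ⟨h, hh⟩, by simp⟩
        exact ⟨Sum.inr ⟨h, (g h).symm ⟨x, hxh⟩⟩, by simp [F]⟩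
  obtain ⟨b1, b2, b3, b4⟩ := (relabel_eq_iff _ _ _).1 he
  have hg' := fun h => (relabel_eq_iff _ _ _).1 (hg h)
  have hroot : ∀ h (y : Y h), (m h).root = some y ↔ (g h y : D) = d.σ (e h) := by
    intro h y
    rw [← hrP h (g h y), ← show (m h).root.map (g h) = rP h from (hg' h).2.2.2,
      ← Option.map_some, (Option.map_injective (g h).injective).eq_iff]
  have b1' : ∀ h, (e (b.σ h) : D) = returnPerm d.σ B (e h) := fun h => congrArg Subtype.val (b1 h)
  have g1' : ∀ h x, (g h ((m h).σ x) : D) = returnPerm d.σ (P (e h)) (g h x) :=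
    fun h x => congrArg Subtype.val ((hg' h).1 x)
  refine ⟨Equiv.ofBijective F hF, (relabel_eq_iff _ _ _).2 ⟨?_, ?_, ?_, ?_⟩⟩
  · rintro (h | ⟨h, x⟩)
    · change F (glueFun b m (Sum.inl h)) = d.σ (e h)
      cases hmr : (m h).root with
      | some y =>
        rw [glueFun_inl_some b m hmr]
        exact (hroot h y).1 hmr
      | none =>
        rw [glueFun_inl_none b m hmr]
        change (e (b.σ h) : D) = _
        rw [b1', coe_returnPerm_of_mem]
        by_contra hB
        have hmem := H.enter (e h).2 hB
        have := (hroot h ((g h).symm ⟨_, hmem⟩)).2 (by simp)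
        rw [hmr] at this
        cases this
    · change F (glueFun b m (Sum.inr ⟨h, x⟩)) = d.σ (g h x)
      -- The rotation inside a part comes back to its first half-edge exactly at the exit. This
      -- matches the case distinction in `glueFun`.
      have hfirst : (g h ((m h).σ x) : D) = d.σ (e h) ↔ d.σ (g h x) ∈ B := by
        rw [g1']
        constructor
        · intro heq
          by_contra hB
          rw [coe_returnPerm_of_mem _ _ _ (H.stay (e h).2 (g h x).2 hB), d.σ.injective.eq_iff]
            at heq
          exact H.disjB (e h).2 (g h x).2 (by rw [heq]; exact (e h).2)
        · exact fun hB => H.returnPerm_exit (e h).2 (g h x).2 hB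
      by_cases hx : (m h).root = some ((m h).σ x)
      · rw [glueFun_inr_root b m hx]
        change (e (b.σ h) : D) = _
        rw [b1', (H.apply_exit (e h).2 (g h x).2 (hfirst.1 ((hroot _ _).1 hx))).1]
      · rw [glueFun_inr b m hx]
        change (g h ((m h).σ x) : D) = _
        rw [g1', coe_returnPerm_of_mem]
        exact H.stay (e h).2 (g h x).2 fun hB => hx ((hroot _ _).2 (hfirst.2 hB))
  · rintro (h | ⟨h, x⟩)
    · change (e (b.α h) : D) = d.α (e h)
      rw [b2, coe_restrict_α H.edgeB]
    · change (g h ((m h).α x) : D) = d.α (g h x)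
      rw [(hg' h).2.1, coe_restrict_α (H.edgeP (e h).2)]
  · rintro (h | ⟨h, x⟩)
    · exact b3 h
    · exact (hg' h).2.2.1 x
  · change (b.root.map Sum.inl).map F = d.root
    rw [← hrB, ← show b.root.map e = rB from b4, Option.map_map, Option.map_map]
    rfl

end Glue

end MapData

end TreeRooted

/-! ### Taking apart and reassembling isomorphism classes of maps. -/

namespace TreeRooted

open Equiv

namespace MapData

variable {D : Type} {d : MapData D}

/-! ### The root block and the pendant submaps of a tree-rooted map -/

theorem exists_root (hT : d.IsTreeRootedMap) [Nonempty D] : ∃ r, d.root = some r := by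
  cases hr : d.root with
  | none => exact ((hT.rooted.1 hr).false (Classical.arbitrary D)).elim
  | some r => exact ⟨r, rfl⟩

variable [Finite D]

theorem map_val_rootBlock_root_eq (hα : ∀ x, d.α (d.α x) = x) :
    d.rootBlock.root.map Subtype.val = d.root := by
  rw [map_val_rootBlock_root]
  cases hr : d.root with
  | none => rfl
  | some r => simp [Option.filter, (isBlock_rootBlockSet hα hr).2]

theorem isTreeRootedMap_rootBlock (hT : d.IsTreeRootedMap) [Nonempty D] :
    d.rootBlock.IsTreeRootedMap := by
  obtain ⟨r, hr⟩ := exists_root hT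
  have h := map_val_rootBlock_root_eq hT.involutive
  rw [hr, Option.map_eq_some_iff] at h
  obtain ⟨r', hr', -⟩ := h
  have := (decomp_rootBlockSet hT hr).isTreeRootedMap_block hT r'
  rwa [← hr'] at this

theorem isTwoConnected_rootBlock (hT : d.IsTreeRootedMap) [Nonempty D] :
    d.rootBlock.IsTwoConnected := by
  obtain ⟨r, hr⟩ := exists_root hT
  have hB := (isBlock_rootBlockSet hT.involutive hr).1.1
  exact (Decomp.isTwoConnectedSubmap_restrict hB.isEdgeSet hB.nonempty
    (isTreeRootedMap_rootBlock hT).connected).1 hB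

theorem pendant_root_eq_some_iff {h : D} (x : d.pendantSet h) :
    (d.pendant h).root = some x ↔ (x : D) = d.σ h := by
  rw [← (Option.map_injective Subtype.val_injective).eq_iff, map_val_pendant_root,
    Option.map_some]
  by_cases h' : d.σ h ∈ d.pendantSet h
  · rw [if_pos h', Option.some_inj, eq_comm]
  · rw [if_neg h']
    refine iff_of_false (by simp) fun hx => h' (hx ▸ x.2)

theorem isTreeRootedMap_pendant (hT : d.IsTreeRootedMap) {h : D} (hh : h ∈ d.rootBlockSet) :
    (d.pendant h).IsTreeRootedMap := by
  by_cases hσ : d.σ h ∈ d.rootBlockSet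
  · have : IsEmpty (d.pendantSet h) := ⟨fun x => x.2.1 hσ⟩
    exact isTreeRootedMap_of_isEmpty _
  · have : Nonempty D := ⟨h⟩
    obtain ⟨r, hr⟩ := exists_root hT
    have hmem := mem_pendantSet_self hσ
    have := (decomp_rootBlockSet hT hr).isTreeRootedMap_pendant hT hh hmem
    rwa [← (pendant_root_eq_some_iff ⟨_, hmem⟩).2 rfl] at this

/-! ### The parts of a glued map -/

theorem exists_map_val_eq {D : Type} {S : Set D} {o : Option D} (h : ∀ x, o = some x → x ∈ S) :
    ∃ r : Option S, r.map Subtype.val = o := by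
  cases o with
  | none => exact ⟨none, rfl⟩
  | some x => exact ⟨some ⟨x, h x rfl⟩, rfl⟩

theorem exists_root_gluePart {X : Type} {Y : X → Type} (m : ∀ h, MapData (Y h)) :
    ∃ r : ∀ x, Option (gluePart Y x),
    ∀ h, (r (Sum.inl h)).map Subtype.val = (m h).root.map fun x => Sum.inr ⟨h, x⟩ := by
  have key : ∀ x : X ⊕ Σ h, Y h, ∃ r : Option (gluePart Y x),
      ∀ h, x = Sum.inl h → r.map Subtype.val = (m h).root.map fun x => Sum.inr ⟨h, x⟩ := by
    rintro (h | y)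
    · obtain ⟨r, hr⟩ := exists_map_val_eq (S := gluePart Y (Sum.inl h))
        (o := (m h).root.map fun x => Sum.inr ⟨h, x⟩) (by
        rintro x hx
        obtain ⟨y, -, rfl⟩ := Option.map_eq_some_iff.1 hx
        exact ⟨y, rfl⟩)
      refine ⟨r, fun h' hh' => ?_⟩
      cases hh'
      exact hr
    · exact ⟨none, fun h hh => by cases hh⟩
  choose r hr using key
  exact ⟨r, fun h => hr _ h rfl⟩

section Glue

variable {X : Type} {Y : X → Type} [Finite X] [∀ h, Finite (Y h)] {b : MapData X}
  {m : ∀ h, MapData (Y h)}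

/-- The root sits in b, and 2-connectedness of b makes it a maximal 2-connected submap of the
result. So the root block and the pendant submaps are the pieces that were glued. -/
theorem glue_spec [Nonempty X] (hb : b.IsTreeRootedMap) (hb2 : b.IsTwoConnected)
    (hm : ∀ h, (m h).IsTreeRootedMap) :
    (glue b m).IsTreeRootedMap ∧ (glue b m).rootBlockSet = Set.range Sum.inl ∧
      (∀ h, (glue b m).pendantSet (Sum.inl h) = gluePart Y (Sum.inl h)) ∧
      (glue b m).numBlocks = 1 + ∑ᶠ h, (m h).numBlocks := by
  have H := decomp_glue b m fun h => (hm h).rooted.1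
  obtain ⟨r, hr⟩ := exists_root hb
  obtain ⟨rP, hrP⟩ := exists_root_gluePart m
  have hne : (Set.range (Sum.inl : X → X ⊕ Σ h, Y h)).Nonempty := Set.range_nonempty _
  have hroot : (glue b m).root = some (Sum.inl r) := by
    change b.root.map Sum.inl = _
    rw [hr, Option.map_some]
  let rB : Option (Set.range (Sum.inl : X → X ⊕ Σ h, Y h)) := some ⟨Sum.inl r, r, rfl⟩
  have hrB : rB.map Subtype.val = b.root.map Sum.inl := by rw [hr]; rfl
  have eB := relabel_eq_restrict_glue b m (fun h => (hm h).rooted.1) rB hrB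
  have eP := fun h => relabel_eq_restrict_gluePart b m (fun h => (hm h).rooted.1) h _ (hrP h)
  have hBT : ((glue b m).restrict (Set.range Sum.inl) rB).IsTreeRootedMap := by
    rw [← eB]
    exact isTreeRootedMap_relabel _ hb
  have hPT : ∀ x ∈ Set.range (Sum.inl : X → X ⊕ Σ h, Y h),
      ((glue b m).restrict (gluePart Y x) (rP x)).IsTreeRootedMap := by
    rintro _ ⟨h, rfl⟩
    rw [← eP h]
    exact isTreeRootedMap_relabel _ (hm h)
  have hα : ∀ x, (glue b m).α ((glue b m).α x) = x := by
    rintro (h | ⟨h, x⟩)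
    · exact congrArg Sum.inl (hb.involutive h)
    · exact congrArg (fun y => (Sum.inr ⟨h, y⟩ : X ⊕ Σ h, Y h)) ((hm h).involutive x)
  have hf : ∀ x, (glue b m).α x ≠ x := by
    rintro (h | ⟨h, x⟩) heq
    · exact hb.fixedPointFree h (Sum.inl_injective heq)
    · have h1 : (⟨h, (m h).α x⟩ : Σ h, Y h) = ⟨h, x⟩ := Sum.inr_injective heq
      exact (hm h).fixedPointFree x (eq_of_heq (Sigma.mk.inj h1).2)
  have hT := H.isTreeRootedMap hα hf hroot hBT hne hPT
  have hB2 : (glue b m).IsTwoConnectedSubmap (Set.range Sum.inl) := by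
    rw [Decomp.isTwoConnectedSubmap_restrict H.edgeB (r := rB) hne hBT.connected, ← eB,
      isTwoConnected_relabel]
    exact hb2
  have hBset := (H.isBlock hα hB2).rootBlockSet_eq hroot ⟨r, rfl⟩
  refine ⟨hT, hBset, fun h => H.pendantSet_eq hα hBset ⟨h, rfl⟩ _
    (hPT _ ⟨h, rfl⟩).connected, ?_⟩
  rw [H.numBlocks_eq hα hB2 rP, ← finsum_comp_equiv (Equiv.ofInjective Sum.inl Sum.inl_injective)]
  congr 1
  refine finsum_congr fun h => ?_
  change ((glue b m).restrict (gluePart Y (Sum.inl h)) (rP (Sum.inl h))).numBlocks = _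
  rw [← eP h, numBlocks_relabel]

theorem exists_relabel_eq_rootBlock_glue [Nonempty X] (hb : b.IsTreeRootedMap)
    (hb2 : b.IsTwoConnected) (hm : ∀ h, (m h).IsTreeRootedMap) :
    ∃ e : X ≃ (glue b m).rootBlockSet, (∀ h, (e h : X ⊕ Σ h, Y h) = Sum.inl h) ∧
      b.relabel e = (glue b m).rootBlock := by
  obtain ⟨hT, hB, -, -⟩ := glue_spec hb hb2 hm
  have key : ∀ (S : Set (X ⊕ Σ h, Y h)) (_ : S = Set.range Sum.inl) (r : Option S)
      (_ : r.map Subtype.val = b.root.map Sum.inl),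
      ∃ e : X ≃ S, (∀ h, (e h : X ⊕ Σ h, Y h) = Sum.inl h) ∧
        b.relabel e = (glue b m).restrict S r := by
    rintro _ rfl r hr
    exact ⟨_, fun _ => rfl, relabel_eq_restrict_glue b m (fun h => (hm h).rooted.1) r hr⟩
  exact key _ hB _ (map_val_rootBlock_root_eq hT.involutive)

theorem toClass_pendant_glue [Nonempty X] (hb : b.IsTreeRootedMap) (hb2 : b.IsTwoConnected)
    (hm : ∀ h, (m h).IsTreeRootedMap) (h : X) :
    ((glue b m).pendant (Sum.inl h)).toClass = (m h).toClass := by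
  obtain ⟨-, -, hP, -⟩ := glue_spec hb hb2 hm
  have key : ∀ (S : Set (X ⊕ Σ h, Y h)) (_ : S = gluePart Y (Sum.inl h)) (r : Option S)
      (_ : r.map Subtype.val = (m h).root.map fun x => Sum.inr ⟨h, x⟩),
      ((glue b m).restrict S r).toClass = (m h).toClass := by
    rintro _ rfl r hr
    rw [← relabel_eq_restrict_gluePart b m (fun h => (hm h).rooted.1) h r hr, toClass_relabel]
  refine key _ (hP h) _ ?_
  change ((glue b m).pendant (Sum.inl h)).root.map Subtype.val = _
  rw [map_val_pendant_root, hP, glue_σ]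
  cases hr : (m h).root with
  | none =>
    rw [glueFun_inl_none b m hr, if_neg]
    · rfl
    · rintro ⟨x, hx⟩
      cases hx
  | some y =>
    rw [glueFun_inl_some b m hr, if_pos ⟨y, rfl⟩]
    rfl

end Glue

end MapData

open MapData

/-! ### The decomposition on isomorphism classes -/

namespace HalfEdgeOrder

variable (c : HalfEdgeOrder)

theorem toClass_rep (q : MapClass) : (c.rep q).2.toClass = q := by
  rw [toClass_eq_mk _ (Equiv.refl _), relabel_refl]
  exact c.rep_spec q

theorem rep_fst (q : MapClass) : (c.rep q).1 = q.numHalfEdges := by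
  have := MapClass.numHalfEdges_toClass (c.rep q).2
  rw [toClass_rep, Nat.card_eq_fintype_card, Fintype.card_fin] at this
  exact this.symm

theorem isTreeRootedMap_rep (q : MapClass) :
    (c.rep q).2.IsTreeRootedMap ↔ q.rep.IsTreeRootedMap := by
  rw [← MapClass.isTreeRootedMap_rep_toClass, toClass_rep]

theorem isTwoConnected_rep (q : MapClass) :
    (c.rep q).2.IsTwoConnected ↔ q.rep.IsTwoConnected := by
  rw [← MapClass.isTwoConnected_rep_toClass, toClass_rep]

theorem relabel_enum {D : Type} [Finite D] (d : MapData D) :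
    (c.rep d.toClass).2.relabel (c.enum d) = d :=
  (c.exists_iso d).choose_spec

/-- The numbering is defined through a chosen isomorphism. By rigidity of rooted connected maps
there is only one, so any isomorphism from the representative gives the same numbering. -/
theorem eq_enum {D : Type} [Finite D] {d : MapData D} (hd : d.IsTreeRootedMap) {q : MapClass}
    (hq : q = d.toClass) (e : Fin (c.rep q).1 ≃ D) (he : (c.rep q).2.relabel e = d) {i : ℕ}
    (h : i < (c.rep q).1) (h' : i < (c.rep d.toClass).1) : e ⟨i, h⟩ = c.enum d ⟨i, h'⟩ := by
  subst hq
  rw [relabel_injective hd he (c.relabel_enum d)]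

theorem toClass_pendant_enum {D D' : Type} [Finite D] [Finite D'] {G : MapData D}
    {d : MapData D'} (E : D ≃ D') (hE : G.relabel E = d) (hd : d.IsTreeRootedMap) {q : MapClass}
    (e : Fin (c.rep q).1 ≃ G.rootBlockSet) (he : (c.rep q).2.relabel e = G.rootBlock)
    (hq : q = d.rootBlock.toClass) {i : ℕ} (h : i < (c.rep q).1)
    (h' : i < (c.rep d.rootBlock.toClass).1) :
    (d.pendant (c.enum d.rootBlock ⟨i, h'⟩)).toClass = (G.pendant (e ⟨i, h⟩)).toClass := by
  subst hE
  have : Nonempty D' := ⟨E (e ⟨i, h⟩)⟩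
  have := c.eq_enum (isTreeRootedMap_rootBlock hd) hq (e.trans (E.subtypeEquiv fun x =>
    (mem_rootBlockSet_relabel E G x).symm)) (by rw [← relabel_trans, he, relabel_rootBlock]) h h'
  rw [← this]
  exact toClass_pendant_relabel E G _

/-- The class with root block `b` and with pendant submaps `m`. -/
noncomputable def assemble (b : MapClass) (m : ℕ → MapClass) : MapClass :=
  (glue (c.rep b).2 fun i : Fin (c.rep b).1 => (m i).rep).toClass

/-- The pendant submaps of a class (the vertex map for the indices without meaning). -/
noncomputable def childD (q : MapClass) (i : ℕ) : MapClass := (c.child q i).getD MapClass.vertexMap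

theorem child_eq_some {q : MapClass} {i : ℕ} (h : i < q.rootBlock.numHalfEdges) :
    c.child q i = some (c.childD q i) := by
  have h' : i < (c.rep q.rep.rootBlock.toClass).1 := by rwa [rep_fst]
  rw [childD, child, dif_pos h']
  rfl

theorem child_eq_none {q : MapClass} {i : ℕ} (h : ¬ i < q.rootBlock.numHalfEdges) :
    c.child q i = none := by
  have h' : ¬ i < (c.rep q.rep.rootBlock.toClass).1 := by rwa [rep_fst]
  rw [child, dif_neg h']

theorem childD_eq {q : MapClass} {i : ℕ} (h : i < (c.rep q.rep.rootBlock.toClass).1) :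
    c.childD q i = (q.rep.pendant (c.enum q.rep.rootBlock ⟨i, h⟩)).toClass := by
  rw [childD, child, dif_pos h]
  rfl

/-- A block: a 2-connected tree-rooted map of positive size. -/
structure _root_.TreeRooted.MapClass.IsPosBlock (b : MapClass) : Prop where
  tr : b.rep.IsTreeRootedMap
  two : b.rep.IsTwoConnected
  pos : 0 < b.numHalfEdges

theorem isPosBlock_rootBlock {q : MapClass} (hq : q.rep.IsTreeRootedMap)
    (hpos : 0 < q.numHalfEdges) : q.rootBlock.IsPosBlock := by
  have : Nonempty (Fin q.numHalfEdges) := ⟨⟨0, hpos⟩⟩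
  obtain ⟨r, hr⟩ := exists_root hq
  refine ⟨(MapClass.isTreeRootedMap_rep_toClass _).2 (isTreeRootedMap_rootBlock hq),
    (MapClass.isTwoConnected_rep_toClass _).2 (isTwoConnected_rootBlock hq), ?_⟩
  have hne : Nonempty q.rep.rootBlockSet := ⟨⟨r, (isBlock_rootBlockSet hq.involutive hr).2⟩⟩
  rw [MapClass.rootBlock, MapClass.numHalfEdges_toClass]
  exact Nat.card_pos

theorem isTreeRootedMap_childD {q : MapClass} (hq : q.rep.IsTreeRootedMap) {i : ℕ}
    (h : i < q.rootBlock.numHalfEdges) : (c.childD q i).rep.IsTreeRootedMap := by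
  rw [childD_eq c (by rwa [rep_fst] : i < (c.rep q.rep.rootBlock.toClass).1),
    MapClass.isTreeRootedMap_rep_toClass]
  exact isTreeRootedMap_pendant hq (Subtype.coe_prop _)

/-- Gluing after taking apart: the injectivity half of the bijection between maps and decorated
trees. -/
theorem assemble_eq {q : MapClass} (hq : q.rep.IsTreeRootedMap) (hpos : 0 < q.numHalfEdges) :
    c.assemble q.rootBlock (c.childD q) = q := by
  have : Nonempty (Fin q.numHalfEdges) := ⟨⟨0, hpos⟩⟩
  obtain ⟨r, hr⟩ := exists_root hq
  have H := decomp_rootBlockSet hq hr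
  have hiso : ∀ i : Fin (c.rep q.rep.rootBlock.toClass).1,
      ∃ g : Fin (c.childD q i).numHalfEdges ≃ q.rep.pendantSet (c.enum q.rep.rootBlock i),
        (c.childD q i).rep.relabel g = q.rep.pendant (c.enum q.rep.rootBlock i) := by
    intro i
    rw [← toClass_eq_iff, MapClass.toClass_rep]
    exact childD_eq c i.2
  choose g hg using hiso
  obtain ⟨E, hE⟩ := exists_relabel_glue_eq H (map_val_rootBlock_root_eq hq.involutive)
    (c.enum q.rep.rootBlock) (c.relabel_enum _)
    (fun i => (q.rep.pendant (c.enum q.rep.rootBlock i)).root)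
    (fun i x => pendant_root_eq_some_iff x) g hg
  exact ((toClass_relabel E _).symm.trans (congrArg toClass hE)).trans (MapClass.toClass_rep q)

variable {b : MapClass} {m : ℕ → MapClass}

/-- Taking apart after gluing: the surjectivity half, with the additivity of sizes and of block
numbers. -/
theorem assemble_spec (hb : b.IsPosBlock) (hm : ∀ i < b.numHalfEdges, (m i).rep.IsTreeRootedMap) :
    (c.assemble b m).rep.IsTreeRootedMap ∧ (c.assemble b m).rootBlock = b ∧
      (∀ i < b.numHalfEdges, c.childD (c.assemble b m) i = m i) ∧
      (c.assemble b m).numHalfEdges =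
        b.numHalfEdges + ∑ i ∈ Finset.range b.numHalfEdges, (m i).numHalfEdges ∧
      (c.assemble b m).numBlocks =
        1 + ∑ i ∈ Finset.range b.numHalfEdges, (m i).numBlocks := by
  have hN := c.rep_fst b
  have : Nonempty (Fin (c.rep b).1) := ⟨⟨0, hN ▸ hb.pos⟩⟩
  have hb1 := (c.isTreeRootedMap_rep b).2 hb.tr
  have hb2 := (c.isTwoConnected_rep b).2 hb.two
  have hm' : ∀ i : Fin (c.rep b).1, (m i).rep.IsTreeRootedMap := fun i => hm i (hN ▸ i.2)
  obtain ⟨hT, hB, hP, hn⟩ := glue_spec hb1 hb2 hm'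
  obtain ⟨e, he, hbe⟩ := exists_relabel_eq_rootBlock_glue hb1 hb2 hm'
  have hpend := toClass_pendant_glue hb1 hb2 hm'
  have hroot : (c.assemble b m).rootBlock = b := by
    rw [assemble, MapClass.rootBlock_toClass, ← hbe, toClass_relabel, toClass_rep]
  refine ⟨(MapClass.isTreeRootedMap_rep_toClass _).2 hT, hroot, ?_, ?_, ?_⟩
  · intro i hi
    obtain ⟨E, hE⟩ := MapClass.exists_relabel_eq_rep
      (glue (c.rep b).2 fun i : Fin (c.rep b).1 => (m i).rep)
    have hi' : i < (c.rep (c.assemble b m).rep.rootBlock.toClass).1 := by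
      rw [rep_fst]
      exact (congrArg MapClass.numHalfEdges hroot).symm ▸ hi
    rw [childD_eq c hi']
    refine (toClass_pendant_enum c E hE ((MapClass.isTreeRootedMap_rep_toClass _).2 hT) e hbe
      hroot.symm (hN ▸ hi) hi').trans ?_
    rw [he, hpend, MapClass.toClass_rep]
  · rw [assemble, MapClass.numHalfEdges_toClass, Nat.card_sum, Nat.card_sigma,
      Nat.card_eq_fintype_card, Fintype.card_fin, hN]
    simp only [Nat.card_eq_fintype_card, Fintype.card_fin]
    congr 1
    rw [← hN, ← Fin.sum_univ_eq_sum_range (fun i => (m i).numHalfEdges) (c.rep b).1]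
  · rw [assemble, MapClass.numBlocks_toClass, hn, finsum_eq_sum_of_fintype]
    change 1 + ∑ i : Fin (c.rep b).1, (m i).numBlocks = _
    rw [Fin.sum_univ_eq_sum_range (fun i => (m i).numBlocks) (c.rep b).1, hN]

end HalfEdgeOrder

end TreeRooted

/-! ### The block tree, and the bijection between maps and trees of blocks. -/

namespace TreeRooted

open Equiv

/-! ### The vertex map -/

open MapData in
theorem eq_vertexMap {q : MapClass} (hq : q.rep.IsTreeRootedMap) (h0 : q.numHalfEdges = 0) :
    q = MapClass.vertexMap := by
  have hE : IsEmpty (Fin q.numHalfEdges) := by rw [h0]; infer_instance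
  have : MapClass.vertexMap = (⟨1, 1, ∅, none⟩ : MapData (Fin 0)).toClass := by
    rw [toClass_eq_mk _ (Equiv.refl _), relabel_refl]
    rfl
  rw [this, ← MapClass.toClass_rep q, toClass_eq_iff]
  refine ⟨finCongr h0, (relabel_eq_iff _ _ _).2 ⟨isEmptyElim, isEmptyElim, isEmptyElim, ?_⟩⟩
  rw [hq.rooted.2 hE]
  rfl

theorem numHalfEdges_vertexMap : MapClass.vertexMap.numHalfEdges = 0 := by
  have : MapClass.vertexMap = (⟨1, 1, ∅, none⟩ : MapData (Fin 0)).toClass := by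
    rw [MapData.toClass_eq_mk _ (Equiv.refl _), MapData.relabel_refl]
    rfl
  rw [this, MapClass.numHalfEdges_toClass, Nat.card_eq_fintype_card, Fintype.card_fin]

theorem isTreeRootedMap_vertexMap : MapClass.vertexMap.rep.IsTreeRootedMap := by
  have : IsEmpty (Fin MapClass.vertexMap.numHalfEdges) := by
    rw [numHalfEdges_vertexMap]; infer_instance
  exact MapData.isTreeRootedMap_of_isEmpty _

theorem isTwoConnected_of_numHalfEdges_eq_zero {q : MapClass} (h : q.numHalfEdges = 0) :
    q.rep.IsTwoConnected := by
  have : IsEmpty (Fin q.numHalfEdges) := by rw [h]; infer_instance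
  rintro ⟨E₁, E₂, -, -, ⟨x, -⟩, -⟩
  exact isEmptyElim x

theorem rootBlock_of_numHalfEdges_eq_zero {q : MapClass} (h : q.numHalfEdges = 0) :
    q.rootBlock = MapClass.vertexMap := by
  have : IsEmpty (Fin q.numHalfEdges) := by rw [h]; infer_instance
  apply eq_vertexMap
  · exact (MapClass.isTreeRootedMap_rep_toClass _).2 (MapData.isTreeRootedMap_of_isEmpty _)
  · rw [MapClass.rootBlock, MapClass.numHalfEdges_toClass, Nat.card_of_isEmpty]

theorem numBlocks_of_numHalfEdges_eq_zero {q : MapClass} (h : q.numHalfEdges = 0) :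
    q.numBlocks = 0 := by
  have : IsEmpty (Fin q.numHalfEdges) := by rw [h]; infer_instance
  rw [MapClass.numBlocks, MapData.numBlocks, Set.ncard_eq_zero]
  refine Set.eq_empty_of_forall_notMem fun S hS => ?_
  obtain ⟨x, -⟩ := hS.1.nonempty
  exact isEmptyElim x

theorem mem_twoConnectedMaps_zero {q : MapClass} :
    q ∈ twoConnectedMaps 0 ↔ q = MapClass.vertexMap := by
  constructor
  · rintro ⟨⟨h1, h2⟩, -⟩
    exact eq_vertexMap h1 h2
  · rintro rfl
    exact ⟨⟨isTreeRootedMap_vertexMap, numHalfEdges_vertexMap⟩,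
      isTwoConnected_of_numHalfEdges_eq_zero numHalfEdges_vertexMap⟩

theorem MapData.IsTreeRootedMap.exists_card_eq {D : Type} [Finite D] {d : MapData D}
    (h : d.IsTreeRootedMap) : ∃ n, Nat.card D = 2 * n :=
  ⟨_, (MapData.two_mul_numCycles_alpha h.involutive h.fixedPointFree).symm⟩

theorem exists_mem_maps {q : MapClass} (h : q.rep.IsTreeRootedMap) : ∃ n, q ∈ maps n := by
  obtain ⟨n, hn⟩ := h.exists_card_eq
  rw [Nat.card_eq_fintype_card, Fintype.card_fin] at hn
  exact ⟨n, h, hn⟩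

/-! ### Plane trees -/

theorem nil_mem_treeOfOffspring (ξ : List ℕ → ℕ) : [] ∈ treeOfOffspring ξ :=
  fun _ h => absurd h (Nat.not_lt_zero _)

theorem cons_mem_treeOfOffspring (ξ : List ℕ → ℕ) (i : ℕ) (w : List ℕ) :
    i :: w ∈ treeOfOffspring ξ ↔ i < ξ [] ∧ w ∈ treeOfOffspring fun v => ξ (i :: v) := by
  constructor
  · intro h
    exact ⟨h 0 (Nat.succ_pos _), fun j hj => h (j + 1) (Nat.succ_lt_succ hj)⟩
  · rintro ⟨h1, h2⟩ (_ | j) hj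
    · exact h1
    · exact h2 j (Nat.lt_of_succ_lt_succ hj)

theorem append_mem_treeOfOffspring (ξ : List ℕ → ℕ) (v : List ℕ) (i : ℕ) :
    v ++ [i] ∈ treeOfOffspring ξ ↔ v ∈ treeOfOffspring ξ ∧ i < ξ v := by
  induction v generalizing ξ with
  | nil =>
    rw [List.nil_append, cons_mem_treeOfOffspring]
    simp [nil_mem_treeOfOffspring]
  | cons j v ih =>
    rw [List.cons_append, cons_mem_treeOfOffspring, cons_mem_treeOfOffspring, ih, and_assoc]

theorem numChildren_treeOfOffspring {ξ : List ℕ → ℕ} {v : List ℕ}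
    (hv : v ∈ treeOfOffspring ξ) : numChildren (treeOfOffspring ξ) v = ξ v := by
  have : {i : ℕ | v ++ [i] ∈ treeOfOffspring ξ} = Set.Iio (ξ v) := by
    ext i
    rw [Set.mem_ofPred_eq, append_mem_treeOfOffspring, and_iff_right hv, Set.mem_Iio]
  rw [numChildren, this, ← Finset.coe_Iio, Set.ncard_coe_finset, Nat.card_Iio]

/-- Only the values of `ξ` on the tree matter. -/
theorem treeOfOffspring_congr {ξ ξ' : List ℕ → ℕ} (h : ∀ v ∈ treeOfOffspring ξ, ξ v = ξ' v) :
    treeOfOffspring ξ = treeOfOffspring ξ' := by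
  ext w
  induction w using List.reverseRecOn with
  | nil => simp [nil_mem_treeOfOffspring]
  | append_singleton v i ih =>
    rw [append_mem_treeOfOffspring, append_mem_treeOfOffspring, ← ih]
    exact and_congr_right fun hv => by rw [h v hv]

/-- Words are sorted by their first letter. It serves for the nodes of a tree and for its inner
nodes alike. -/
theorem ncard_of_cons {A : Set (List ℕ)} {k : ℕ} {A' : ℕ → Set (List ℕ)} (h0 : [] ∈ A)
    (h : ∀ i w, i :: w ∈ A ↔ i < k ∧ w ∈ A' i) (hf : ∀ i < k, (A' i).Finite) :
    A.Finite ∧ A.ncard = 1 + ∑ i ∈ Finset.range k, (A' i).ncard := by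
  have hfin : ∀ i : Fin k, Finite (A' i) := fun i => hf i i.2
  let F : Option (Σ i : Fin k, A' i) → A := fun o => o.elim ⟨[], h0⟩
    fun p => ⟨p.1 :: p.2, (h _ _).2 ⟨p.1.2, p.2.2⟩⟩
  have hF : Function.Bijective F := by
    constructor
    · rintro (_ | ⟨i, w⟩) (_ | ⟨j, w'⟩) heq
      · rfl
      · exact absurd (congrArg Subtype.val heq) (by simp [F])
      · exact absurd (congrArg Subtype.val heq) (by simp [F])
      · have h1 : (i : ℕ) :: (w : List ℕ) = (j : ℕ) :: (w' : List ℕ) := congrArg Subtype.val heq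
        rw [List.cons.injEq] at h1
        obtain rfl : i = j := Fin.ext h1.1
        rw [Subtype.ext h1.2]
    · rintro ⟨_ | ⟨i, w⟩, hw⟩
      · exact ⟨none, rfl⟩
      · obtain ⟨hi, hw'⟩ := (h _ _).1 hw
        exact ⟨some ⟨⟨i, hi⟩, w, hw'⟩, rfl⟩
  have e := Equiv.ofBijective F hF
  refine ⟨Finite.of_equiv _ e, ?_⟩
  rw [MapData.ncard_eq_card, ← Nat.card_congr e, Finite.card_option, Nat.card_sigma, add_comm,
    ← Fin.sum_univ_eq_sum_range (fun i => (A' i).ncard)]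
  rfl

namespace HalfEdgeOrder

variable (c : HalfEdgeOrder)

/-! ### Recursion for the block tree -/

theorem block_nil (q : MapClass) : c.block [] q = q.rootBlock := rfl

theorem block_cons {q : MapClass} {i : ℕ} (h : i < q.rootBlock.numHalfEdges) (v : List ℕ) :
    c.block (i :: v) q = c.block v (c.childD q i) := by
  rw [block, submapAt, c.child_eq_some h]
  rfl

theorem block_cons_of_not {q : MapClass} {i : ℕ} (h : ¬ i < q.rootBlock.numHalfEdges)
    (v : List ℕ) : c.block (i :: v) q = MapClass.vertexMap := by
  rw [block, submapAt, c.child_eq_none h]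
  rfl

theorem blockTree_eq (q : MapClass) :
    c.blockTree q = treeOfOffspring fun v => (c.block v q).numHalfEdges := by
  ext w
  induction w generalizing q with
  | nil => simp [nil_mem_treeOfOffspring, blockTree, submapAt]
  | cons i w ih =>
    rw [cons_mem_treeOfOffspring, block_nil]
    by_cases h : i < q.rootBlock.numHalfEdges
    · have e : (fun v => (c.block (i :: v) q).numHalfEdges) =
          fun v => (c.block v (c.childD q i)).numHalfEdges := by
        funext v
        rw [c.block_cons h]
      rw [e, ← ih, blockTree, Set.mem_ofPred_eq, submapAt, c.child_eq_some h]
      simp [h, blockTree]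
    · rw [blockTree, Set.mem_ofPred_eq, submapAt, c.child_eq_none h]
      simp [h]

theorem block_of_not_mem {q : MapClass} {v : List ℕ} (hv : v ∉ c.blockTree q) :
    c.block v q = MapClass.vertexMap := by
  rw [blockTree, Set.mem_ofPred_eq, Bool.not_eq_true, Option.isSome_eq_false_iff,
    Option.isNone_iff_eq_none] at hv
  rw [block, hv]
  rfl

theorem assemble_congr {b : MapClass} {m m' : ℕ → MapClass}
    (h : ∀ i < b.numHalfEdges, m i = m' i) : c.assemble b m = c.assemble b m' := by
  have hN := c.rep_fst b
  have : (fun i : Fin (c.rep b).1 => m i) = fun i : Fin (c.rep b).1 => m' i :=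
    funext fun i => h i (hN ▸ i.2)
  have key : ∀ f g : Fin (c.rep b).1 → MapClass, f = g →
      (MapData.glue (c.rep b).2 fun i => (f i).rep).toClass =
      (MapData.glue (c.rep b).2 fun i => (g i).rep).toClass := by
    rintro f _ rfl
    rfl
  exact key _ _ this

/-- The root block has positive size, so each pendant submap is strictly smaller than the map. -/
theorem tree_rooted_induction {p : MapClass → Prop}
    (h0 : p MapClass.vertexMap)
    (h : ∀ q : MapClass, q.rep.IsTreeRootedMap → 0 < q.numHalfEdges →
      q.rootBlock.IsPosBlock →
      (∀ i < q.rootBlock.numHalfEdges, (c.childD q i).rep.IsTreeRootedMap ∧ p (c.childD q i)) →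
      p q) (q : MapClass) (hq : q.rep.IsTreeRootedMap) : p q := by
  generalize hn : q.numHalfEdges = n
  induction n using Nat.strong_induction_on generalizing q with
  | _ n ih =>
    rcases Nat.eq_zero_or_pos q.numHalfEdges with hz | hpos
    · rw [eq_vertexMap hq hz]
      exact h0
    · have hb := isPosBlock_rootBlock hq hpos
      refine h q hq hpos hb fun i hi => ?_
      have hc := c.isTreeRootedMap_childD hq hi
      refine ⟨hc, ih _ ?_ _ hc rfl⟩
      have hsz := (c.assemble_spec hb fun i hi => c.isTreeRootedMap_childD hq hi).2.2.2.1
      rw [c.assemble_eq hq hpos] at hsz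
      have := Finset.single_le_sum (f := fun i => (c.childD q i).numHalfEdges)
        (fun _ _ => Nat.zero_le _) (Finset.mem_range.2 hi)
      have := hb.pos
      omega

theorem block_spec {q : MapClass} (hq : q.rep.IsTreeRootedMap) (v : List ℕ) :
    (c.block v q).rep.IsTreeRootedMap ∧ (c.block v q).rep.IsTwoConnected := by
  revert v
  refine c.tree_rooted_induction (p := fun q => ∀ v, (c.block v q).rep.IsTreeRootedMap ∧
    (c.block v q).rep.IsTwoConnected) ?_ ?_ q hq
  · intro v
    have : c.block v MapClass.vertexMap = MapClass.vertexMap := by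
      have hr := rootBlock_of_numHalfEdges_eq_zero numHalfEdges_vertexMap
      cases v with
      | nil => exact hr
      | cons i v =>
        refine c.block_cons_of_not ?_ v
        rw [hr, numHalfEdges_vertexMap]
        exact Nat.not_lt_zero _
    rw [this]
    exact ⟨isTreeRootedMap_vertexMap,
      isTwoConnected_of_numHalfEdges_eq_zero numHalfEdges_vertexMap⟩
  · intro q _ _ hb ih v
    cases v with
    | nil => exact ⟨hb.tr, hb.two⟩
    | cons i v =>
      by_cases hi : i < q.rootBlock.numHalfEdges
      · rw [c.block_cons hi]
        exact (ih i hi).2 v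
      · rw [c.block_cons_of_not hi]
        exact ⟨isTreeRootedMap_vertexMap,
          isTwoConnected_of_numHalfEdges_eq_zero numHalfEdges_vertexMap⟩

theorem cons_mem_blockTree {q : MapClass} (i : ℕ) (w : List ℕ) :
    i :: w ∈ c.blockTree q ↔ i < q.rootBlock.numHalfEdges ∧ w ∈ c.blockTree (c.childD q i) := by
  rw [blockTree_eq, blockTree_eq, cons_mem_treeOfOffspring, block_nil]
  refine and_congr_right fun hi => ?_
  simp only [c.block_cons hi]

theorem nil_mem_blockTree (q : MapClass) : [] ∈ c.blockTree q := by
  rw [blockTree_eq]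
  exact nil_mem_treeOfOffspring _

/-- The sizes of a tree-rooted map in terms of its block tree. -/
theorem blockTree_spec {q : MapClass} (hq : q.rep.IsTreeRootedMap) :
    (c.blockTree q).Finite ∧ (c.blockTree q).ncard = q.numHalfEdges + 1 ∧
      {v ∈ c.blockTree q | (c.block v q).numHalfEdges ≠ 0}.ncard = q.numBlocks := by
  refine c.tree_rooted_induction (p := fun q => (c.blockTree q).Finite ∧
    (c.blockTree q).ncard = q.numHalfEdges + 1 ∧
      {v ∈ c.blockTree q | (c.block v q).numHalfEdges ≠ 0}.ncard = q.numBlocks) ?_ ?_ q hq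
  · have hr := rootBlock_of_numHalfEdges_eq_zero numHalfEdges_vertexMap
    have hT : c.blockTree MapClass.vertexMap = {[]} := by
      ext w
      cases w with
      | nil => simp [nil_mem_blockTree]
      | cons i w => simp [cons_mem_blockTree, hr, numHalfEdges_vertexMap]
    refine ⟨by rw [hT]; exact Set.finite_singleton _, by simp [hT, numHalfEdges_vertexMap], ?_⟩
    rw [numBlocks_of_numHalfEdges_eq_zero numHalfEdges_vertexMap, hT]
    convert Set.ncard_empty (α := List ℕ)
    refine Set.eq_empty_of_forall_notMem ?_
    rintro _ ⟨rfl, hv⟩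
    rw [block_nil, hr, numHalfEdges_vertexMap] at hv
    exact hv rfl
  · intro q hq hpos hb ih
    obtain ⟨-, -, -, hsize, hblocks⟩ :=
      c.assemble_spec hb fun i hi => c.isTreeRootedMap_childD hq hi
    rw [c.assemble_eq hq hpos] at hsize hblocks
    have hfin : ∀ i < q.rootBlock.numHalfEdges, (c.blockTree (c.childD q i)).Finite :=
      fun i hi => (ih i hi).2.1
    have h1 := ncard_of_cons (c.nil_mem_blockTree q) (fun i w => c.cons_mem_blockTree i w) hfin
    have h2 := ncard_of_cons (A := {v ∈ c.blockTree q | (c.block v q).numHalfEdges ≠ 0})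
      (k := q.rootBlock.numHalfEdges) (A' := fun i =>
        {v ∈ c.blockTree (c.childD q i) | (c.block v (c.childD q i)).numHalfEdges ≠ 0})
      ⟨c.nil_mem_blockTree q, hb.pos.ne'⟩ (fun i w => by
        rw [Set.mem_sep_iff, Set.mem_sep_iff, cons_mem_blockTree, and_assoc]
        refine and_congr_right fun hi => ?_
        rw [c.block_cons hi]) fun i hi => (hfin i hi).subset (Set.sep_subset _ _)
    refine ⟨h1.1, ?_, ?_⟩
    · rw [h1.2, hsize, Finset.sum_congr rfl fun i hi => (ih i (Finset.mem_range.1 hi)).2.2.1,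
        Finset.sum_add_distrib, Finset.sum_const, Finset.card_range, smul_eq_mul, mul_one]
      ring
    · rw [h2.2, hblocks, Finset.sum_congr rfl fun i hi => (ih i (Finset.mem_range.1 hi)).2.2.2]

/-- A tree-rooted map is determined by its decorated block tree. -/
theorem eq_of_block_eq {q q' : MapClass} (hq : q.rep.IsTreeRootedMap)
    (hq' : q'.rep.IsTreeRootedMap) (h : ∀ v, c.block v q = c.block v q') : q = q' := by
  have hpos_iff : ∀ {q : MapClass}, q.rep.IsTreeRootedMap →
      (0 < q.numHalfEdges ↔ 0 < q.rootBlock.numHalfEdges) := by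
    intro q hq
    refine ⟨fun hp => (isPosBlock_rootBlock hq hp).pos, fun hp => ?_⟩
    by_contra h0
    rw [rootBlock_of_numHalfEdges_eq_zero (by omega), numHalfEdges_vertexMap] at hp
    exact lt_irrefl 0 hp
  suffices H : ∀ q' : MapClass, q'.rep.IsTreeRootedMap →
      (∀ v, c.block v q = c.block v q') → q = q' from H q' hq' h
  refine c.tree_rooted_induction (p := fun q => ∀ q' : MapClass, q'.rep.IsTreeRootedMap →
    (∀ v, c.block v q = c.block v q') → q = q') ?_ ?_ q hq
  · intro q' hq' h
    have hroot : MapClass.vertexMap.rootBlock = q'.rootBlock := h []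
    rw [rootBlock_of_numHalfEdges_eq_zero numHalfEdges_vertexMap] at hroot
    refine (eq_vertexMap hq' ?_).symm
    by_contra h0
    have := (hpos_iff hq').1 (Nat.pos_of_ne_zero h0)
    rw [← hroot, numHalfEdges_vertexMap] at this
    exact lt_irrefl 0 this
  · intro q hq hpos hb ih q' hq' h
    have hroot : q.rootBlock = q'.rootBlock := h []
    have hpos' : 0 < q'.numHalfEdges := (hpos_iff hq').2 (hroot ▸ hb.pos)
    rw [← c.assemble_eq hq hpos, ← c.assemble_eq hq' hpos', ← hroot]
    refine c.assemble_congr fun i hi => ?_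
    have hi' : i < q'.rootBlock.numHalfEdges := hroot ▸ hi
    refine (ih i hi).2 _ (c.isTreeRootedMap_childD hq' hi') fun v => ?_
    rw [← c.block_cons hi, ← c.block_cons hi', h]

/-- Every finite tree of blocks is the decorated block tree of a tree-rooted map. -/
theorem exists_block_eq {F : List ℕ → MapClass}
    (hF : ∀ v, (F v).rep.IsTreeRootedMap ∧ (F v).rep.IsTwoConnected)
    (hfin : (treeOfOffspring fun v => (F v).numHalfEdges).Finite)
    (hoff : ∀ v, v ∉ (treeOfOffspring fun v => (F v).numHalfEdges) →
      F v = MapClass.vertexMap) :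
    ∃ q : MapClass, q.rep.IsTreeRootedMap ∧ ∀ v, c.block v q = F v := by
  generalize hn : (treeOfOffspring fun v => (F v).numHalfEdges).ncard = n
  induction n using Nat.strong_induction_on generalizing F with
  | _ n ih =>
    rcases Nat.eq_zero_or_pos (F []).numHalfEdges with hz | hpos
    · refine ⟨MapClass.vertexMap, isTreeRootedMap_vertexMap, fun v => ?_⟩
      have hr := rootBlock_of_numHalfEdges_eq_zero numHalfEdges_vertexMap
      cases v with
      | nil => rw [block_nil, hr, eq_vertexMap (hF []).1 hz]
      | cons i v =>
        rw [hoff (i :: v) (by rw [cons_mem_treeOfOffspring, hz]; simp), c.block_cons_of_not]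
        rw [hr, numHalfEdges_vertexMap]
        exact Nat.not_lt_zero _
    · have hcons := cons_mem_treeOfOffspring fun v => (F v).numHalfEdges
      have hfin' : ∀ i < (F []).numHalfEdges,
          (treeOfOffspring fun v => (F (i :: v)).numHalfEdges).Finite := fun i hi =>
        (hfin.preimage (f := List.cons i) (fun _ _ _ _ h => (List.cons.inj h).2)).subset
          fun w hw => (hcons i w).2 ⟨hi, hw⟩
      have hcard := (ncard_of_cons (nil_mem_treeOfOffspring _) hcons hfin').2
      have key : ∀ i < (F []).numHalfEdges, ∃ q : MapClass, q.rep.IsTreeRootedMap ∧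
          ∀ v, c.block v q = F (i :: v) := by
        intro i hi
        refine ih _ ?_ (fun v => hF (i :: v)) (hfin' i hi) (fun v hv => ?_) rfl
        · have := Finset.single_le_sum
            (f := fun i => (treeOfOffspring fun v => (F (i :: v)).numHalfEdges).ncard)
            (fun _ _ => Nat.zero_le _) (Finset.mem_range.2 hi)
          omega
        · exact hoff (i :: v) fun h => hv ((hcons i v).1 h).2
      have : Nonempty MapClass := ⟨MapClass.vertexMap⟩
      choose! m hm hm' using key
      have hb : (F []).IsPosBlock := ⟨(hF []).1, (hF []).2, hpos⟩
      obtain ⟨h1, h2, h3, -, -⟩ := c.assemble_spec hb hm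
      refine ⟨_, h1, fun v => ?_⟩
      cases v with
      | nil => exact h2
      | cons i v =>
        by_cases hi : i < (F []).numHalfEdges
        · rw [c.block_cons (by rw [h2]; exact hi), h3 i hi, hm' i hi]
        · rw [c.block_cons_of_not (by rw [h2]; exact hi), hoff (i :: v) fun h => hi ((hcons i v).1 h).1]

/-! ### The maps with a given block tree -/

/-- Also for words that are not nodes: there the decoration defaults to the vertex map, the only map
of size 0. Conditions over all words thus amount to conditions on the tree. -/
theorem block_mem_twoConnectedMaps {q : MapClass} (hq : q.rep.IsTreeRootedMap) (v : List ℕ) :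
    c.block v q ∈ twoConnectedMaps ((c.block v q).numHalfEdges / 2) := by
  obtain ⟨h1, h2⟩ := c.block_spec hq v
  obtain ⟨n, hn⟩ := exists_mem_maps h1
  refine ⟨⟨h1, ?_⟩, h2⟩
  have := hn.2
  omega

/-- The tree-rooted maps whose block tree is the tree with `2 * k v` children at each node `v`. -/
def fiber (k : List ℕ → ℕ) : Set MapClass :=
  {q | q.rep.IsTreeRootedMap ∧ ∀ v, c.block v q ∈ twoConnectedMaps (k v)}

variable {c} {k : List ℕ → ℕ}

theorem blockTree_of_mem_fiber {q : MapClass} (hq : q ∈ c.fiber k) :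
    c.blockTree q = treeOfOffspring fun v => 2 * k v := by
  rw [blockTree_eq]
  congr 1
  funext v
  exact (hq.2 v).1.2

/-- The tree determines the sizes of the blocks, since a node has two children for each edge of its
block. Its 2n edges correspond to the half-edges of the map. -/
theorem mem_fiber_iff {n : ℕ} {t : Set (List ℕ)} (ht : t = treeOfOffspring fun v => 2 * k v)
    (hk : ∀ v, v ∉ t → k v = 0) (hn : t.encard = 2 * n + 1) {q : MapClass} :
    q ∈ c.fiber k ↔ q ∈ maps n ∧ c.blockTree q = t := by
  constructor
  · intro hq
    have hqt : c.blockTree q = t := by rw [blockTree_of_mem_fiber hq, ht]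
    obtain ⟨hfin, hcard, -⟩ := c.blockTree_spec hq.1
    refine ⟨⟨hq.1, ?_⟩, hqt⟩
    rw [hqt] at hcard hfin
    rw [← hfin.cast_ncard_eq, hcard] at hn
    have : q.numHalfEdges + 1 = 2 * n + 1 := by exact_mod_cast hn
    omega
  · rintro ⟨hq, hqt⟩
    refine ⟨hq.1, fun v => ?_⟩
    have hmem := c.block_mem_twoConnectedMaps hq.1 v
    by_cases hv : v ∈ t
    · have h1 := numChildren_treeOfOffspring (ht ▸ hv : v ∈ treeOfOffspring fun v => 2 * k v)
      have h2 := numChildren_treeOfOffspring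
        (c.blockTree_eq q ▸ hqt ▸ hv : v ∈ treeOfOffspring fun v => (c.block v q).numHalfEdges)
      rw [← ht] at h1
      rw [← c.blockTree_eq, hqt] at h2
      have : (c.block v q).numHalfEdges / 2 = k v := by omega
      rwa [this] at hmem
    · rw [hk v hv, c.block_of_not_mem (hqt ▸ hv)]
      exact mem_twoConnectedMaps_zero.2 rfl

theorem exists_eq_treeOfOffspring {q : MapClass} (hq : q.rep.IsTreeRootedMap) :
    ∃ k : List ℕ → ℕ, c.blockTree q = (treeOfOffspring fun v => 2 * k v) ∧
      ∀ v, v ∉ c.blockTree q → k v = 0 := by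
  refine ⟨fun v => (c.block v q).numHalfEdges / 2, ?_, fun v hv => ?_⟩
  · rw [blockTree_eq]
    congr 1
    funext v
    exact (c.block_mem_twoConnectedMaps hq v).1.2
  · beta_reduce
    rw [c.block_of_not_mem hv, numHalfEdges_vertexMap]

theorem numBlocks_of_mem_fiber {q : MapClass} (hq : q ∈ c.fiber k) :
    q.numBlocks = {v ∈ treeOfOffspring fun v => 2 * k v | k v ≠ 0}.ncard := by
  rw [← (c.blockTree_spec hq.1).2.2, blockTree_of_mem_fiber hq]
  congr 1
  ext v
  rw [Set.mem_sep_iff, Set.mem_sep_iff, (hq.2 v).1.2]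
  refine and_congr_right fun _ => ?_
  omega

/-- Blocks of the prescribed sizes can be chosen freely and independently at the nodes. This product
structure is the source of both the law of the tree and the independence of the blocks. -/
theorem bijective_block (hfin : (treeOfOffspring fun v => 2 * k v).Finite)
    (hk : ∀ v, v ∉ (treeOfOffspring fun v => 2 * k v) → k v = 0) :
    Function.Bijective fun (q : c.fiber k) (v : treeOfOffspring fun v => 2 * k v) =>
      (⟨c.block v q, q.2.2 v⟩ : twoConnectedMaps (k v)) := by
  classical
  constructor
  · intro q q' h
    refine Subtype.ext (c.eq_of_block_eq q.2.1 q'.2.1 fun v => ?_)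
    by_cases hv : v ∈ treeOfOffspring fun v => 2 * k v
    · exact congrArg Subtype.val (congrFun h ⟨v, hv⟩)
    · rw [c.block_of_not_mem (by rwa [blockTree_of_mem_fiber q.2]),
        c.block_of_not_mem (by rwa [blockTree_of_mem_fiber q'.2])]
  · intro f
    let F : List ℕ → MapClass := fun v =>
      if hv : v ∈ treeOfOffspring fun v => 2 * k v then f ⟨v, hv⟩ else MapClass.vertexMap
    have hF1 : ∀ v (hv : v ∈ treeOfOffspring fun v => 2 * k v), F v = f ⟨v, hv⟩ :=
      fun v hv => dif_pos hv
    have hF2 : ∀ v, v ∉ (treeOfOffspring fun v => 2 * k v) → F v = MapClass.vertexMap :=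
      fun v hv => dif_neg hv
    have hF : ∀ v, F v ∈ twoConnectedMaps (k v) := by
      intro v
      by_cases hv : v ∈ treeOfOffspring fun v => 2 * k v
      · rw [hF1 v hv]
        exact (f ⟨v, hv⟩).2
      · rw [hF2 v hv, hk v hv]
        exact mem_twoConnectedMaps_zero.2 rfl
    have hN : (fun v => (F v).numHalfEdges) = fun v => 2 * k v := funext fun v => (hF v).1.2
    obtain ⟨q, hq, hqF⟩ := c.exists_block_eq (F := F) (fun v => ⟨(hF v).1.1, (hF v).2⟩)
      (by rwa [hN]) (by rwa [hN])
    refine ⟨⟨q, hq, fun v => hqF v ▸ hF v⟩, funext fun v => Subtype.ext ?_⟩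
    exact (hqF v).trans (hF1 v v.2)

end HalfEdgeOrder

end TreeRooted

/-! ### Bounds on the number of maps: the contour code, and an explicit 2-connected family. -/

namespace TreeRooted

open Equiv

/-! ### The exponential bound -/

/-- A permutation with a single cycle is a rotation. -/
theorem exists_conj_eq_finRotate {D : Type} [Finite D] {f : Perm D} (h : ∀ x y, f.SameCycle x y)
    {m : ℕ} (hm : Nat.card D = m + 1) (r : D) :
    ∃ e : D ≃ Fin (m + 1), (e.symm.trans f).trans e = finRotate (m + 1) ∧ e r = 0 := by
  classical
  have := Fintype.ofFinite D
  rw [Nat.card_eq_fintype_card] at hm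
  have hc : f.IsCycleOn ((Finset.univ : Finset D) : Set D) := by
    refine ⟨?_, fun x _ y _ => h x y⟩
    rw [Finset.coe_univ]
    exact Set.bijOn_univ.2 f.bijective
  have hper : (f ^ (m + 1)) r = r := by
    rw [← hm]
    exact hc.pow_card_apply (Finset.mem_univ r)
  let g : Fin (m + 1) → D := fun i => (f ^ (i : ℕ)) r
  have hg : Function.Bijective g := by
    rw [Fintype.bijective_iff_surjective_and_card]
    refine ⟨fun x => ?_, by rw [Fintype.card_fin, hm]⟩
    obtain ⟨k, hk, hkx⟩ := hc.exists_pow_eq (Finset.mem_univ r) (Finset.mem_univ x)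
    rw [Finset.card_univ, hm] at hk
    exact ⟨⟨k, hk⟩, hkx⟩
  have hstep : ∀ i, f (g i) = g (finRotate (m + 1) i) := by
    intro i
    rw [finRotate_apply]
    change f ((f ^ (i : ℕ)) r) = (f ^ ((i + 1 : Fin (m + 1)) : ℕ)) r
    rw [Fin.val_add_one, ← Perm.mul_apply, ← pow_succ']
    split_ifs with hi
    · rw [hi, Fin.val_last, hper, pow_zero, Perm.one_apply]
    · rfl
  refine ⟨(Equiv.ofBijective g hg).symm, ?_, ?_⟩
  · ext i : 1
    rw [trans_apply, trans_apply, symm_symm, symm_apply_eq]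
    exact hstep i
  · rw [symm_apply_eq]
    rfl

namespace MapData

variable {D : Type} {d : MapData D}

theorem numCycles_mul_edgePerm_le [Finite D] (hα : ∀ x, d.α (d.α x) = x) (hf : ∀ x, d.α x ≠ x)
    (f : Perm D) {S S' : Set D} (hS : d.IsEdgeSet S) (hS' : d.IsEdgeSet S') (hSS : S ⊆ S') :
    2 * numCycles (f * d.edgePerm S') + S.ncard ≤ 2 * numCycles (f * d.edgePerm S) + S'.ncard := by
  classical
  refine edgeSet_induction hα hS hS' hSS (p := fun S' =>
    2 * numCycles (f * d.edgePerm S') + S.ncard ≤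
      2 * numCycles (f * d.edgePerm S) + S'.ncard) le_rfl ?_
  intro U hU _ _ x _ hx ih
  rw [edgePerm_union_pair hα hU hx, ncard_union_pair hα hf hU hx, ← mul_assoc]
  have := numCycles_mul_swap_le (f * d.edgePerm U) x (d.α x)
  omega

/-- If the set of edges `S` cuts a single cycle `f` into the largest possible number of cycles, then
its edges do not cross along `f`. -/
theorem sameCycle_mul_swap_of_numCycles [Finite D] [DecidableEq D] (hα : ∀ x, d.α (d.α x) = x)
    (hf : ∀ x, d.α x ≠ x) {f : Perm D} {S : Set D} (hS : d.IsEdgeSet S) (h1 : numCycles f = 1)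
    (h : S.ncard + 2 ≤ 2 * numCycles (f * d.edgePerm S)) {a b : D} (ha : a ∈ S) (hb : b ∈ S)
    (hab : b ∉ ({a, d.α a} : Set D)) : (f * swap a (d.α a)).SameCycle b (d.α b) := by
  by_contra hn
  have e0 : d.edgePerm {a, d.α a} = swap a (d.α a) := by
    have := edgePerm_union_pair hα d.isEdgeSet_empty (Set.notMem_empty a)
    rwa [Set.empty_union, edgePerm_empty hα, one_mul] at this
  have hp := isEdgeSet_pair hα a
  have e1 := edgePerm_union_pair hα hp hab
  have hsub : ({a, d.α a} ∪ {b, d.α b} : Set D) ⊆ S := by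
    rintro x ((rfl | rfl) | (rfl | rfl))
    · exact ha
    · exact hS _ ha
    · exact hb
    · exact hS _ hb
  have h2 := numCycles_mul_edgePerm_le hα hf f (hp.union (isEdgeSet_pair hα b)) hS hsub
  have h3 := ncard_union_pair hα hf hp hab
  rw [Set.ncard_pair (hf a).symm] at h3
  -- Two crossing edges leave at most one cycle, since the second transposition merges what the
  -- first one split. Each remaining edge adds at most one cycle, so the total is at least two below
  -- the required |S|/2 + 1.
  have h4 := numCycles_mul_swap_of_not _ _ _ hn
  have h5 := numCycles_mul_swap_le f a (d.α a)
  rw [e1, e0, ← mul_assoc] at h2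
  omega

/-- A plane spanning tree has a single face, its contour. It has V - 1 edges, and Euler's relation
leaves F - 1 edges outside it. So, from the contour, both the tree edges and the other edges produce
the largest possible number of cycles. -/
theorem IsTreeRootedMap.numCycles_tree [Finite D] [Nonempty D] (h : d.IsTreeRootedMap) :
    d.tree.ncard + 2 = 2 * numCycles d.σ ∧ numCycles (d.σ * d.edgePerm d.tree) = 1 ∧
      d.treeᶜ.ncard + 2 = 2 * numCycles (d.σ * d.α) := by
  have hα := h.involutive
  have hf := h.fixedPointFree
  have hp := (planar_iff hα hf).1 (h.planar inferInstance)
  have h1 := numComponents_of_acyclic hα hf h.spanning.isEdgeSet h.spanning.acyclic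
  have h2 := euler_of_planar hα hf h.connected hp h.spanning.isEdgeSet
  have h3 := Set.ncard_add_ncard_compl d.tree
  rw [numComponents_eq_one h.spanning.connected] at h1 h2
  refine ⟨?_, ?_, ?_⟩ <;> omega

theorem edgePerm_mul_self (hα : ∀ x, d.α (d.α x) = x) {S : Set D} (hS : d.IsEdgeSet S) :
    d.edgePerm S * d.edgePerm S = 1 := by
  ext x
  rw [Perm.mul_apply, Perm.one_apply]
  by_cases hx : x ∈ S
  · rw [edgePerm_of_mem hα hS hx, edgePerm_of_mem hα hS (hS x hx), hα]
  · rw [edgePerm_of_not_mem hα hS hx, edgePerm_of_not_mem hα hS hx]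

theorem edgePerm_mul_compl (hα : ∀ x, d.α (d.α x) = x) {S : Set D} (hS : d.IsEdgeSet S)
    (hS' : d.IsEdgeSet Sᶜ) : d.edgePerm S * d.edgePerm Sᶜ = d.α := by
  ext x
  rw [Perm.mul_apply]
  by_cases hx : x ∈ S
  · rw [edgePerm_of_not_mem hα hS' (not_not.2 hx), edgePerm_of_mem hα hS hx]
  · rw [edgePerm_of_mem hα hS' hx, edgePerm_of_not_mem hα hS (hS' x hx)]

/-- A normal form of a tree-rooted map, in which the contour of the tree is a rotation. -/
structure IsContour {m : ℕ} (d : MapData (Fin (m + 1))) : Prop where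
  tr : d.IsTreeRootedMap
  contour : d.σ * d.edgePerm d.tree = finRotate (m + 1)
  root : d.root = some 0

theorem edgePerm_relabel {D' : Type} (hα : ∀ x, d.α (d.α x) = x) (e : D ≃ D') {S : Set D}
    (hS : d.IsEdgeSet S) :
    (d.relabel e).edgePerm (e.symm ⁻¹' S) = (e.symm.trans (d.edgePerm S)).trans e := by
  have hα' : ∀ x, (d.relabel e).α ((d.relabel e).α x) = x := by
    intro x
    simp [relabel, hα]
  have hS' : (d.relabel e).IsEdgeSet (e.symm ⁻¹' S) := by
    intro x hx
    simpa [relabel] using hS _ hx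
  ext x
  by_cases hx : e.symm x ∈ S
  · rw [edgePerm_of_mem hα' hS' hx, trans_apply, trans_apply, edgePerm_of_mem hα hS hx]
    rfl
  · rw [edgePerm_of_not_mem hα' hS' hx, trans_apply, trans_apply, edgePerm_of_not_mem hα hS hx,
      apply_symm_apply]

/-- The half-edges are numbered in their order along the contour of the tree, starting from the
root. -/
theorem IsTreeRootedMap.exists_isContour [Finite D] (h : d.IsTreeRootedMap) {m : ℕ}
    (hm : Nat.card D = m + 1) :
    ∃ d' : MapData (Fin (m + 1)), d'.IsContour ∧ d'.toClass = d.toClass := by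
  have hne : Nonempty D := (Nat.card_pos_iff.1 (hm ▸ Nat.succ_pos m)).1
  have h1 := h.numCycles_tree.2.1
  have hcyc : ∀ x y, (d.σ * d.edgePerm d.tree).SameCycle x y := by
    intro x y
    have := (Nat.card_eq_one_iff_unique.1 h1).1
    exact Quotient.exact (Subsingleton.elim (Quotient.mk (Perm.SameCycle.setoid
      (d.σ * d.edgePerm d.tree)) x) (Quotient.mk _ y))
  obtain ⟨r, hr⟩ := Option.ne_none_iff_exists'.1 fun h0 => not_isEmpty_of_nonempty D (h.rooted.1 h0)
  obtain ⟨e, he, he0⟩ := exists_conj_eq_finRotate hcyc hm r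
  refine ⟨d.relabel e, ⟨isTreeRootedMap_relabel e h, ?_, ?_⟩, toClass_relabel _ _⟩
  · rw [← he]
    change _ * (d.relabel e).edgePerm (e.symm ⁻¹' d.tree) = _
    rw [edgePerm_relabel h.involutive e h.spanning.isEdgeSet]
    ext x
    simp [relabel]
  · simp [relabel, hr, he0]

/-- The edges of `S` do not cross along the rotation. -/
theorem IsContour.noncrossing {m : ℕ} {d : MapData (Fin (m + 1))} (h : d.IsContour)
    {S : Set (Fin (m + 1))} (hS : S = d.tree ∨ S = d.treeᶜ) {a b : Fin (m + 1)} (ha : a ∈ S)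
    (hb : b ∈ S) (hab : a < b) (hba : b < d.α a) : d.α b ≤ d.α a := by
  have hα := h.tr.involutive
  have hf := h.tr.fixedPointFree
  have hT := h.tr.spanning.isEdgeSet
  have hT' : d.IsEdgeSet d.treeᶜ := fun x hx hn => hx ((hT.mem_iff hα x).1 hn)
  obtain ⟨h1, h2, h3⟩ := h.tr.numCycles_tree
  rw [h.contour] at h2
  have hc : (finRotate (m + 1) * swap a (d.α a)).SameCycle b (d.α b) := by
    have hab' : b ∉ ({a, d.α a} : Set (Fin (m + 1))) := by
      rintro (rfl | rfl)
      · exact lt_irrefl _ hab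
      · exact lt_irrefl _ hba
    -- Composing the contour with the tree edges gives back σ, and composing it with the other edges
    -- gives the face permutation.
    rcases hS with rfl | rfl
    · refine sameCycle_mul_swap_of_numCycles hα hf hT h2 ?_ ha hb hab'
      rw [← h.contour, mul_assoc, edgePerm_mul_self hα hT, mul_one, h1]
    · refine sameCycle_mul_swap_of_numCycles hα hf hT' h2 ?_ ha hb hab'
      rw [← h.contour, mul_assoc, edgePerm_mul_compl hα hT hT', h3]
  obtain ⟨k, hk⟩ := SameCycle.exists_nat hc
  -- The transposition closes up the interval from a (excluded) to `d.α a` (included), so the orbit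
  -- of b cannot leave it.
  have key : ∀ k : ℕ, a < ((finRotate (m + 1) * swap a (d.α a)) ^ k) b ∧
      ((finRotate (m + 1) * swap a (d.α a)) ^ k) b ≤ d.α a := by
    intro k
    induction k with
    | zero => exact ⟨hab, hba.le⟩
    | succ k ih =>
      rw [pow_succ', Perm.mul_apply]
      generalize ((finRotate (m + 1) * swap a (d.α a)) ^ k) b = x at ih
      rw [Perm.mul_apply]
      have hlt : ∀ z : Fin (m + 1), z < d.α a →
          z < finRotate (m + 1) z ∧ finRotate (m + 1) z ≤ d.α a := by
        intro z hz
        have hzl : z ≠ Fin.last m := fun hz' => (hz.trans_le (Fin.le_last _)).ne hz'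
        rw [finRotate_apply, Fin.lt_def, Fin.le_def, Fin.val_add_one, if_neg hzl]
        exact ⟨Nat.lt_succ_self _, hz⟩
      by_cases hx : x = d.α a
      · rw [hx, swap_apply_right]
        exact hlt a (hab.trans hba)
      · rw [swap_apply_of_ne_of_ne ih.1.ne' hx]
        have := hlt x (lt_of_le_of_ne ih.2 hx)
        exact ⟨ih.1.trans this.1, this.2⟩
  rw [← hk]
  exact (key k).2

end MapData

/-- A non-crossing matching is determined by the set of its openers. -/
theorem matching_eq_of_openers {N : ℕ} {S : Set (Fin N)} {α α' : Fin N → Fin N}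
    (hα : ∀ x, α (α x) = x) (hα' : ∀ x, α' (α' x) = x)
    (hS : ∀ x ∈ S, α x ∈ S) (hS' : ∀ x ∈ S, α' x ∈ S) (hf : ∀ x, α x ≠ x) (hf' : ∀ x, α' x ≠ x)
    (hn : ∀ a ∈ S, ∀ b ∈ S, a < b → b < α a → α b ≤ α a)
    (hn' : ∀ a ∈ S, ∀ b ∈ S, a < b → b < α' a → α' b ≤ α' a)
    (ho : ∀ x ∈ S, x < α x ↔ x < α' x) : ∀ x ∈ S, α x = α' x := by
  have key : ∀ b ∈ S, α b < b → α b = α' b := by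
    intro b
    induction b using WellFoundedLT.induction with
    | _ b ih =>
    intro hb hlt
    have hlt' : α' b < b :=
      lt_of_le_of_ne (not_lt.1 fun h => lt_asymm hlt ((ho b hb).2 h)) (hf' b)
    -- A closer is matched with the last opener still available. If α b comes before α' b, the
    -- latter is an opener nested in the α-arc of b, so its α-partner is an earlier closer, where
    -- the two matchings agree by induction: a contradiction. The other case is symmetric.
    rcases lt_trichotomy (α b) (α' b) with h | h | h
    · exfalso
      have hopen : α' b < α (α' b) := (ho _ (hS' b hb)).2 (by rwa [hα'])
      have h1 := hn _ (hS b hb) _ (hS' b hb) h (by rwa [hα])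
      rw [hα] at h1
      have hne : α (α' b) ≠ b := fun h' => h.ne (by rw [← hα (α' b), h'])
      have := ih _ (lt_of_le_of_ne h1 hne) (hS _ (hS' b hb)) (by rwa [hα])
      rw [hα] at this
      exact hne (by rw [← hα' (α (α' b)), ← this, hα'])
    · exact h
    · exfalso
      have hopen : α b < α' (α b) := (ho _ (hS b hb)).1 (by rwa [hα])
      have h1 := hn' _ (hS' b hb) _ (hS b hb) h (by rwa [hα'])
      rw [hα'] at h1
      have hne : α' (α b) ≠ b := fun h' => h.ne (by rw [← hα' (α b), h'])
      have := ih _ (lt_of_le_of_ne h1 hne) (hS' _ (hS b hb))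
        (lt_of_le_of_ne (not_lt.1 fun h' => by
          rw [ho _ (hS' _ (hS b hb)), hα'] at h'
          exact lt_asymm hopen h') (hf _))
      rw [hα'] at this
      exact hne (by rw [← hα (α' (α b)), this, hα])
  intro x hx
  rcases lt_or_gt_of_ne (hf x) with h | h
  · exact key x hx h
  · have := key (α x) (hS x hx) (by rwa [hα])
    rw [hα] at this
    conv_rhs => rw [this, hα']

namespace MapData

theorem IsContour.eq {m : ℕ} {d d' : MapData (Fin (m + 1))} (h : d.IsContour) (h' : d'.IsContour)
    (ht : d.tree = d'.tree) (ho : ∀ x, x < d.α x ↔ x < d'.α x) : d = d' := by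
  have key : ∀ S : Set (Fin (m + 1)), S = d.tree ∨ S = d.treeᶜ → ∀ x ∈ S, d.α x = d'.α x := by
    intro S hS
    have hS' : S = d'.tree ∨ S = d'.treeᶜ := by rwa [← ht]
    have stable : ∀ {d : MapData (Fin (m + 1))}, d.IsContour → (S = d.tree ∨ S = d.treeᶜ) →
        ∀ x ∈ S, d.α x ∈ S := by
      rintro d h (rfl | rfl) x hx
      · exact h.tr.spanning.isEdgeSet x hx
      · exact fun hn => hx ((h.tr.spanning.isEdgeSet.mem_iff h.tr.involutive x).1 hn)
    exact matching_eq_of_openers h.tr.involutive h'.tr.involutive (stable h hS) (stable h' hS')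
      h.tr.fixedPointFree h'.tr.fixedPointFree (fun a ha b hb => h.noncrossing hS ha hb)
      (fun a ha b hb => h'.noncrossing hS' ha hb) fun x _ => ho x
  have hα : d.α = d'.α := by
    ext x : 1
    by_cases hx : x ∈ d.tree
    · exact key _ (Or.inl rfl) x hx
    · exact key _ (Or.inr rfl) x hx
  have he : d.edgePerm d.tree = d'.edgePerm d'.tree := by
    rw [edgePerm, edgePerm, hα, ht]
  refine MapData.ext ?_ hα ht (h.root.trans h'.root.symm)
  have := h.contour.trans h'.contour.symm
  rw [he] at this
  exact mul_right_cancel this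

end MapData

/-- In contour form a map is determined by two bits for each of its 2n half-edges: whether it
belongs to the tree, and whether it opens its edge. -/
theorem ncard_maps_le (n : ℕ) : (maps n).Finite ∧ (maps n).ncard ≤ 16 ^ n := by
  classical
  rcases Nat.eq_zero_or_pos n with rfl | hn
  · have : maps 0 = {MapClass.vertexMap} := by
      ext q
      refine ⟨fun h => eq_vertexMap h.1 h.2, ?_⟩
      rintro rfl
      exact ⟨isTreeRootedMap_vertexMap, numHalfEdges_vertexMap⟩
    rw [this]
    exact ⟨Set.finite_singleton _, by simp⟩
  · obtain ⟨m, hm⟩ : ∃ m, 2 * n = m + 1 := ⟨2 * n - 1, by omega⟩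
    have hex : ∀ q : maps n, ∃ d : MapData (Fin (m + 1)), d.IsContour ∧ d.toClass = q := by
      rintro ⟨q, h1, h2⟩
      obtain ⟨d, hd, hdq⟩ := h1.exists_isContour (m := m) (by
        rw [Nat.card_eq_fintype_card, Fintype.card_fin, h2, hm])
      exact ⟨d, hd, hdq.trans (MapClass.toClass_rep q)⟩
    choose d hd hdq using hex
    let F : maps n → Fin (m + 1) → Bool × Bool := fun q x =>
      (decide (x ∈ (d q).tree), decide (x < (d q).α x))
    have hF : Function.Injective F := by
      intro q q' h
      have h' : ∀ x, F q x = F q' x := fun x => congrFun h x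
      simp only [F, Prod.mk.injEq, decide_eq_decide] at h'
      have := (hd q).eq (hd q') (Set.ext fun x => (h' x).1) fun x => (h' x).2
      exact Subtype.ext (by rw [← hdq q, ← hdq q', this])
    have hfin : Finite (maps n) := Finite.of_injective F hF
    refine ⟨hfin, ?_⟩
    rw [← Nat.card_coe_set_eq]
    refine (Nat.card_le_card_of_injective F hF).trans_eq ?_
    rw [Nat.card_eq_fintype_card, Fintype.card_fun, Fintype.card_prod, Fintype.card_bool,
      Fintype.card_fin, ← hm, pow_mul]
    norm_num

theorem finite_maps (n : ℕ) : (maps n).Finite := (ncard_maps_le n).1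

theorem finite_twoConnectedMaps (n : ℕ) : (twoConnectedMaps n).Finite :=
  (finite_maps n).subset fun _ h => h.1

theorem bCoeff_le (n : ℕ) : bCoeff n ≤ 16 ^ n :=
  (Set.ncard_le_ncard (fun _ h => h.1) (finite_maps n)).trans (ncard_maps_le n).2

/-! ### The map with two vertices -/

open MapData in
/-- The map with two vertices and `n` edges between them, one of which is the tree. -/
def bond (n : ℕ) : MapData (ZMod n × Bool) where
  σ := ⟨fun x => (cond x.2 (x.1 + 1) (x.1 - 1), x.2), fun x => (cond x.2 (x.1 - 1) (x.1 + 1), x.2),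
    by rintro ⟨i, _ | _⟩ <;> simp, by rintro ⟨i, _ | _⟩ <;> simp⟩
  α := ⟨fun x => (x.1, !x.2), fun x => (x.1, !x.2), by rintro ⟨i, b⟩; simp,
    by rintro ⟨i, b⟩; simp⟩
  tree := {x | x.1 = 0}
  root := some (0, true)

theorem sameCycle_bond (n : ℕ) [NeZero n] (x y : ZMod n × Bool) :
    (bond n).σ.SameCycle x y ↔ x.2 = y.2 := by
  constructor
  · intro h
    exact SameCycle.lift (R := fun x y : ZMod n × Bool => x.2 = y.2)
      ⟨fun _ => rfl, Eq.symm, Eq.trans⟩ (fun _ => rfl) h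
  · have key : ∀ (b : Bool) (k : ℕ), (bond n).σ.SameCycle (0, b) ((k : ZMod n), b) := by
      intro b k
      induction k with
      | zero => rw [Nat.cast_zero]
      | succ k ih =>
        refine ih.trans ?_
        cases b with
        | true =>
          have := sameCycle_self_apply (bond n).σ ((k : ZMod n), true)
          rw [Nat.cast_succ]
          exact this
        | false =>
          refine Perm.SameCycle.symm ?_
          have := sameCycle_self_apply (bond n).σ (((k + 1 : ℕ) : ZMod n), false)
          have e : (bond n).σ (((k + 1 : ℕ) : ZMod n), false) = ((k : ZMod n), false) := by
            simp [bond]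
          rwa [e] at this
    have key' : ∀ x : ZMod n × Bool, (bond n).σ.SameCycle (0, x.2) x := by
      intro x
      have := key x.2 x.1.val
      rwa [ZMod.natCast_zmod_val] at this
    intro h
    refine (key' x).symm.trans ?_
    rw [h]
    exact key' y

open MapData in
theorem isTreeRootedMap_bond (n : ℕ) [NeZero n] : (bond n).IsTreeRootedMap := by
  have hα : ∀ x, (bond n).α ((bond n).α x) = x := by rintro ⟨i, b⟩; simp [bond]
  have hf : ∀ x, (bond n).α x ≠ x := by rintro ⟨i, b⟩; simp [bond]
  have hlink : ∀ x y, (bond n).Linked (bond n).tree x y := by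
    have key : ∀ x, (bond n).Linked (bond n).tree x (0, true) := by
      intro x
      refine (Linked.of_sameCycle ((sameCycle_bond n x (0, x.2)).2 rfl)).trans ?_
      cases x.2 with
      | true => exact Linked.refl _ _ _
      | false => exact Linked.alpha (bond n) (x := (0, false)) rfl
    exact fun x y => (key x).trans (key y).symm
  have hT : (bond n).IsEdgeSet (bond n).tree := fun x hx => hx
  refine ⟨hα, hf, ?_, fun x y => (hlink x y).mono (Set.subset_univ _), fun _ => ?_, hT, hlink, ?_⟩
  · refine ⟨fun h => absurd h (by simp [bond]), fun h => (h.false (0, true)).elim⟩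
  · rw [planar_iff hα hf]
    have h1 : numCycles (bond n).σ = 2 := by
      have e : Quotient (Perm.SameCycle.setoid (bond n).σ) ≃ Bool :=
        Equiv.ofBijective (Quotient.lift (fun x : ZMod n × Bool => x.2)
          fun x y h => (sameCycle_bond n x y).1 h) (by
          constructor
          · intro p q
            induction p using Quotient.inductionOn with | _ x => ?_
            induction q using Quotient.inductionOn with | _ y => ?_
            exact fun h => Quotient.sound ((sameCycle_bond n x y).2 h)
          · exact fun b => ⟨Quotient.mk _ (0, b), rfl⟩)
      rw [numCycles, Nat.card_congr e, Nat.card_eq_fintype_card, Fintype.card_bool]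
    -- All faces of this map have degree two: its face permutation is a fixed-point-free involution,
    -- so its cycles are counted by letting it play the role of α.
    have h2 := two_mul_numCycles_alpha
      (d := (⟨1, (bond n).σ * (bond n).α, ∅, none⟩ : MapData (ZMod n × Bool)))
      (by rintro ⟨i, _ | _⟩ <;> simp [bond]) (by rintro ⟨i, _ | _⟩ <;> simp [bond])
    change 2 * numCycles ((bond n).σ * (bond n).α) = _ at h2
    omega
  · intro x hx h
    have hempty : (bond n).tree \ {x, (bond n).α x} = ∅ := by
      rw [Set.sdiff_eq_empty]
      rintro ⟨i, b⟩ (rfl : i = 0)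
      obtain ⟨j, b'⟩ := x
      obtain rfl : j = 0 := hx
      cases b <;> cases b' <;> simp [bond]
    rw [hempty] at h
    have : x.2 = ((bond n).α x).2 := Linked.lift (d := bond n) (S := ∅)
      (R := fun x y : ZMod n × Bool => x.2 = y.2)
      ⟨fun _ => rfl, Eq.symm, Eq.trans⟩ (fun _ => rfl) (fun _ h => h.elim) h
    simp [bond] at this

/-- Every edge touches both vertices, so two non-empty edge sets share two vertices, never exactly
one. -/
theorem isTwoConnected_bond (n : ℕ) [NeZero n] : (bond n).IsTwoConnected := by
  rintro ⟨E₁, E₂, h1, h2, ⟨x, hx⟩, ⟨y, hy⟩, -, -, hv⟩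
  have key : ∀ {E : Set (ZMod n × Bool)}, (bond n).IsEdgeSet E → ∀ x ∈ E, ∀ b : Bool,
      ∃ z ∈ E, (bond n).vertexOf z = (bond n).vertexOf (0, b) := by
    intro E hE x hx b
    have : ∃ z ∈ E, z.2 = b := by
      by_cases hb : x.2 = b
      · exact ⟨x, hx, hb⟩
      · refine ⟨_, hE x hx, ?_⟩
        change (!x.2) = b
        cases b <;> simp_all
    obtain ⟨z, hz, hzb⟩ := this
    exact ⟨z, hz, Quotient.sound ((sameCycle_bond n _ _).2 hzb)⟩
  have := hv.unique ⟨key h1 x hx true, key h2 y hy true⟩ ⟨key h1 x hx false, key h2 y hy false⟩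
  have := (sameCycle_bond n _ _).1 (Quotient.exact this)
  simp at this

theorem nonempty_twoConnectedMaps (n : ℕ) : (twoConnectedMaps n).Nonempty := by
  rcases Nat.eq_zero_or_pos n with rfl | hn
  · exact ⟨_, mem_twoConnectedMaps_zero.2 rfl⟩
  · have : NeZero n := ⟨hn.ne'⟩
    refine ⟨(bond n).toClass, ⟨(MapClass.isTreeRootedMap_rep_toClass _).2 (isTreeRootedMap_bond n),
      ?_⟩, (MapClass.isTwoConnected_rep_toClass _).2 (isTwoConnected_bond n)⟩
    rw [MapClass.numHalfEdges_toClass, Nat.card_prod, Nat.card_zmod, Nat.card_eq_fintype_card,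
      Fintype.card_bool, mul_comm]

theorem nonempty_maps (n : ℕ) : (maps n).Nonempty :=
  (nonempty_twoConnectedMaps n).mono fun _ h => h.1

theorem bCoeff_pos (n : ℕ) : 0 < bCoeff n :=
  (Set.ncard_pos (finite_twoConnectedMaps n)).2 (nonempty_twoConnectedMaps n)

theorem bCoeff_zero : bCoeff 0 = 1 := by
  have : twoConnectedMaps 0 = {MapClass.vertexMap} := by
    ext q
    exact mem_twoConnectedMaps_zero
  rw [bCoeff, this, Set.ncard_singleton]

end TreeRooted

/-! ### Convergence of the block series at y(u), and the offspring law. -/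

namespace TreeRooted

/-! ### The series of 2-connected tree-rooted maps -/

theorem one_le_bCoeff (n : ℕ) : (1 : ℝ) ≤ bCoeff n := by exact_mod_cast bCoeff_pos n

theorem bCoeff_mul_pow_nonneg (n : ℕ) {y : ℝ} (hy : 0 ≤ y) : 0 ≤ (bCoeff n : ℝ) * y ^ n :=
  mul_nonneg (Nat.cast_nonneg _) (pow_nonneg hy n)

theorem norm_ofScalars_bCoeff (n : ℕ) :
    ‖FormalMultilinearSeries.ofScalars ℝ (fun n => (bCoeff n : ℝ)) n‖ = bCoeff n := by
  rw [FormalMultilinearSeries.ofScalars_norm, Real.norm_of_nonneg (Nat.cast_nonneg _)]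

theorem le_radius :
    ((1 / 16 : NNReal) : ENNReal) ≤
      (FormalMultilinearSeries.ofScalars ℝ fun n => (bCoeff n : ℝ)).radius := by
  refine FormalMultilinearSeries.le_radius_of_bound _ 1 fun n => ?_
  rw [norm_ofScalars_bCoeff]
  have h : (bCoeff n : ℝ) ≤ 16 ^ n := by exact_mod_cast bCoeff_le n
  calc (bCoeff n : ℝ) * ((1 / 16 : NNReal) : ℝ) ^ n ≤ 16 ^ n * ((1 / 16 : NNReal) : ℝ) ^ n := by
        gcongr
    _ = 1 := by rw [← mul_pow]; norm_num

/-- The coefficients are at least 1, so the series diverges at 1. Finiteness is needed for `rhoB` to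
be the true radius rather than the default 0 of `toReal`. -/
theorem radius_ne_top :
    (FormalMultilinearSeries.ofScalars ℝ fun n => (bCoeff n : ℝ)).radius ≠ ⊤ := by
  intro h
  have := FormalMultilinearSeries.summable_norm_mul_pow
    (FormalMultilinearSeries.ofScalars ℝ fun n => (bCoeff n : ℝ)) (r := 1)
    (by rw [h]; exact ENNReal.coe_lt_top)
  have h0 := this.tendsto_atTop_zero
  obtain ⟨n, hn⟩ := (h0.eventually_lt_const zero_lt_one).exists
  rw [norm_ofScalars_bCoeff, NNReal.coe_one, one_pow, mul_one] at hn
  exact not_le_of_gt hn (one_le_bCoeff n)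

theorem rhoB_pos : 0 < rhoB := by
  refine ENNReal.toReal_pos ?_ radius_ne_top
  exact (lt_of_lt_of_le (by simp) le_radius).ne'

theorem coe_lt_radius {r : NNReal} (h : (r : ℝ) < rhoB) :
    (r : ENNReal) < (FormalMultilinearSeries.ofScalars ℝ fun n => (bCoeff n : ℝ)).radius := by
  rw [← ENNReal.ofReal_toReal radius_ne_top, ← ENNReal.ofReal_coe_nnreal]
  exact (ENNReal.ofReal_lt_ofReal_iff rhoB_pos).2 h

theorem summable_bCoeff {y : ℝ} (hy : 0 ≤ y) (h : y < rhoB) :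
    Summable fun j : ℕ => (bCoeff j : ℝ) * y ^ j := by
  have := FormalMultilinearSeries.summable_norm_mul_pow _ (coe_lt_radius (r := ⟨y, hy⟩) h)
  simp only [norm_ofScalars_bCoeff] at this
  exact this

theorem summable_deriv_bCoeff {y : ℝ} (hy : 0 ≤ y) (h : y < rhoB) :
    Summable fun j : ℕ => ((j : ℝ) + 1) * (bCoeff (j + 1) : ℝ) * y ^ j := by
  obtain ⟨r, hyr, hr⟩ := exists_between h
  -- At an intermediate radius r the terms of the series are bounded, so the derived series at y is
  -- dominated by a multiple of ∑ (j + 1)(y/r)^j.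
  have hr0 : 0 < r := hy.trans_lt hyr
  have hs := (summable_nat_add_iff 1).2 (summable_bCoeff hr0.le hr)
  obtain ⟨C, hC⟩ := hs.tendsto_atTop_zero.bddAbove_range
  have hC' : ∀ j, (bCoeff (j + 1) : ℝ) * r ^ (j + 1) ≤ C := fun j => hC ⟨j, rfl⟩
  have hq : ‖y / r‖ < 1 := by
    rw [Real.norm_of_nonneg (div_nonneg hy hr0.le), div_lt_one hr0]
    exact hyr
  have h1 := summable_pow_mul_geometric_of_norm_lt_one 1 hq
  have h2 := summable_geometric_of_norm_lt_one hq
  refine Summable.of_nonneg_of_le (fun j => by positivity) (fun j => ?_)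
    ((h1.add h2).mul_left (C / r))
  have e : ((j : ℝ) + 1) * (bCoeff (j + 1) : ℝ) * y ^ j =
      ((bCoeff (j + 1) : ℝ) * r ^ (j + 1)) * (((j : ℝ) + 1) * (y / r) ^ j / r) := by
    rw [div_pow, pow_succ]
    field_simp
  rw [e]
  calc ((bCoeff (j + 1) : ℝ) * r ^ (j + 1)) * (((j : ℝ) + 1) * (y / r) ^ j / r) ≤
      C * (((j : ℝ) + 1) * (y / r) ^ j / r) := by
        gcongr
        exact hC' j
    _ = C / r * ((j : ℝ) ^ 1 * (y / r) ^ j + (y / r) ^ j) := by ring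

theorem continuousOn_series {a : ℕ → ℝ} (ha : ∀ j, 0 ≤ a j)
    (hs : ∀ y, 0 ≤ y → y < rhoB → Summable fun j => a j * y ^ j) {y : ℝ} (hy : 0 ≤ y)
    (h : y < rhoB) : ContinuousOn (fun x => ∑' j, a j * x ^ j) (Set.Icc 0 y) := by
  refine continuousOn_tsum (fun j => by fun_prop) (hs y hy h) fun j x hx => ?_
  rw [Real.norm_of_nonneg (mul_nonneg (ha j) (pow_nonneg hx.1 j))]
  exact mul_le_mul_of_nonneg_left (pow_le_pow_left₀ hx.1 hx.2 j) (ha j)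

theorem one_le_B {y : ℝ} (hy : 0 ≤ y) (hs : Summable fun j : ℕ => (bCoeff j : ℝ) * y ^ j) :
    1 ≤ B y := by
  have := hs.le_tsum 0 fun j _ => bCoeff_mul_pow_nonneg j hy
  rwa [bCoeff_zero, Nat.cast_one, pow_zero, one_mul] at this

theorem one_le_partition {u y : ℝ} (hu : 0 < u) (hy : 0 ≤ y)
    (hs : Summable fun j : ℕ => (bCoeff j : ℝ) * y ^ j) : 1 ≤ u * B y + 1 - u := by
  nlinarith [one_le_B hy hs]

theorem CriticalEquation.pos {u y : ℝ} (hy : 0 ≤ y) (h : CriticalEquation u y) : 0 < y := by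
  refine lt_of_le_of_ne hy ?_
  rintro rfl
  simp [CriticalEquation] at h

/-- A divergent derived series has the default sum 0 and would make the equation read 0 = 1. So any
solution, the endpoint included, has a convergent derived series, which dominates the series itself.
-/
theorem CriticalEquation.summable {u y : ℝ} (hy : 0 ≤ y) (h : CriticalEquation u y) :
    Summable fun j : ℕ => (bCoeff j : ℝ) * y ^ j := by
  have hs : Summable fun j : ℕ => ((j : ℝ) + 1) * (bCoeff (j + 1) : ℝ) * y ^ j := by
    by_contra hn
    rw [CriticalEquation, B', tsum_eq_zero_of_not_summable hn] at h
    simp at h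
  refine (summable_nat_add_iff 1).1 (Summable.of_nonneg_of_le
    (fun j => bCoeff_mul_pow_nonneg _ hy) (fun j => ?_) (hs.mul_left y))
  have h1 := bCoeff_mul_pow_nonneg (j + 1) hy
  calc (bCoeff (j + 1) : ℝ) * y ^ (j + 1) ≤ ((j : ℝ) + 1) * ((bCoeff (j + 1) : ℝ) * y ^ (j + 1)) :=
        le_mul_of_one_le_left h1 (by linarith [(Nat.cast_nonneg j : (0 : ℝ) ≤ j)])
    _ = y * (((j : ℝ) + 1) * (bCoeff (j + 1) : ℝ) * y ^ j) := by ring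

/-- Without a solution, the critical function stays below its target. -/
theorem lt_of_not_criticalEquation {u : ℝ} (hu : 0 < u)
    (hn : ∀ y ∈ Set.Icc 0 rhoB, ¬ CriticalEquation u y) {y : ℝ} (hy : 0 ≤ y) (h : y < rhoB) :
    2 * y * u * B' y - (u * B y + 1 - u) < 0 := by
  by_contra hle
  rw [not_lt] at hle
  have hB : ContinuousOn B (Set.Icc 0 y) :=
    continuousOn_series (fun j => Nat.cast_nonneg _) (fun _ => summable_bCoeff) hy h
  have hB' : ContinuousOn B' (Set.Icc 0 y) :=
    continuousOn_series (fun j => by positivity) (fun _ => summable_deriv_bCoeff) hy h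
  have hc : ContinuousOn (fun y => 2 * y * u * B' y - (u * B y + 1 - u)) (Set.Icc 0 y) := by
    fun_prop
  have h0 : 2 * 0 * u * B' 0 - (u * B 0 + 1 - u) ≤ 0 := by
    have := one_le_partition hu le_rfl (summable_bCoeff le_rfl rhoB_pos)
    linarith
  obtain ⟨z, hz, hz0⟩ := intermediate_value_Icc hy hc ⟨h0, hle⟩
  have hZ := one_le_partition hu hz.1 (summable_bCoeff hz.1 (hz.2.trans_lt h))
  refine hn z ⟨hz.1, hz.2.trans h.le⟩ ?_
  rw [CriticalEquation, div_eq_one_iff_eq (by linarith)]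
  exact sub_eq_zero.1 hz0

/-- Put S = B(y) - 1 ≤ y B'(y). Without a solution, 2u y B'(y) < 1 + uS for every y < ρ_B, hence uS
< 1. The partial sums are bounded by 1/u uniformly in y, and by continuity also at ρ_B. -/
theorem summable_rhoB {u : ℝ} (hu : 0 < u)
    (hn : ∀ y ∈ Set.Icc 0 rhoB, ¬ CriticalEquation u y) :
    Summable fun j : ℕ => (bCoeff j : ℝ) * rhoB ^ j := by
  refine (summable_nat_add_iff 1).1 (summable_of_sum_range_le (c := 1 / u)
    (fun j => bCoeff_mul_pow_nonneg _ rhoB_pos.le) fun N => ?_)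
  have key : ∀ y ∈ Set.Ico 0 rhoB,
      ∑ j ∈ Finset.range N, (bCoeff (j + 1) : ℝ) * y ^ (j + 1) ≤ 1 / u := by
    intro y hy
    have hlt := lt_of_not_criticalEquation hu hn hy.1 hy.2
    have hs := (summable_nat_add_iff 1).2 (summable_bCoeff hy.1 hy.2)
    have hd := (summable_deriv_bCoeff hy.1 hy.2).mul_left y
    have h1 : B y = 1 + ∑' j : ℕ, (bCoeff (j + 1) : ℝ) * y ^ (j + 1) := by
      rw [B, (summable_bCoeff hy.1 hy.2).tsum_eq_zero_add, bCoeff_zero]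
      simp
    have h2 : ∑' j : ℕ, (bCoeff (j + 1) : ℝ) * y ^ (j + 1) ≤ y * B' y := by
      rw [B', ← tsum_mul_left]
      refine hs.tsum_le_tsum (fun j => ?_) hd
      have h1 := bCoeff_mul_pow_nonneg (j + 1) hy.1
      calc (bCoeff (j + 1) : ℝ) * y ^ (j + 1) ≤
            ((j : ℝ) + 1) * ((bCoeff (j + 1) : ℝ) * y ^ (j + 1)) :=
            le_mul_of_one_le_left h1 (by linarith [(Nat.cast_nonneg j : (0 : ℝ) ≤ j)])
        _ = y * (((j : ℝ) + 1) * (bCoeff (j + 1) : ℝ) * y ^ j) := by ring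
    have h3 := hs.sum_le_tsum (Finset.range N) fun j _ => bCoeff_mul_pow_nonneg (j + 1) hy.1
    rw [le_div_iff₀ hu]
    nlinarith
  have hc : Continuous fun y : ℝ => ∑ j ∈ Finset.range N, (bCoeff (j + 1) : ℝ) * y ^ (j + 1) := by
    fun_prop
  have hcl : rhoB ∈ closure (Set.Ico 0 rhoB) := by
    rw [closure_Ico rhoB_pos.ne]
    exact ⟨rhoB_pos.le, le_rfl⟩
  exact closure_minimal key (isClosed_le hc continuous_const) hcl

/-- All that the rest of the proof needs to know about y(u). -/
theorem yOf_spec {u : ℝ} (hu : 0 < u) :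
    0 < yOf u ∧ Summable fun j : ℕ => (bCoeff j : ℝ) * yOf u ^ j := by
  by_cases h : ∃ y ∈ Set.Icc 0 rhoB, CriticalEquation u y
  · rw [yOf, dif_pos h]
    obtain ⟨h1, h2⟩ := h.choose_spec
    exact ⟨h2.pos h1.1, h2.summable h1.1⟩
  · rw [yOf, dif_neg h]
    push Not at h
    exact ⟨rhoB_pos, summable_rhoB hu h⟩

/-! ### The offspring law -/

/-- The probability of having `2 * j` children. -/
noncomputable def offspringWeight (u : ℝ) (j : ℕ) : ℝ :=
  (bCoeff j : ℝ) * yOf u ^ j * (if j = 0 then 1 else u) / (u * B (yOf u) + 1 - u)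

theorem partition_pos {u : ℝ} (hu : 0 < u) : 0 < u * B (yOf u) + 1 - u :=
  zero_lt_one.trans_le (one_le_partition hu (yOf_spec hu).1.le (yOf_spec hu).2)

theorem offspringWeight_nonneg {u : ℝ} (hu : 0 < u) (j : ℕ) : 0 ≤ offspringWeight u j := by
  refine div_nonneg (mul_nonneg (bCoeff_mul_pow_nonneg j (yOf_spec hu).1.le) ?_)
    (partition_pos hu).le
  split_ifs
  · exact zero_le_one
  · exact hu.le

/-- Giving all terms the weight u yields uB; the term j = 0, where b_0 = 1, has weight 1 instead,
which accounts for 1 - u. -/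
theorem hasSum_offspringWeight {u : ℝ} (hu : 0 < u) : HasSum (offspringWeight u) 1 := by
  have h1 := ((yOf_spec hu).2.hasSum.mul_left u).add (hasSum_ite_eq 0 (1 - u))
  have h2 := h1.div_const (u * B (yOf u) + 1 - u)
  have e : (u * ∑' j : ℕ, (bCoeff j : ℝ) * yOf u ^ j + (1 - u)) / (u * B (yOf u) + 1 - u) = 1 := by
    rw [← add_sub_assoc]
    exact div_self (partition_pos hu).ne'
  rw [e] at h2
  suffices h : offspringWeight u = fun j => (u * ((bCoeff j : ℝ) * yOf u ^ j) +
      if j = 0 then 1 - u else 0) / (u * B (yOf u) + 1 - u) by rwa [h]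
  funext j
  rw [offspringWeight]
  congr 1
  split_ifs with hj
  · rw [hj, bCoeff_zero]
    simp
  · ring

theorem offspring_eq (u : ℝ) : offspring u =
    Measure.sum fun j : ℕ => ENNReal.ofReal (offspringWeight u j) • Measure.dirac (2 * j) := rfl

theorem isProbabilityMeasure_offspring {u : ℝ} (hu : 0 < u) :
    IsProbabilityMeasure (offspring u) := by
  refine ⟨?_⟩
  rw [offspring_eq, Measure.sum_apply _ MeasurableSet.univ]
  simp only [Measure.smul_apply, measure_univ, smul_eq_mul, mul_one]
  rw [← ENNReal.ofReal_tsum_of_nonneg (offspringWeight_nonneg hu) (hasSum_offspringWeight hu).summable,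
    (hasSum_offspringWeight hu).tsum_eq, ENNReal.ofReal_one]

theorem offspring_two_mul (u : ℝ) (j : ℕ) :
    offspring u {2 * j} = ENNReal.ofReal (offspringWeight u j) := by
  rw [offspring_eq, Measure.sum_apply _ (MeasurableSet.singleton _), tsum_eq_single j]
  · simp
  · intro i hi
    simp [hi]

theorem offspring_odd (u : ℝ) {k : ℕ} (hk : ¬ 2 ∣ k) : offspring u {k} = 0 := by
  rw [offspring_eq, Measure.sum_apply _ (MeasurableSet.singleton _), ENNReal.tsum_eq_zero]
  intro i
  have : 2 * i ≠ k := fun h => hk ⟨i, h.symm⟩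
  simp [this]

end TreeRooted

/-! ### The law of the blocks given the tree, and the law of the tree. -/

namespace TreeRooted

/-! ### The block-weighted law -/

theorem MapClass.measurableSet (A : Set MapClass) : MeasurableSet A := trivial

theorem mCoeff_pos (n : ℕ) {u : ℝ} (hu : 0 < u) : 0 < mCoeff n u := by
  have := (finite_maps n).to_subtype
  obtain ⟨q, hq⟩ := nonempty_maps n
  exact (Summable.of_finite).tsum_pos (fun _ => (pow_pos hu _).le) ⟨q, hq⟩ (pow_pos hu _)

theorem isProbabilityMeasure_blockLaw (n : ℕ) {u : ℝ} (hu : 0 < u) :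
    IsProbabilityMeasure (blockLaw n u) := by
  have := (finite_maps n).to_subtype
  refine ⟨?_⟩
  rw [blockLaw, Measure.sum_apply _ MeasurableSet.univ]
  simp only [Measure.smul_apply, measure_univ, smul_eq_mul, mul_one]
  rw [← ENNReal.ofReal_tsum_of_nonneg (fun q => div_nonneg (pow_pos hu _).le (mCoeff_pos n hu).le)
    Summable.of_finite, tsum_div_const]
  change ENNReal.ofReal (mCoeff n u / mCoeff n u) = 1
  rw [div_self (mCoeff_pos n hu).ne', ENNReal.ofReal_one]

/-- On a set of maps with the same number of blocks, the law is uniform. -/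
theorem blockLaw_apply {n : ℕ} {u : ℝ} {b : ℕ} {F : Set MapClass} {A : Set MapClass}
    (hF : ∀ q, q ∈ F ↔ q ∈ maps n ∧ q ∈ A) (hb : ∀ q ∈ F, q.numBlocks = b) :
    blockLaw n u A = ENNReal.ofReal (F.ncard * (u ^ b / mCoeff n u)) := by
  classical
  have hfin := finite_maps n
  have hFn : F.Finite := hfin.subset fun q hq => ((hF q).1 hq).1
  have := hfin.fintype
  rw [blockLaw, Measure.sum_apply _ (MapClass.measurableSet _), tsum_fintype]
  simp only [Measure.smul_apply, Measure.dirac_apply, smul_eq_mul]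
  have e : ∀ q : maps n, ENNReal.ofReal (u ^ (q : MapClass).numBlocks / mCoeff n u) *
      A.indicator 1 (q : MapClass) =
      if (q : MapClass) ∈ A then ENNReal.ofReal (u ^ b / mCoeff n u) else 0 := by
    intro q
    by_cases hq : (q : MapClass) ∈ A
    · rw [Set.indicator_of_mem hq, if_pos hq, hb q ((hF q).2 ⟨q.2, hq⟩), Pi.one_apply, mul_one]
    · rw [Set.indicator_of_notMem hq, if_neg hq, mul_zero]
  rw [Finset.sum_congr rfl fun q _ => e q, ← Finset.sum_filter, Finset.sum_const, nsmul_eq_mul,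
    ENNReal.ofReal_mul (Nat.cast_nonneg _), ENNReal.ofReal_natCast]
  congr 2
  rw [← Set.ncard_coe_finset, ← Set.ncard_image_of_injective _ Subtype.val_injective]
  congr 1
  ext q
  simp only [Finset.coe_filter, Finset.mem_univ, true_and, Set.mem_image, Subtype.exists,
    exists_and_right, exists_eq_right, hF, Set.mem_ofPred_eq]
  exact ⟨fun ⟨h, h'⟩ => ⟨h, h'⟩, fun ⟨h, h'⟩ => ⟨h, h'⟩⟩

theorem uniformOn_eq {Ω : Type*} [MeasurableSpace Ω] [MeasurableSingletonClass Ω] {s : Set Ω}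
    (hs : s.Finite) (hne : s.Nonempty) (t : Set Ω) :
    uniformOn s t = ENNReal.ofReal ((s ∩ t).ncard / s.ncard) := by
  have hpos : (0 : ℝ) < s.ncard := by exact_mod_cast (Set.ncard_pos hs).2 hne
  rw [uniformOn, cond_apply hs.measurableSet, Measure.count_apply hs.measurableSet,
    Measure.count_apply (hs.subset Set.inter_subset_left).measurableSet, ← hs.cast_ncard_eq,
    ← (hs.subset Set.inter_subset_left).cast_ncard_eq, ENNReal.ofReal_div_of_pos hpos,
    ENNReal.ofReal_natCast, ENNReal.ofReal_natCast, div_eq_mul_inv, mul_comm]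
  rfl

namespace HalfEdgeOrder

variable {c : HalfEdgeOrder} {k : List ℕ → ℕ}

/-- The maps with a given block tree and constraints on the blocks. -/
theorem ncard_fiber_inter {t : Set (List ℕ)} (ht : t = treeOfOffspring fun v => 2 * k v)
    [Fintype t] (hk : ∀ v, v ∉ t → k v = 0) (s : t → Set MapClass) :
    (c.fiber k ∩ ⋂ v : t, c.block v ⁻¹' s v).ncard =
      ∏ v : t, (twoConnectedMaps (k v) ∩ s v).ncard := by
  subst ht
  have hbij := bijective_block (c := c) (Set.toFinite _) hk
  let e := Equiv.ofBijective _ hbij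
  have e1 : (c.fiber k ∩ ⋂ v : (treeOfOffspring fun v => 2 * k v), c.block v ⁻¹' s v : Set _) ≃
      ∀ v : (treeOfOffspring fun v => 2 * k v), (twoConnectedMaps (k v) ∩ s v : Set MapClass) :=
    { toFun := fun q v => ⟨c.block v q, q.2.1.2 v, Set.mem_iInter.1 q.2.2 v⟩
      invFun := fun f => ⟨e.symm fun v => ⟨f v, (f v).2.1⟩, (e.symm _).2,
        Set.mem_iInter.2 fun v => by
          have := congrFun (e.apply_symm_apply fun v => ⟨f v, (f v).2.1⟩) v
          rw [Set.mem_preimage, show c.block v (e.symm fun v => ⟨f v, (f v).2.1⟩ : c.fiber k) = f v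
            from congrArg Subtype.val this]
          exact (f v).2.2⟩
      left_inv := fun q => by
        have := congrArg Subtype.val (e.symm_apply_apply ⟨q.1, q.2.1⟩)
        exact Subtype.ext this
      right_inv := fun f => by
        funext v
        have := congrArg Subtype.val (congrFun (e.apply_symm_apply fun v => ⟨f v, (f v).2.1⟩) v)
        exact Subtype.ext this }
  rw [MapData.ncard_eq_card, Nat.card_congr e1, Nat.card_pi]
  rfl

/-- The uniform law on a product is the product of the uniform laws. Independence and the marginals
are both read off by taking trivial constraints at some of the nodes. -/
theorem uniformOn_fiber {t : Set (List ℕ)} (ht : t = treeOfOffspring fun v => 2 * k v)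
    [Fintype t] (hk : ∀ v, v ∉ t → k v = 0) (s : t → Set MapClass) :
    uniformOn (c.fiber k) (⋂ v : t, c.block v ⁻¹' s v) =
      ∏ v : t, uniformOn (twoConnectedMaps (k v)) (s v) := by
  have h1 := ncard_fiber_inter (c := c) ht hk s
  have h2 := ncard_fiber_inter (c := c) ht hk fun _ => Set.univ
  simp only [Set.preimage_univ, Set.iInter_univ, Set.inter_univ] at h2
  have hpos : 0 < (c.fiber k).ncard := by
    rw [h2]
    exact Finset.prod_pos fun v _ => bCoeff_pos _
  rw [uniformOn_eq (Set.finite_of_ncard_pos hpos)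
    ((Set.ncard_pos (Set.finite_of_ncard_pos hpos)).1 hpos), h1, h2, Nat.cast_prod, Nat.cast_prod,
    ← Finset.prod_div_distrib, ENNReal.ofReal_prod_of_nonneg fun v _ => by positivity]
  exact Finset.prod_congr rfl fun v _ =>
    (uniformOn_eq (finite_twoConnectedMaps _) (nonempty_twoConnectedMaps _) _).symm

instance (k : ℕ) : IsProbabilityMeasure (uniformOn (twoConnectedMaps k)) :=
  isProbabilityMeasure_uniformOn (finite_twoConnectedMaps k) (nonempty_twoConnectedMaps k)

theorem uniformOn_fiber_preimage {t : Set (List ℕ)} (ht : t = treeOfOffspring fun v => 2 * k v)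
    (hfin : t.Finite) (hk : ∀ v, v ∉ t → k v = 0) (v : t) (s : Set MapClass) :
    uniformOn (c.fiber k) (c.block v ⁻¹' s) = uniformOn (twoConnectedMaps (k v)) s := by
  classical
  have := hfin.fintype
  have h := uniformOn_fiber (c := c) ht hk fun w => if w = v then s else Set.univ
  rw [Finset.prod_eq_single v (fun w _ hw => by rw [if_neg hw, measure_univ])
    (fun h => absurd (Finset.mem_univ v) h), if_pos rfl] at h
  rw [← h]
  congr 1
  ext q
  simp only [Set.mem_preimage, Set.mem_iInter]
  refine ⟨fun hq w => ?_, fun hq => ?_⟩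
  · split_ifs with hw
    · rwa [hw]
    · trivial
  · have := hq v
    rwa [if_pos rfl] at this

theorem iIndepFun_block {t : Set (List ℕ)} (ht : t = treeOfOffspring fun v => 2 * k v)
    (hfin : t.Finite) (hk : ∀ v, v ∉ t → k v = 0) :
    iIndepFun (fun (v : t) (q : MapClass) => c.block v q) (uniformOn (c.fiber k)) := by
  classical
  have := hfin.fintype
  rw [iIndepFun_iff_measure_inter_preimage_eq_mul]
  intro S s _
  have h := uniformOn_fiber (c := c) ht hk fun w => if w ∈ S then s w else Set.univ
  have e : (⋂ v : t, c.block v ⁻¹' (if v ∈ S then s v else Set.univ)) =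
      ⋂ i ∈ S, (fun q => c.block i q) ⁻¹' s i := by
    ext q
    simp only [Set.mem_preimage, Set.mem_iInter]
    refine forall_congr' fun v => ?_
    split_ifs with hv <;> simp [hv]
  rw [← e, h, ← Finset.prod_subset (Finset.subset_univ S) fun v _ hv => by
    rw [if_neg hv, measure_univ]]
  refine Finset.prod_congr rfl fun v hv => ?_
  rw [if_pos hv]
  exact (uniformOn_fiber_preimage ht hfin hk v (s v)).symm

theorem blockLaw_fiber_inter {n : ℕ} {u : ℝ} {t : Set (List ℕ)}
    (ht : t = treeOfOffspring fun v => 2 * k v) (hk : ∀ v, v ∉ t → k v = 0)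
    (hn : t.encard = 2 * n + 1) (A : Set MapClass) :
    blockLaw n u (c.blockTree ⁻¹' {t} ∩ A) =
      ENNReal.ofReal ((c.fiber k ∩ A).ncard * (u ^ {v ∈ t | k v ≠ 0}.ncard / mCoeff n u)) := by
  refine blockLaw_apply (fun q => ?_) fun q hq => ?_
  · rw [Set.mem_inter_iff, mem_fiber_iff ht hk hn, and_assoc]
    rfl
  · rw [numBlocks_of_mem_fiber hq.1, ht]

/-- All maps with the same block tree have the same number of blocks, so their weights u^b are equal
and cancel. -/
theorem cond_blockLaw {n : ℕ} {u : ℝ} (hu : 0 < u) {t : Set (List ℕ)}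
    (ht : t = treeOfOffspring fun v => 2 * k v) (hk : ∀ v, v ∉ t → k v = 0)
    (hn : t.encard = 2 * n + 1) (hne : (c.fiber k).Nonempty) :
    cond (blockLaw n u) (c.blockTree ⁻¹' {t}) = uniformOn (c.fiber k) := by
  have hfin : (c.fiber k).Finite :=
    (finite_maps n).subset fun q hq => ((mem_fiber_iff ht hk hn).1 hq).1
  have hpos : (0 : ℝ) < (c.fiber k).ncard := by exact_mod_cast (Set.ncard_pos hfin).2 hne
  have hw : 0 < u ^ {v ∈ t | k v ≠ 0}.ncard / mCoeff n u :=
    div_pos (pow_pos hu _) (mCoeff_pos n hu)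
  have h0 := blockLaw_fiber_inter (c := c) (u := u) ht hk hn Set.univ
  rw [Set.inter_univ, Set.inter_univ] at h0
  refine Measure.ext fun A _ => ?_
  rw [cond_apply (MapClass.measurableSet _), blockLaw_fiber_inter ht hk hn, h0, uniformOn_eq hfin hne, mul_comm,
    ← div_eq_mul_inv, ← ENNReal.ofReal_div_of_pos (mul_pos hpos hw),
    mul_div_mul_right _ _ hw.ne']

end HalfEdgeOrder

/-! ### Bienaymé–Galton–Watson trees -/

theorem measurable_treeOfOffspring : Measurable treeOfOffspring := by
  rw [measurable_set_iff]
  intro w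
  change Measurable fun ξ : List ℕ → ℕ => ∀ (i : ℕ) (h : i < w.length), w[i] < ξ (w.take i)
  refine Measurable.forall fun i => Measurable.forall fun h => ?_
  exact measurableSet_setOfPred.1 (measurableSet_lt measurable_const (measurable_pi_apply _))

/-- The event that the tree is t prescribes the offspring at the finitely many nodes of t and
nothing elsewhere, so it is a cylinder. -/
theorem galtonWatson_singleton (μ : Measure ℕ) [IsProbabilityMeasure μ] {ξ : List ℕ → ℕ}
    {t : Set (List ℕ)} [Fintype t] (ht : t = treeOfOffspring ξ) :
    galtonWatson μ {t} = ∏ v : t, μ {ξ v} := by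
  classical
  have e : treeOfOffspring ⁻¹' {t} = Set.pi (t.toFinset : Set (List ℕ)) fun v => {ξ v} := by
    ext ξ'
    rw [Set.coe_toFinset, Set.mem_preimage, Set.mem_singleton_iff, Set.mem_pi]
    constructor
    · intro h v hv
      have h1 := numChildren_treeOfOffspring (h ▸ hv : v ∈ treeOfOffspring ξ')
      have h2 := numChildren_treeOfOffspring (ht ▸ hv : v ∈ treeOfOffspring ξ)
      rw [h] at h1
      rw [← ht] at h2
      exact h1.symm.trans h2
    · intro h
      have h' : treeOfOffspring ξ = treeOfOffspring ξ' :=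
        treeOfOffspring_congr fun v hv => (h v (by rwa [ht])).symm
      exact h'.symm.trans ht.symm
  rw [galtonWatson, Measure.map_apply measurable_treeOfOffspring (MeasurableSet.singleton _), e,
    Measure.infinitePi_pi _ fun _ _ => MeasurableSet.singleton _]
  exact (Finset.prod_subtype _ (fun v => Set.mem_toFinset) fun v => μ {ξ v})

/-- Every node but the root is a child of exactly one node. -/
theorem sum_offspring {ξ : List ℕ → ℕ} {t : Set (List ℕ)} [Fintype t]
    (ht : t = treeOfOffspring ξ) : ∑ v : t, ξ v + 1 = t.ncard := by
  let F : Option (Σ v : t, Fin (ξ v)) → t := fun o => o.elim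
    ⟨[], by rw [ht]; exact nil_mem_treeOfOffspring ξ⟩
    fun p => ⟨p.1 ++ [(p.2 : ℕ)], by
      have := (append_mem_treeOfOffspring ξ p.1 p.2).2 ⟨by rw [← ht]; exact p.1.2, p.2.2⟩
      rwa [← ht] at this⟩
  have hF : Function.Bijective F := by
    constructor
    · rintro (_ | ⟨v, i⟩) (_ | ⟨w, j⟩) heq
      · rfl
      · exact absurd (congrArg Subtype.val heq) (by simp [F])
      · exact absurd (congrArg Subtype.val heq) (by simp [F])
      · have h1 : (v : List ℕ) ++ [(i : ℕ)] = (w : List ℕ) ++ [(j : ℕ)] :=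
          congrArg Subtype.val heq
        obtain ⟨h2, h3⟩ := List.append_inj' h1 rfl
        obtain rfl : v = w := Subtype.ext h2
        rw [Fin.ext (List.cons.inj h3).1]
    · rintro ⟨w, hw⟩
      rcases List.eq_nil_or_concat w with rfl | ⟨v, i, rfl⟩
      · exact ⟨none, rfl⟩
      · rw [List.concat_eq_append] at hw
        obtain ⟨h1, h2⟩ := (append_mem_treeOfOffspring _ _ _).1 (ht ▸ hw)
        exact ⟨some ⟨⟨v, ht ▸ h1⟩, ⟨i, h2⟩⟩, by simp [F]⟩
  rw [MapData.ncard_eq_card, ← Nat.card_congr (Equiv.ofBijective F hF), Finite.card_option,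
    Nat.card_sigma]
  simp

namespace HalfEdgeOrder

variable {c : HalfEdgeOrder} {k : List ℕ → ℕ}

/-- The factor between the laws of the two trees. -/
noncomputable def treeFactor (u : ℝ) (n : ℕ) : ℝ :=
  yOf u ^ n * mCoeff n u / (u * B (yOf u) + 1 - u) ^ (2 * n + 1)

theorem treeFactor_pos {u : ℝ} (hu : 0 < u) (n : ℕ) : 0 < treeFactor u n :=
  div_pos (mul_pos (pow_pos (yOf_spec hu).1 _) (mCoeff_pos n hu)) (pow_pos (partition_pos hu) _)

/-- With 2n + 1 nodes the k_v sum to n. So the powers of y and of the normalization depend on n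
only, and what remains is the number of maps with this tree times their common weight. -/
theorem prod_offspringWeight {n : ℕ} {u : ℝ} (hu : 0 < u) {t : Set (List ℕ)}
    (ht : t = treeOfOffspring fun v => 2 * k v) [Fintype t] (hk : ∀ v, v ∉ t → k v = 0)
    (hn : t.ncard = 2 * n + 1) :
    ∏ v : t, offspringWeight u (k v) = treeFactor u n *
      ((c.fiber k).ncard * (u ^ {v ∈ t | k v ≠ 0}.ncard / mCoeff n u)) := by
  classical
  have h1 := ncard_fiber_inter (c := c) ht hk fun _ => Set.univ
  simp only [Set.preimage_univ, Set.iInter_univ, Set.inter_univ] at h1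
  have h2 := sum_offspring ht
  rw [← Finset.mul_sum, hn] at h2
  have h3 : ∑ v : t, k v = n := by omega
  have h4 : Fintype.card t = 2 * n + 1 := by
    rw [← hn, MapData.ncard_eq_card, Nat.card_eq_fintype_card]
  have h5 : ∏ v : t, (if k v = 0 then 1 else u) = u ^ {v ∈ t | k v ≠ 0}.ncard := by
    rw [Finset.prod_ite, Finset.prod_const_one, one_mul, Finset.prod_const]
    congr 1
    rw [← Set.ncard_coe_finset, ← Set.ncard_image_of_injective _ Subtype.val_injective]
    congr 1
    ext v
    simp [and_comm]
  simp only [offspringWeight]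
  rw [Finset.prod_div_distrib, Finset.prod_mul_distrib, Finset.prod_mul_distrib,
    Finset.prod_pow_eq_pow_sum, h3, h5, Finset.prod_const, Finset.card_univ, h4, h1, Nat.cast_prod,
    treeFactor]
  have := (mCoeff_pos n hu).ne'
  have := (pow_pos (partition_pos hu) (2 * n + 1)).ne'
  simp only [bCoeff]
  field_simp

theorem galtonWatson_eq {n : ℕ} {u : ℝ} (hu : 0 < u) [IsProbabilityMeasure (offspring u)]
    {t : Set (List ℕ)} (hn : t.encard = 2 * n + 1) :
    galtonWatson (offspring u) {t} =
      ENNReal.ofReal (treeFactor u n) * blockLaw n u (c.blockTree ⁻¹' {t}) := by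
  classical
  have hfin : t.Finite := Set.finite_of_encard_eq_coe (k := 2 * n + 1) (by exact_mod_cast hn)
  have := hfin.fintype
  have hn' : t.ncard = 2 * n + 1 := by
    have h := hfin.cast_ncard_eq
    rw [hn] at h
    exact_mod_cast h
  by_cases hk : ∃ k : List ℕ → ℕ, t = (treeOfOffspring fun v => 2 * k v) ∧ ∀ v, v ∉ t → k v = 0
  · obtain ⟨k, ht, hk⟩ := hk
    have h0 := blockLaw_fiber_inter (c := c) (u := u) ht hk hn Set.univ
    rw [Set.inter_univ, Set.inter_univ] at h0
    rw [h0, ← ENNReal.ofReal_mul (treeFactor_pos hu n).le,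
      ← prod_offspringWeight (c := c) hu ht hk hn', galtonWatson_singleton _ ht,
      ENNReal.ofReal_prod_of_nonneg fun v _ => offspringWeight_nonneg hu _]
    exact Finset.prod_congr rfl fun v _ => offspring_two_mul u _
  · have h0 : blockLaw n u (c.blockTree ⁻¹' {t}) = 0 := by
      have := blockLaw_apply (n := n) (u := u) (b := 0) (F := ∅) (A := c.blockTree ⁻¹' {t})
        (fun q => by
          refine ⟨fun h => h.elim, fun ⟨h1, h2⟩ => hk ?_⟩
          obtain ⟨k, h3, h4⟩ := exists_eq_treeOfOffspring (c := c) h1.1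
          rw [Set.mem_preimage, Set.mem_singleton_iff] at h2
          rw [h2] at h3 h4
          exact ⟨k, h3, h4⟩) (fun _ h => h.elim)
      rw [this, Set.ncard_empty, Nat.cast_zero, zero_mul, ENNReal.ofReal_zero]
    rw [h0, mul_zero]
    -- A tree that is no block tree has a node with an odd number of children, and thus
    -- Galton–Watson weight 0, or is not a plane tree at all.
    by_cases hξ : ∃ ξ : List ℕ → ℕ, treeOfOffspring ξ = t
    · obtain ⟨ξ, ht⟩ := hξ
      rw [galtonWatson_singleton _ ht.symm, Finset.prod_eq_zero_iff]
      by_contra hne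
      refine hk ⟨fun v => if v ∈ t then ξ v / 2 else 0, ?_, fun v hv => if_neg hv⟩
      refine ht.symm.trans (treeOfOffspring_congr fun v hv => ?_)
      rw [ht] at hv
      beta_reduce
      rw [if_pos hv]
      by_contra hodd
      exact hne ⟨⟨v, hv⟩, Finset.mem_univ _, offspring_odd u fun h => hodd (by
        have h' : 2 ∣ ξ v := h
        omega)⟩
    · rw [galtonWatson, Measure.map_apply measurable_treeOfOffspring (MeasurableSet.singleton _)]
      have : treeOfOffspring ⁻¹' {t} = ∅ :=
        Set.eq_empty_of_forall_notMem fun ξ h => hξ ⟨ξ, h⟩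
      rw [this, measure_empty]

theorem encard_blockTree {q : MapClass} {n : ℕ} (hq : q ∈ maps n) :
    (c.blockTree q).encard = 2 * n + 1 := by
  obtain ⟨h1, h2, -⟩ := c.blockTree_spec hq.1
  rw [← h1.cast_ncard_eq, h2, hq.2]
  push_cast
  rfl

theorem measure_eq_of_countable {Ω : Type*} [MeasurableSpace Ω] [MeasurableSingletonClass Ω]
    {μ ν : Measure Ω} {K : ENNReal} {S : Set Ω} (hS : S.Countable)
    (h : ∀ x ∈ S, μ {x} = K * ν {x}) : μ S = K * ν S := by
  have key : ∀ μ : Measure Ω, μ S = ∑' x : S, μ {(x : Ω)} := by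
    intro μ
    rw [← measure_biUnion hS (fun x _ y _ hxy => Set.disjoint_singleton.2 hxy)
      (fun x _ => MeasurableSet.singleton x), Set.biUnion_of_singleton]
  rw [key μ, key ν, ← ENNReal.tsum_mul_left]
  exact tsum_congr fun x => h x x.2

theorem map_blockTree (c : HalfEdgeOrder) {u : ℝ} (hu : 0 < u)
    [IsProbabilityMeasure (offspring u)] (n : ℕ) :
    (blockLaw n u).map c.blockTree = galtonWatsonCond (offspring u) (2 * n) := by
  have := isProbabilityMeasure_blockLaw n hu
  have hmeas : Measurable c.blockTree := fun _ _ => MapClass.measurableSet _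
  set C : Set (Set (List ℕ)) := {t | t.encard = 2 * n + 1} with hC
  have hCc : C.Countable := by
    refine (Set.countable_ofPred_finite_subset (s := (Set.univ : Set (List ℕ)))
      Set.countable_univ).mono fun t ht => ?_
    refine Set.mem_ofPred_eq.symm ▸ ⟨?_, Set.subset_univ t⟩
    exact Set.finite_of_encard_eq_coe (k := 2 * n + 1) (by exact_mod_cast ht)
  have hfull : (blockLaw n u).map c.blockTree Cᶜ = 0 := by
    rw [Measure.map_apply hmeas hCc.measurableSet.compl]
    have := blockLaw_apply (n := n) (u := u) (b := 0) (F := ∅) (A := c.blockTree ⁻¹' Cᶜ)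
      (fun q => ⟨fun h => h.elim, fun ⟨h1, h2⟩ => h2 (encard_blockTree h1)⟩) (fun _ h => h.elim)
    rw [this, Set.ncard_empty, Nat.cast_zero, zero_mul, ENNReal.ofReal_zero]
  have hprob : IsProbabilityMeasure ((blockLaw n u).map c.blockTree) :=
    Measure.isProbabilityMeasure_map hmeas.aemeasurable
  -- Proportionality on singletons extends to all sets of trees with 2n edges, since there are only
  -- countably many such trees.
  have key : ∀ A, galtonWatson (offspring u) (C ∩ A) =
      ENNReal.ofReal (treeFactor u n) * (blockLaw n u).map c.blockTree (C ∩ A) := by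
    intro A
    refine measure_eq_of_countable (hCc.mono Set.inter_subset_left) fun t ht => ?_
    rw [Measure.map_apply hmeas (MeasurableSet.singleton t)]
    exact galtonWatson_eq hu ht.1
  have hK : ENNReal.ofReal (treeFactor u n) ≠ 0 := by
    simpa using treeFactor_pos hu n
  have hinter : ∀ A, (blockLaw n u).map c.blockTree (C ∩ A) =
      (blockLaw n u).map c.blockTree A := by
    intro A
    rw [Set.inter_comm]
    exact measure_inter_conull hfull
  -- As the block law has total mass 1 and charges only such trees, the factor is the probability of
  -- the conditioning event, which is therefore positive.
  have hC1 : galtonWatson (offspring u) C = ENNReal.ofReal (treeFactor u n) := by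
    have := key Set.univ
    rwa [hinter, measure_univ, mul_one, Set.inter_univ] at this
  refine Measure.ext fun A _ => ?_
  have hcond : galtonWatsonCond (offspring u) (2 * n) = cond (galtonWatson (offspring u)) C := by
    rw [galtonWatsonCond, hC]
    push_cast
    rfl
  rw [hcond, cond_apply hCc.measurableSet, key, hC1, hinter, ← mul_assoc,
    ENNReal.inv_mul_cancel hK ENNReal.ofReal_ne_top, one_mul]

end HalfEdgeOrder

end TreeRooted

/-! ### The main theorem. -/

theorem mainTheorem9 (c : TreeRooted.HalfEdgeOrder) (u : ℝ) (hu : 0 < u) (n : ℕ) :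
    -- the offspring law and the block-weighted law are probability measures
    ∃ _ : IsProbabilityMeasure (TreeRooted.offspring u),
      IsProbabilityMeasure (TreeRooted.blockLaw n u) ∧
      -- the block tree is a conditioned Bienaymé–Galton–Watson tree
      (TreeRooted.blockLaw n u).map c.blockTree =
        TreeRooted.galtonWatsonCond (TreeRooted.offspring u) (2 * n) ∧
      -- given the block tree, the blocks are independent and uniform
      ∀ t : Set (List ℕ), TreeRooted.blockLaw n u (c.blockTree ⁻¹' {t}) ≠ 0 →
        iIndepFun (fun (v : t) (q : TreeRooted.MapClass) => c.block v q)
          (cond (TreeRooted.blockLaw n u) (c.blockTree ⁻¹' {t})) ∧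
        ∀ v ∈ t, ∃ k : ℕ, TreeRooted.numChildren t v = 2 * k ∧
          (cond (TreeRooted.blockLaw n u) (c.blockTree ⁻¹' {t})).map (c.block v) =
            uniformOn (TreeRooted.twoConnectedMaps k) := by
  open TreeRooted HalfEdgeOrder in
  have hprob := isProbabilityMeasure_offspring hu
  refine ⟨hprob, isProbabilityMeasure_blockLaw n hu, c.map_blockTree hu n, fun t ht => ?_⟩
  -- A tree of positive probability is the block tree of some map. This makes it a plane tree with
  -- even offspring and 2n edges, so the fiber description applies.
  obtain ⟨q, hq, hqt⟩ : ∃ q ∈ maps n, c.blockTree q = t := by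
    by_contra hn
    push Not at hn
    refine ht ?_
    rw [blockLaw_apply (b := 0) (F := ∅) (A := c.blockTree ⁻¹' {t})
      (fun q => ⟨fun h => h.elim, fun ⟨h1, h2⟩ => hn q h1 h2⟩) (fun _ h => h.elim), Set.ncard_empty, Nat.cast_zero, zero_mul, ENNReal.ofReal_zero]
  obtain ⟨k, hk, hk0⟩ := exists_eq_treeOfOffspring (c := c) hq.1
  have hn := encard_blockTree (c := c) hq
  rw [hqt] at hk hk0 hn
  have hfin : t.Finite := hqt ▸ (c.blockTree_spec hq.1).1
  rw [cond_blockLaw hu hk hk0 hn ⟨q, (mem_fiber_iff hk hk0 hn).2 ⟨hq, hqt⟩⟩]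
  refine ⟨iIndepFun_block hk hfin hk0, fun v hv => ⟨k v, ?_, ?_⟩⟩
  · have := numChildren_treeOfOffspring (hk ▸ hv : v ∈ treeOfOffspring fun v => 2 * k v)
    rwa [← hk] at this
  · refine Measure.ext fun s _ => ?_
    rw [Measure.map_apply (fun _ _ => MapClass.measurableSet _) (by assumption)]
    exact uniformOn_fiber_preimage hk hfin hk0 ⟨v, hv⟩ s
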